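/- **Setting.** Let $G$ be an oriented framed trivalent graph in $S^3$ without sources and sinks (components that are circles without vertices are allowed), and let $c$ be a positive balanced coloring: a positive integer $c(e)$ for each edge $e$ such that at every vertex the sum of the colors of the incoming edges equals the sum of the colors of the outgoing edges. Let $D$ be a diagram of $G$ in the plane, in which the difference between the framing of $G$ and the blackboard framing is marked by positive and negative half-twist symbols on the edges. Let $V$ be the set of vertices. *State sum.* Draw a small circle around every vertex. The generalized crossings are the crossings of $D$ and the points where an edge enters the circle around its end vertex; the generalized regions are the regions of the plane cut by $D$ and the circle regions. With all strands drawn upward, a crossing has four corners N, S, W, E, and an entering point has three corners, N (inside the circle), W and E (to the left and to the right of the edge). The weights of the corners are - $N:\,-t^{i}$, $S:\,1$, $W:\,t^{i}$, $E:\,1$ at a positive crossing (the strand from south-west to north-east is the upper one), where $i$ is the color of the upper strand; - $N:\,-t^{-i}$, $S:\,1$, $W:\,1$, $E:\,t^{-i}$ at a negative crossing, where $i$ is the color of the upper strand; - $N:\,t^{i/2}-t^{-i/2}$, $W:\,t^{i/2}$, $E:\,t^{-i/2}$ at an entering point of an edge of color $i$. For an initial point $\delta$ on an edge of $D$, a state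 is a choice of one corner at each generalized crossing such that each generalized region not adjacent to $\delta$ contains exactly one chosen corner and the regions adjacent to $\delta$ contain none. $\langle D\mid\delta\rangle$ is the sum over all states of the product of the weights of the chosen corners; it is $0$ if there is no state, in particular if $D$ is disconnected. *Normalization.* The index of a region is $0$ on the unbounded region and increases by $c(e)$ when $e$ is crossed from its left to its right. If the regions to the left and to the right of $\delta$ have indices $n$ and $n+i$, let $|\delta|=t^{n+i}-t^{n}$. Let $\mathcal F(D)=\prod_e t^{\frac{c(e)}{4}(p(e)-n(e))}$, where $p(e)$ and $n(e)$ are the numbers of positive and negative half-twist symbols on $e$. Replace every edge $e$ by $c(e)$ parallel strands, joined at the vertices without crossings, and resolve all crossings in the oriented way; let $\mathcal C(D,c)=t^{\frac12(a-b)}$, where $a$ and $b$ are the numbers of clockwise and of counterclockwise circles obtained. The normalized Alexander polynomial is $$\Delta_{(G,c)}(t)=\Delta_{(D,c)}(t)=\frac{\mathcal F(D)\,\mathcal C(D,c)}{|\delta|\,(t^{1/2}-t^{-1/2})^{|V|-1}}\,\langle D\mid\delta\rangle ,$$ a rational function of $t^{1/4}$. *Mirror image and reversal.* The mirror image $G^*$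 is given by the diagram $D^*$ obtained from $D$ by exchanging positive and negative crossings and exchanging positive and negative half twists. $-G$ is given by the diagram $-D$ obtained from $D$ by reversing the orientations of all edges. **Proposition.** For every such diagram $D$ and coloring $c$, and for all choices of the initial points on the two sides of each equation, 1. $\Delta_{(D,c)}(t)=\Delta_{(D^*,c)}(t^{-1})$, that is, $\Delta_{(G,c)}(t)=\Delta_{(G^*,c)}(t^{-1})$; 2. $\Delta_{(D,c)}(t)=\Delta_{(-D,c)}(t)$, that is, $\Delta_{(G,c)}(t)=\Delta_{(-G,c)}(t)$. In particular, if $G$ is planar, that is, given by a diagram $D$ without crossings whose framing is that of the plane (on each edge as many positive as negative half twists), then $\Delta_{(G,c)}(t)=\Delta_{(G,c)}(t^{-1})$, with $\Delta_{(G,c)}=\Delta_{(D,c)}$. -/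

import Mathlib

/-!
Diagrams of oriented framed trivalent graphs are encoded as planar combinatorial maps.
Every crossing and every vertex is drawn with its strands running upward, which fixes what
"left", "right", "north", "south", "west" and "east" mean there.
-/

namespace MOY

/-- The places where an oriented arc of a diagram can end. At a crossing `x` the arcs `crossL x`
and `crossR x` come in from the south-west and from the south-east. A vertex of type `M` (merge)
has two incoming edges (the left one and the right one) and one outgoing edge, and a vertex of
type `S` (split) has one incoming and two outgoing edges. -/
inductive InPort (X M S : Type) : Type
  | crossL (x : X) : InPort X M S
  | crossR (x : X) : InPort X M S
  | mergeL (m : M) : InPort X M S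
  | mergeR (m : M) : InPort X M S
  | split (s : S) : InPort X M S

/-- The places where an oriented arc of a diagram can start. At a crossing `x` the arcs `crossL x`
and `crossR x` leave to the north-west and to the north-east. -/
inductive OutPort (X M S : Type) : Type
  | crossL (x : X) : OutPort X M S
  | crossR (x : X) : OutPort X M S
  | merge (m : M) : OutPort X M S
  | splitL (s : S) : OutPort X M S
  | splitR (s : S) : OutPort X M S

/-- Reversal of all orientations: each crossing and vertex is turned by half a turn, so that its
strands run upward again. Merges become splits, left and right are exchanged. -/
def reversePort (X M S : Type) : InPort X M S ≃ OutPort X S M where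
  toFun
    | .crossL x => .crossR x
    | .crossR x => .crossL x
    | .mergeL m => .splitR m
    | .mergeR m => .splitL m
    | .split s => .merge s
  invFun
    | .crossL x => .crossR x
    | .crossR x => .crossL x
    | .splitR m => .mergeL m
    | .splitL m => .mergeR m
    | .merge s => .split s
  left_inv p := by cases p <;> rfl
  right_inv p := by cases p <;> rfl

/-- The two sides of an oriented curve. -/
inductive Side (P : Type) : Type
  | left (e : P) : Side P
  | right (e : P) : Side P

/-- Exchange the two sides. -/
def Side.flip {P : Type} : Side P → Side P
  | .left e => .right e
  | .right e => .left e

theorem Side.flip_flip {P : Type} (a : Side P) : a.flip.flip = a := by cases a <;> rfl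

/-- The underlying oriented curve system with its crossings and trivalent vertices (each vertex has
in- and outdegree at least one). Cutting the diagram at all crossings and vertices leaves the
arcs `Arc` and the circles `Loop` without crossings and vertices. -/
structure Wiring where
  /-- the crossings (double points) -/
  X : Type
  /-- the vertices with two incoming edges -/
  M : Type
  /-- the vertices with two outgoing edges -/
  S : Type
  /-- the arcs between consecutive crossings or vertices -/
  Arc : Type
  /-- the circles that pass through no crossing and no vertex -/
  Loop : Type
  fintypeX : Fintype X
  fintypeM : Fintype M
  fintypeS : Fintype S
  fintypeArc : Fintype Arc
  fintypeLoop : Fintype Loop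
  /-- where an arc starts -/
  tail : Arc ≃ OutPort X M S
  /-- where an arc ends -/
  head : Arc ≃ InPort X M S

attribute [instance] Wiring.fintypeX Wiring.fintypeM Wiring.fintypeS Wiring.fintypeArc
  Wiring.fintypeLoop

namespace Wiring

variable (W : Wiring)

/-- The pieces of the diagram: arcs and free circles. -/
abbrev Piece : Type := W.Arc ⊕ W.Loop

/-- The vertices of the graph. -/
abbrev Vertex : Type := W.M ⊕ W.S

/-- The arc that arrives at a given place. -/
def into (p : InPort W.X W.M W.S) : W.Piece := Sum.inl (W.head.symm p)

/-- The arc that leaves from a given place. -/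
def outof (p : OutPort W.X W.M W.S) : W.Piece := Sum.inl (W.tail.symm p)

/-- Two sides of arcs bound a common corner at a crossing or a vertex. -/
inductive SameCorner : Side W.Piece → Side W.Piece → Prop
  | crossW (x : W.X) : SameCorner (.left (W.into (.crossL x))) (.left (W.outof (.crossL x)))
  | crossN (x : W.X) : SameCorner (.right (W.outof (.crossL x))) (.left (W.outof (.crossR x)))
  | crossE (x : W.X) : SameCorner (.right (W.outof (.crossR x))) (.right (W.into (.crossR x)))
  | crossS (x : W.X) : SameCorner (.left (W.into (.crossR x))) (.right (W.into (.crossL x)))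
  | mergeW (m : W.M) : SameCorner (.left (W.into (.mergeL m))) (.left (W.outof (.merge m)))
  | mergeE (m : W.M) : SameCorner (.right (W.outof (.merge m))) (.right (W.into (.mergeR m)))
  | mergeS (m : W.M) : SameCorner (.left (W.into (.mergeR m))) (.right (W.into (.mergeL m)))
  | splitW (s : W.S) : SameCorner (.left (W.into (.split s))) (.left (W.outof (.splitL s)))
  | splitN (s : W.S) : SameCorner (.right (W.outof (.splitL s))) (.left (W.outof (.splitR s)))
  | splitE (s : W.S) : SameCorner (.right (W.outof (.splitR s))) (.right (W.into (.split s)))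

/-- The boundary curves of the regions: classes of sides under the relation generated by
`SameCorner`. A region has one boundary curve for each component of the diagram next to it. -/
def BoundaryCurve : Type := Quot W.SameCorner

/-- The same curves with all orientations reversed. -/
def reverse : Wiring where
  X := W.X
  M := W.S
  S := W.M
  Arc := W.Arc
  Loop := W.Loop
  fintypeX := W.fintypeX
  fintypeM := W.fintypeS
  fintypeS := W.fintypeM
  fintypeArc := W.fintypeArc
  fintypeLoop := W.fintypeLoop
  tail := W.head.trans (reversePort W.X W.M W.S)
  head := W.tail.trans (reversePort W.X W.S W.M).symm

theorem sameCorner_of_reverse {a b : Side W.reverse.Piece} (h : W.reverse.SameCorner a b) :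
    W.SameCorner (Side.flip a : Side W.Piece) (Side.flip b : Side W.Piece) := by
  cases h with
  | crossW x => exact SameCorner.crossE (W := W) x
  | crossN x => exact SameCorner.crossS (W := W) x
  | crossE x => exact SameCorner.crossW (W := W) x
  | crossS x => exact SameCorner.crossN (W := W) x
  | mergeW m => exact SameCorner.splitE (W := W) m
  | mergeE m => exact SameCorner.splitW (W := W) m
  | mergeS m => exact SameCorner.splitN (W := W) m
  | splitW s => exact SameCorner.mergeE (W := W) s
  | splitN s => exact SameCorner.mergeS (W := W) s
  | splitE s => exact SameCorner.mergeW (W := W) s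

theorem sameCorner_reverse {a b : Side W.Piece} (h : W.SameCorner a b) :
    W.reverse.SameCorner (Side.flip a : Side W.Piece) (Side.flip b : Side W.Piece) := by
  cases h with
  | crossW x => exact SameCorner.crossE (W := W.reverse) x
  | crossN x => exact SameCorner.crossS (W := W.reverse) x
  | crossE x => exact SameCorner.crossW (W := W.reverse) x
  | crossS x => exact SameCorner.crossN (W := W.reverse) x
  | mergeW m => exact SameCorner.splitE (W := W.reverse) m
  | mergeE m => exact SameCorner.splitW (W := W.reverse) m
  | mergeS m => exact SameCorner.splitN (W := W.reverse) m
  | splitW s => exact SameCorner.mergeE (W := W.reverse) s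
  | splitN s => exact SameCorner.mergeS (W := W.reverse) s
  | splitE s => exact SameCorner.mergeW (W := W.reverse) s

theorem card_boundaryCurve_reverse : Nat.card W.reverse.BoundaryCurve = Nat.card W.BoundaryCurve :=
  Nat.card_congr
    { toFun := Quot.lift (fun a : Side W.Piece => Quot.mk W.SameCorner a.flip)
        (fun _ _ h => Quot.sound (W.sameCorner_of_reverse h))
      invFun := Quot.lift (fun a : Side W.Piece => Quot.mk W.reverse.SameCorner a.flip)
        (fun _ _ h => Quot.sound (W.sameCorner_reverse h))
      left_inv := by
        rintro ⟨a⟩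
        exact congrArg (Quot.mk W.reverse.SameCorner) (Side.flip_flip a)
      right_inv := by
        rintro ⟨a⟩
        exact congrArg (Quot.mk W.SameCorner) (Side.flip_flip a) }

end Wiring

/-- A diagram in the plane of a framed trivalent graph without sources and sinks.

`Region` is the set of regions of the plane cut by the diagram. Glue, for each region, a sphere with
one hole for each of its boundary curves to the diagram. The result is a closed oriented surface
with Euler characteristic
`#crossings + #vertices - #arcs + 2 * #Region - #BoundaryCurve`
(free circles contribute `0`), which is connected iff any two regions can be joined by passing
through arcs and circles. So `connected` and `euler` say that the surface is a sphere, that is, that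
this is a diagram on the sphere; the diagram itself may be disconnected. The point at infinity is
put in the region `outer`, which becomes the unbounded region of the plane. -/
structure Diagram extends Wiring where
  Region : Type
  fintypeRegion : Fintype Region
  /-- the region next to a given side of a piece -/
  region : Side toWiring.Piece → Region
  region_eq : ∀ {a b}, toWiring.SameCorner a b → region a = region b
  connected : ∀ r r' : Region,
    Relation.EqvGen (fun r₁ r₂ => ∃ e, region (.left e) = r₁ ∧ region (.right e) = r₂) r r'
  euler : (Fintype.card X + Fintype.card toWiring.Vertex : ℤ) - Fintype.card Arc
    + 2 * Fintype.card Region - Nat.card toWiring.BoundaryCurve = 2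
  /-- the unbounded region -/
  outer : Region
  /-- `true` at a positive crossing, where the strand from south-west to north-east is the upper
  one; `false` at a negative crossing, where the strand from south-east to north-west is. -/
  positive : X → Bool
  /-- the number of symbols for a positive half twist of the framing (relative to the blackboard
  framing) on a piece -/
  posTwist : toWiring.Piece → ℕ
  /-- the number of symbols for a negative half twist of the framing on a piece -/
  negTwist : toWiring.Piece → ℕ

attribute [instance] Diagram.fintypeRegion

/-- The four corners of a crossing. -/
inductive Corner : Type
  | N | S | W | E
  deriving DecidableEq

instance : Fintype Corner where
  elems := {.N, .S, .W, .E}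
  complete := by intro a; cases a <;> decide

/-- The three corners at the point where an edge enters the circle region around its end vertex:
the corner inside the circle region, and the ones to the left and to the right of the edge. -/
inductive CircleCorner : Type
  | N | W | E
  deriving DecidableEq

instance : Fintype CircleCorner where
  elems := {.N, .W, .E}
  complete := by intro a; cases a <;> decide

/-- `tq k` is `t ^ (k / 4)`. All rational functions of `t ^ (1 / 4)` are written as elements of
`RatFunc ℚ`, whose variable `RatFunc.X` stands for `t ^ (1 / 4)`. -/
noncomputable def tq (k : ℤ) : RatFunc ℚ := RatFunc.X ^ k

/-- The substitution of `t⁻¹` for `t`. -/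
noncomputable def invT (f : RatFunc ℚ) : RatFunc ℚ := RatFunc.eval RatFunc.C (RatFunc.X)⁻¹ f

namespace Diagram

variable (D : Diagram)

/-- The region to the left of a piece. -/
def leftR (e : D.Piece) : D.Region := D.region (.left e)

/-- The region to the right of a piece. -/
def rightR (e : D.Piece) : D.Region := D.region (.right e)

/-- The mirror image: each crossing is changed into one of the opposite sign, and each half twist
of the framing into one of the opposite sign. -/
def mirror : Diagram :=
  { D with
    positive := fun x => !D.positive x
    posTwist := D.negTwist
    negTwist := D.posTwist }

/-- The diagram with the orientations of all edges reversed. Signs of crossings and of half twists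
do not change. -/
def reverse : Diagram where
  toWiring := D.toWiring.reverse
  Region := D.Region
  fintypeRegion := D.fintypeRegion
  region := fun a : Side D.Piece => D.region a.flip
  region_eq := fun h => D.region_eq (D.toWiring.sameCorner_of_reverse h)
  connected := fun r r' => by
    have key : ∀ a b : D.Region,
        Relation.EqvGen (fun r₁ r₂ => ∃ e : D.Piece,
          D.region (.left e) = r₁ ∧ D.region (.right e) = r₂) a b →
        Relation.EqvGen (fun r₁ r₂ => ∃ e : D.Piece,
          D.region (.right e) = r₁ ∧ D.region (.left e) = r₂) a b := by
      intro a b h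
      induction h with
      | rel a b h =>
        obtain ⟨e, h₁, h₂⟩ := h
        exact .symm _ _ (.rel _ _ ⟨e, h₂, h₁⟩)
      | refl a => exact .refl a
      | symm a b _ ih => exact .symm _ _ ih
      | trans a b c _ _ ih₁ ih₂ => exact .trans _ _ _ ih₁ ih₂
    exact key r r' (D.connected r r')
  euler := by
    have h := D.euler
    rw [← D.toWiring.card_boundaryCurve_reverse] at h
    have hV : Fintype.card D.toWiring.reverse.Vertex = Fintype.card D.Vertex :=
      Fintype.card_congr (Equiv.sumComm D.S D.M)
    rw [hV]
    exact h
  outer := D.outer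
  positive := D.positive
  posTwist := D.posTwist
  negTwist := D.negTwist

/-- The diagram has no crossing, and its framing is the one given by the plane: on every edge
the half twists cancel. -/
def IsPlanar : Prop := IsEmpty D.X ∧ ∀ e, D.posTwist e = D.negTwist e

/-- A positive balanced coloring: a positive integer for each edge of the graph (so that it does
not change where an edge passes through a crossing), such that at each vertex the sum over the
incoming edges equals the sum over the outgoing edges. -/
structure PosColoring where
  color : D.Piece → ℤ
  pos : ∀ e, 0 < color e
  cross₁ : ∀ x, color (D.into (.crossL x)) = color (D.outof (.crossR x))
  cross₂ : ∀ x, color (D.into (.crossR x)) = color (D.outof (.crossL x))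
  merge : ∀ m, color (D.into (.mergeL m)) + color (D.into (.mergeR m))
    = color (D.outof (.merge m))
  split : ∀ s, color (D.into (.split s))
    = color (D.outof (.splitL s)) + color (D.outof (.splitR s))

variable {D}

/-- The same coloring on the mirror image. -/
def PosColoring.mirror (c : D.PosColoring) : D.mirror.PosColoring where
  color := c.color
  pos := c.pos
  cross₁ := c.cross₁
  cross₂ := c.cross₂
  merge := c.merge
  split := c.split

/-- The same coloring for the reversed orientation. -/
def PosColoring.reverse (c : D.PosColoring) : D.reverse.PosColoring where
  color := c.color
  pos := c.pos
  cross₁ := fun x => (c.cross₁ x).symm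
  cross₂ := fun x => (c.cross₂ x).symm
  merge := fun s => by
    rw [add_comm]
    exact (c.split s).symm
  split := fun m => by
    have h := (c.merge m).symm
    rw [add_comm] at h
    exact h

/-! ### The state sum -/

variable (D)

/-- The points where an edge enters the circle region around its end vertex: the left one and the
right one at a merge, and the one at a split. -/
abbrev CirclePoint : Type := (D.M ⊕ D.M) ⊕ D.S

/-- The generalized crossings. -/
abbrev Cr : Type := D.X ⊕ D.CirclePoint

/-- The generalized regions: the regions of the plane and the circle regions around the
vertices. -/
abbrev Re : Type := D.Region ⊕ D.Vertex

variable {D}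

/-- The vertex at which a circle point lies. -/
def CirclePoint.vertex : D.CirclePoint → D.Vertex
  | .inl (.inl m) => .inl m
  | .inl (.inr m) => .inl m
  | .inr s => .inr s

/-- The edge (its last arc) that enters the circle region at a circle point. -/
def CirclePoint.arc : D.CirclePoint → D.Piece
  | .inl (.inl m) => D.into (.mergeL m)
  | .inl (.inr m) => D.into (.mergeR m)
  | .inr s => D.into (.split s)

variable (D)

/-- The region that contains a given corner of a crossing. -/
def crossRegion (x : D.X) : Corner → D.Re
  | .N => .inl (D.rightR (D.outof (.crossL x)))
  | .S => .inl (D.rightR (D.into (.crossL x)))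
  | .W => .inl (D.leftR (D.into (.crossL x)))
  | .E => .inl (D.rightR (D.into (.crossR x)))

/-- The region that contains a given corner of a circle point. -/
def circleRegion (p : D.CirclePoint) : CircleCorner → D.Re
  | .N => .inr (CirclePoint.vertex p)
  | .W => .inl (D.leftR (CirclePoint.arc p))
  | .E => .inl (D.rightR (CirclePoint.arc p))

/-- A choice of a corner at each generalized crossing. -/
abbrev CornerChoice : Type := (D.X → Corner) × (D.CirclePoint → CircleCorner)

/-- The region chosen for each generalized crossing. -/
def chosenRegion (s : D.CornerChoice) : D.Cr → D.Re
  | .inl x => D.crossRegion x (s.1 x)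
  | .inr p => D.circleRegion p (s.2 p)

/-- `s` is a Kauffman state of the diagram with the initial point on the piece `δ`: every region
that is not adjacent to `δ` contains exactly one chosen corner, the two others none. If the
diagram is disconnected or the two sides of `δ` lie in one region, then there are more unmarked
regions than crossings, so there is no state. -/
def IsState (δ : D.Piece) (s : D.CornerChoice) : Prop :=
  Set.BijOn (D.chosenRegion s) Set.univ {r | r ≠ .inl (D.leftR δ) ∧ r ≠ .inl (D.rightR δ)}

variable {D} (c : D.PosColoring)

/-- The color of the upper strand of a crossing. -/
def overColor (x : D.X) : ℤ :=
  if D.positive x then c.color (D.into (.crossL x)) else c.color (D.into (.crossR x))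

/-- The local sign of a corner of a crossing. The sign of each corner of a circle point is `1`. -/
noncomputable def signM : Corner → RatFunc ℚ
  | .N => -1
  | .S => 1
  | .W => 1
  | .E => 1

/-- The local weight of a corner of a crossing. -/
noncomputable def weightA (x : D.X) : Corner → RatFunc ℚ
  | .N => if D.positive x then tq (4 * overColor c x) else tq (-(4 * overColor c x))
  | .S => 1
  | .W => if D.positive x then tq (4 * overColor c x) else 1
  | .E => if D.positive x then 1 else tq (-(4 * overColor c x))

/-- The local weight of a corner of a circle point. -/
noncomputable def circleWeightA (p : D.CirclePoint) : CircleCorner → RatFunc ℚ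
  | .N => tq (2 * c.color (CirclePoint.arc p)) - tq (-(2 * c.color (CirclePoint.arc p)))
  | .W => tq (2 * c.color (CirclePoint.arc p))
  | .E => tq (-(2 * c.color (CirclePoint.arc p)))

open Classical in
/-- The state sum. -/
noncomputable def stateSum (δ : D.Piece) : RatFunc ℚ :=
  ∑ s : D.CornerChoice with D.IsState δ s,
    (∏ x, signM (s.1 x) * weightA c x (s.1 x)) * ∏ p, circleWeightA c p (s.2 p)

/-- `f` is the index of the regions: it is `0` on the unbounded region, and it grows by the color
when an edge is crossed from left to right. -/
def IsIndex (f : D.Region → ℤ) : Prop :=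
  f D.outer = 0 ∧ ∀ e, f (D.rightR e) = f (D.leftR e) + c.color e

/-- The index of the regions, that is, the unique function with `IsIndex`. -/
noncomputable def index : D.Region → ℤ := Classical.epsilon (IsIndex c)

/-- The factor `|δ|` of an initial point: the regions next to it have indices `n` (on the left)
and `n + i` (on the right), and `|δ| = t ^ (n + i) - t ^ n`. -/
noncomputable def initialFactor (δ : D.Piece) : RatFunc ℚ :=
  tq (4 * index c (D.rightR δ)) - tq (4 * index c (D.leftR δ))

/-! ### Framing and curliness -/

/-- The framing factor: the product over all edges of
`t ^ (color / 4 * (#positive half twists - #negative half twists))`. -/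
noncomputable def framing : RatFunc ℚ :=
  ∏ e : D.Piece, tq (c.color e * ((D.posTwist e : ℤ) - (D.negTwist e : ℤ)))

/-- The strands of the link diagram in which each edge of color `i` is replaced by `i` parallel
strands, numbered from left to right. -/
abbrev Strand : Type := Σ e : D.Piece, Fin (c.color e).toNat

/-- The crossing or vertex at which an arc ends, and the position of its `k`-th strand among all
strands that arrive there, from left to right. -/
def headPos (a : D.Arc) (k : ℕ) : (D.X ⊕ D.Vertex) × ℕ :=
  match D.head a with
  | .crossL x => (.inl x, k)
  | .crossR x => (.inl x, (c.color (D.into (.crossL x))).toNat + k)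
  | .mergeL m => (.inr (.inl m), k)
  | .mergeR m => (.inr (.inl m), (c.color (D.into (.mergeL m))).toNat + k)
  | .split s => (.inr (.inr s), k)

/-- The crossing or vertex at which an arc starts, and the position of its `k`-th strand among all
strands that leave from there, from left to right. -/
def tailPos (a : D.Arc) (k : ℕ) : (D.X ⊕ D.Vertex) × ℕ :=
  match D.tail a with
  | .crossL x => (.inl x, k)
  | .crossR x => (.inl x, (c.color (D.outof (.crossL x))).toNat + k)
  | .merge m => (.inr (.inl m), k)
  | .splitL s => (.inr (.inr s), k)
  | .splitR s => (.inr (.inr s), (c.color (D.outof (.splitL s))).toNat + k)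

/-- The strands are connected in order from left to right: at a vertex because the parallel strands
are joined without crossings, at a crossing because all crossings of the `i` strands with the `j`
strands are resolved in the oriented way. -/
inductive Joined : Strand c → Strand c → Prop
  | mk (a b : D.Arc) (k : Fin (c.color (.inl a)).toNat) (l : Fin (c.color (.inl b)).toNat)
      (h : headPos c a k = tailPos c b l) : Joined ⟨.inl a, k⟩ ⟨.inl b, l⟩

/-- The oriented closed curves that result from resolving the crossings in the oriented way. -/
def ResolvedCircle : Type := Quot (Joined c)

/-- How often a resolved circle runs along a piece. -/
noncomputable def mult (γ : ResolvedCircle c) (e : D.Piece) : ℕ :=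
  Nat.card {k : Fin (c.color e).toNat // Quot.mk (Joined c) ⟨e, k⟩ = γ}

/-- `w r` is the number of times that the resolved circle `γ` winds clockwise around the points of
the region `r`. -/
def IsWinding (γ : ResolvedCircle c) (w : D.Region → ℤ) : Prop :=
  w D.outer = 0 ∧ ∀ e, w (D.rightR e) = w (D.leftR e) + mult c γ e

/-- A resolved circle (a simple closed curve) is clockwise if it winds clockwise around the points
inside. -/
def IsClockwise (γ : ResolvedCircle c) : Prop := ∃ w, IsWinding c γ w ∧ ∀ r, 0 ≤ w r

/-- A resolved circle is counterclockwise. -/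
def IsCounterclockwise (γ : ResolvedCircle c) : Prop := ∃ w, IsWinding c γ w ∧ ∀ r, w r ≤ 0

/-- The colored curliness `t ^ ((#clockwise - #counterclockwise) / 2)`. -/
noncomputable def curliness : RatFunc ℚ :=
  tq (2 * ((Nat.card {γ : ResolvedCircle c // IsClockwise c γ} : ℤ)
    - (Nat.card {γ : ResolvedCircle c // IsCounterclockwise c γ} : ℤ)))

/-- The normalized Alexander polynomial, computed with the initial point on the piece `δ`. -/
noncomputable def alexander (δ : D.Piece) : RatFunc ℚ :=
  framing c * curliness c
    / (initialFactor c δ * (tq 2 - tq (-2)) ^ ((Fintype.card D.Vertex : ℤ) - 1))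
    * stateSum c δ

end Diagram

end MOY

/-! A state must choose the circle region of a split at its only circle point, and the circle region
of a merge at exactly one of its two circle points. So the state sum is a product of vertex factors
times a sum over choices of one corner at each crossing and each merge (`stateSum_eq_unit`). A
diagram that is not `Good` has no states and all its polynomials vanish. The rest concerns `Good`
diagrams, for which the reduced sum has two descriptions.

First, up to one common sign it is the determinant of the matrix of corner weights, taken with the
Kasteleyn signs `kappa` (`Good.exists_sign`). All states get the same sign because this determinant
has no zero at positive real weights. Indeed, for a kernel vector the number of sign changes across
arcs never decreases in passing through a crossing or vertex. The total over all arcs is the same at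
heads and at tails, so it is preserved everywhere, and then a zero on both sides of one piece
spreads over the whole diagram (`kernelVector_eq_zero`).

Second, for weights with `IsNormalized` it is the principal minor of `1 - walkMatrix w` at the
initial arc, where the walk on the arcs is of Burau type (`Good.reducedSum_eq_adjugate`). The
passage between the two uses that on the sphere balanced functions on arcs are the differences of
region functions (`Good.exact`).

Initial point: the columns of `1 - walkMatrix` sum to zero and the initial factors form a kernel
vector. Hence its principal minors are proportional to the initial factors
(`Good.alexander_eq_alexander`).

Mirror image: passing to the mirror image and to `t⁻¹` rescales the rows and columns of the corner
matrix by powers of `t` given by the index (`Good.unitWeight_gauge`). Apart from the two regions at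
the initial point, the total exponent is `rotation (index c)`, the sum of the index over all regions
minus its sum over the `S` corners. This is the number of clockwise minus the number of
counterclockwise resolved circles (`Good.curliness_eq`): each circle stays at one level of the index
and cuts the sphere into two connected sides, each of rotation `1`. So the curliness absorbs the
exponent.

Reversal: the walk of the reversed mirror image at `t⁻¹` is the transpose of the original walk,
conjugated by the initial factors (`Good.isTransposed`), and has the same principal minors. Together
with the mirror formula this gives invariance under reversal. For a planar diagram the mirror image
has the same weights and framing, which gives the symmetry under `t ↦ t⁻¹`. -/

namespace MOY

/-! ### Arcs sorted by heads and tails, and the regions at the corners -/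

/-- The incoming places of a system of crossings and vertices. -/
def inPortEquiv (X M S : Type) : InPort X M S ≃ ((X ⊕ M) ⊕ (X ⊕ M)) ⊕ S where
  toFun
    | .crossL x => .inl (.inl (.inl x))
    | .crossR x => .inl (.inr (.inl x))
    | .mergeL m => .inl (.inl (.inr m))
    | .mergeR m => .inl (.inr (.inr m))
    | .split s => .inr s
  invFun
    | .inl (.inl (.inl x)) => .crossL x
    | .inl (.inr (.inl x)) => .crossR x
    | .inl (.inl (.inr m)) => .mergeL m
    | .inl (.inr (.inr m)) => .mergeR m
    | .inr s => .split s
  left_inv p := by cases p <;> rfl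
  right_inv p := by rcases p with ((x | m) | (x | m)) | s <;> rfl

/-- The outgoing places of a system of crossings and vertices. -/
def outPortEquiv (X M S : Type) : OutPort X M S ≃ ((X ⊕ X) ⊕ M) ⊕ (S ⊕ S) where
  toFun
    | .crossL x => .inl (.inl (.inl x))
    | .crossR x => .inl (.inl (.inr x))
    | .merge m => .inl (.inr m)
    | .splitL s => .inr (.inl s)
    | .splitR s => .inr (.inr s)
  invFun
    | .inl (.inl (.inl x)) => .crossL x
    | .inl (.inl (.inr x)) => .crossR x
    | .inl (.inr m) => .merge m
    | .inr (.inl s) => .splitL s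
    | .inr (.inr s) => .splitR s
  left_inv p := by cases p <;> rfl
  right_inv p := by rcases p with ((x | x) | m) | (s | s) <;> rfl

namespace Diagram

variable (D : Diagram)

/-- The places with two incoming arcs: crossings and merges. -/
abbrev Node : Type := D.X ⊕ D.M

/-- All crossings and vertices. -/
abbrev Vtx : Type := D.Node ⊕ D.S

/-- Arcs, sorted by the places where they end. -/
def headEquiv : D.Arc ≃ (D.Node ⊕ D.Node) ⊕ D.S := D.head.trans (inPortEquiv _ _ _)

/-- Arcs, sorted by the places where they start. -/
def tailEquiv : D.Arc ≃ ((D.X ⊕ D.X) ⊕ D.M) ⊕ (D.S ⊕ D.S) := D.tail.trans (outPortEquiv _ _ _)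

/-- The left incoming arc of a crossing or merge. -/
def iL (x : D.Node) : D.Arc := D.headEquiv.symm (.inl (.inl x))

/-- The right incoming arc of a crossing or merge. -/
def iR (x : D.Node) : D.Arc := D.headEquiv.symm (.inl (.inr x))

/-- The incoming arc of a split. -/
def iS (s : D.S) : D.Arc := D.headEquiv.symm (.inr s)

/-- The left outgoing arc of a crossing. -/
def oL (x : D.X) : D.Arc := D.tail.symm (.crossL x)

/-- The right outgoing arc of a crossing. -/
def oR (x : D.X) : D.Arc := D.tail.symm (.crossR x)

/-- The outgoing arc of a merge. -/
def oM (m : D.M) : D.Arc := D.tail.symm (.merge m)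

/-- The left outgoing arc of a split. -/
def oSL (s : D.S) : D.Arc := D.tail.symm (.splitL s)

/-- The right outgoing arc of a split. -/
def oSR (s : D.S) : D.Arc := D.tail.symm (.splitR s)

theorem arc_head_cases (a : D.Arc) :
    (∃ x, a = D.iL x) ∨ (∃ x, a = D.iR x) ∨ ∃ s, a = D.iS s := by
  rcases h : D.headEquiv a with (x | x) | s
  · exact .inl ⟨x, by rw [iL, ← h, Equiv.symm_apply_apply]⟩
  · exact .inr (.inl ⟨x, by rw [iR, ← h, Equiv.symm_apply_apply]⟩)
  · exact .inr (.inr ⟨s, by rw [iS, ← h, Equiv.symm_apply_apply]⟩)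

theorem arc_tail_cases (a : D.Arc) :
    (∃ x, a = D.oL x) ∨ (∃ x, a = D.oR x) ∨ (∃ m, a = D.oM m) ∨ (∃ s, a = D.oSL s) ∨
      ∃ s, a = D.oSR s := by
  rcases h : D.tail a with x | x | m | s | s
  · exact .inl ⟨x, by rw [oL, ← h, Equiv.symm_apply_apply]⟩
  · exact .inr (.inl ⟨x, by rw [oR, ← h, Equiv.symm_apply_apply]⟩)
  · exact .inr (.inr (.inl ⟨m, by rw [oM, ← h, Equiv.symm_apply_apply]⟩))
  · exact .inr (.inr (.inr (.inl ⟨s, by rw [oSL, ← h, Equiv.symm_apply_apply]⟩)))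
  · exact .inr (.inr (.inr (.inr ⟨s, by rw [oSR, ← h, Equiv.symm_apply_apply]⟩)))

theorem sum_head {α : Type*} [AddCommMonoid α] (F : D.Arc → α) :
    ∑ a, F a = ∑ x, (F (D.iL x) + F (D.iR x)) + ∑ s, F (D.iS s) := by
  rw [← Equiv.sum_comp D.headEquiv.symm F, Fintype.sum_sum_type, Fintype.sum_sum_type,
    ← Finset.sum_add_distrib]
  rfl

theorem sum_tail {α : Type*} [AddCommMonoid α] (F : D.Arc → α) :
    ∑ a, F a = ∑ x, (F (D.oL x) + F (D.oR x)) + ∑ m, F (D.oM m)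
      + ∑ s, (F (D.oSL s) + F (D.oSR s)) := by
  rw [← Equiv.sum_comp D.tailEquiv.symm F, Fintype.sum_sum_type, Fintype.sum_sum_type,
    Fintype.sum_sum_type, Fintype.sum_sum_type, ← Finset.sum_add_distrib,
    ← Finset.sum_add_distrib]
  rfl

/-- The corners of a crossing or a merge. The two circle points of a merge can choose the region
between the incoming edges in two ways, which are recorded as the corners `S` and `N`. -/
def corner : D.Node → Corner → D.Region
  | .inl x, .W => D.leftR (D.into (.crossL x))
  | .inl x, .S => D.rightR (D.into (.crossL x))
  | .inl x, .E => D.rightR (D.into (.crossR x))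
  | .inl x, .N => D.rightR (D.outof (.crossL x))
  | .inr m, .W => D.leftR (D.into (.mergeL m))
  | .inr m, .S => D.rightR (D.into (.mergeL m))
  | .inr m, .E => D.rightR (D.into (.mergeR m))
  | .inr m, .N => D.rightR (D.into (.mergeL m))

/-- The region to the left of a split. -/
def splitW (s : D.S) : D.Region := D.leftR (D.into (.split s))

/-- The region between the outgoing edges of a split. -/
def splitN (s : D.S) : D.Region := D.rightR (D.outof (.splitL s))

/-- The region to the right of a split. -/
def splitE (s : D.S) : D.Region := D.rightR (D.into (.split s))

theorem left_iL (x : D.Node) : D.leftR (.inl (D.iL x)) = D.corner x .W := by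
  rcases x with x | m <;> rfl

theorem right_iL (x : D.Node) : D.rightR (.inl (D.iL x)) = D.corner x .S := by
  rcases x with x | m <;> rfl

theorem left_iR (x : D.Node) : D.leftR (.inl (D.iR x)) = D.corner x .S := by
  rcases x with x | m
  · exact D.region_eq (.crossS x)
  · exact D.region_eq (.mergeS m)

theorem right_iR (x : D.Node) : D.rightR (.inl (D.iR x)) = D.corner x .E := by
  rcases x with x | m <;> rfl

theorem left_iS (s : D.S) : D.leftR (.inl (D.iS s)) = D.splitW s := rfl

theorem right_iS (s : D.S) : D.rightR (.inl (D.iS s)) = D.splitE s := rfl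

theorem left_oL (x : D.X) : D.leftR (.inl (D.oL x)) = D.corner (.inl x) .W :=
  (D.region_eq (.crossW x)).symm

theorem right_oL (x : D.X) : D.rightR (.inl (D.oL x)) = D.corner (.inl x) .N := rfl

theorem left_oR (x : D.X) : D.leftR (.inl (D.oR x)) = D.corner (.inl x) .N :=
  (D.region_eq (.crossN x)).symm

theorem right_oR (x : D.X) : D.rightR (.inl (D.oR x)) = D.corner (.inl x) .E :=
  D.region_eq (.crossE x)

theorem left_oM (m : D.M) : D.leftR (.inl (D.oM m)) = D.corner (.inr m) .W :=
  (D.region_eq (.mergeW m)).symm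

theorem right_oM (m : D.M) : D.rightR (.inl (D.oM m)) = D.corner (.inr m) .E :=
  D.region_eq (.mergeE m)

theorem left_oSL (s : D.S) : D.leftR (.inl (D.oSL s)) = D.splitW s :=
  (D.region_eq (.splitW s)).symm

theorem right_oSL (s : D.S) : D.rightR (.inl (D.oSL s)) = D.splitN s := rfl

theorem left_oSR (s : D.S) : D.leftR (.inl (D.oSR s)) = D.splitN s :=
  (D.region_eq (.splitN s)).symm

theorem right_oSR (s : D.S) : D.rightR (.inl (D.oSR s)) = D.splitE s :=
  D.region_eq (.splitE s)

theorem corner_merge_N (m : D.M) : D.corner (.inr m) .N = D.corner (.inr m) .S := rfl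

/-- The crossing or vertex where an arc ends. -/
def headVtx (a : D.Arc) : D.Vtx :=
  match D.headEquiv a with
  | .inl (.inl x) => .inl x
  | .inl (.inr x) => .inl x
  | .inr s => .inr s

/-- The crossing or vertex where an arc starts. -/
def tailVtx (a : D.Arc) : D.Vtx :=
  match D.tail a with
  | .crossL x => .inl (.inl x)
  | .crossR x => .inl (.inl x)
  | .merge m => .inl (.inr m)
  | .splitL s => .inr s
  | .splitR s => .inr s

@[simp] theorem headVtx_iL (x : D.Node) : D.headVtx (D.iL x) = .inl x := by simp [headVtx, iL]
@[simp] theorem headVtx_iR (x : D.Node) : D.headVtx (D.iR x) = .inl x := by simp [headVtx, iR]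
@[simp] theorem headVtx_iS (s : D.S) : D.headVtx (D.iS s) = .inr s := by simp [headVtx, iS]
@[simp] theorem tailVtx_oL (x : D.X) : D.tailVtx (D.oL x) = .inl (.inl x) := by simp [tailVtx, oL]
@[simp] theorem tailVtx_oR (x : D.X) : D.tailVtx (D.oR x) = .inl (.inl x) := by simp [tailVtx, oR]
@[simp] theorem tailVtx_oM (m : D.M) : D.tailVtx (D.oM m) = .inl (.inr m) := by simp [tailVtx, oM]
@[simp] theorem tailVtx_oSL (s : D.S) : D.tailVtx (D.oSL s) = .inr s := by simp [tailVtx, oSL]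
@[simp] theorem tailVtx_oSR (s : D.S) : D.tailVtx (D.oSR s) = .inr s := by simp [tailVtx, oSR]

/-- Every arc has one head and one tail; counting the places gives `2X + 2M + S = 2X + M + 2S`. -/
theorem card_merge_eq_card_split : Fintype.card D.M = Fintype.card D.S := by
  have h₁ := Fintype.card_congr D.headEquiv
  have h₂ := Fintype.card_congr D.tailEquiv
  simp only [Fintype.card_sum] at h₁ h₂
  omega

theorem card_arc : Fintype.card D.Arc = 2 * Fintype.card D.X + 3 * Fintype.card D.M := by
  have h₁ := Fintype.card_congr D.headEquiv
  have h₂ := D.card_merge_eq_card_split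
  simp only [Fintype.card_sum] at h₁ h₂
  omega

/-! ### Connected diagrams -/

/-- The number of regions is the one of a connected diagram. -/
def Good : Prop := Fintype.card D.Region = Fintype.card D.Node + 2

variable {D}

/-- With `#Arc = 2X + 3M` and `2M` vertices the Euler relation reads `2 * #Region - #BoundaryCurve =
#Node + 2`. So in a `Good` diagram each region has one boundary curve, which expresses that the
diagram is connected. -/
theorem Good.card_boundaryCurve (hD : D.Good) :
    Nat.card D.BoundaryCurve = Fintype.card D.Region := by
  have h := D.euler
  have h₁ := D.card_arc
  have h₂ := D.card_merge_eq_card_split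
  simp only [Good, Node, Fintype.card_sum] at hD
  simp only [Wiring.Vertex, Fintype.card_sum] at h
  omega

/-- A function on the regions that does not change across pieces is constant. -/
theorem region_const {α : Type*} (F : D.Region → α) (h : ∀ e, F (D.leftR e) = F (D.rightR e))
    (r r' : D.Region) : F r = F r' := by
  induction D.connected r r' with
  | rel a b h' =>
    obtain ⟨e, rfl, rfl⟩ := h'
    exact h e
  | refl a => rfl
  | symm a b _ ih => exact ih.symm
  | trans a b c _ _ ih₁ ih₂ => exact ih₁.trans ih₂

theorem exists_side_of_piece (δ : D.Piece) (r : D.Region) : ∃ a, D.region a = r := by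
  have := region_const (D := D) (fun r => ∃ a, D.region a = r)
    (fun e => propext ⟨fun _ => ⟨_, rfl⟩, fun _ => ⟨_, rfl⟩⟩) (D.leftR δ) r
  rw [← this]
  exact ⟨_, rfl⟩

theorem Good.exists_side (hD : D.Good) (r : D.Region) : ∃ a, D.region a = r := by
  by_cases hP : Nonempty D.Piece
  · exact exists_side_of_piece hP.some r
  · have h1 : Fintype.card D.Region ≤ 1 :=
      Fintype.card_le_one_iff.2 (region_const id fun e => (hP ⟨e⟩).elim)
    unfold Good at hD
    omega

instance : Finite D.BoundaryCurve := by
  have : Finite (Side D.Piece) := by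
    refine Finite.of_surjective (fun p : D.Piece ⊕ D.Piece =>
      (match p with | .inl e => .left e | .inr e => .right e : Side D.Piece)) ?_
    rintro (e | e)
    · exact ⟨.inl e, rfl⟩
    · exact ⟨.inr e, rfl⟩
  exact Quot.finite _

theorem card_region_le_card_boundaryCurve (δ : D.Piece) :
    Fintype.card D.Region ≤ Nat.card D.BoundaryCurve := by
  rw [← Nat.card_eq_fintype_card]
  refine Nat.card_le_card_of_surjective (Quot.lift D.region (fun _ _ => D.region_eq)) fun r => ?_
  obtain ⟨a, ha⟩ := exists_side_of_piece δ r
  exact ⟨Quot.mk _ a, ha⟩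

/-- The piece to which a side belongs. -/
def sidePiece {P : Type} : Side P → P
  | .left e => e
  | .right e => e

/-- The map from boundary curves to regions is onto, hence bijective by counting. So a function that
is constant along boundary curves descends to the regions, where `region_const` applies. -/
theorem Good.side_const (hD : D.Good) {α : Type*} (h : Side D.Piece → α)
    (hc : ∀ a b, D.SameCorner a b → h a = h b)
    (hs : ∀ e, h (.left e) = h (.right e)) (a b) : h a = h b := by
  let q : D.BoundaryCurve → D.Region := Quot.lift D.region (fun _ _ => D.region_eq)
  have hqs : Function.Surjective q := fun r => by
    obtain ⟨a, ha⟩ := hD.exists_side r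
    exact ⟨Quot.mk _ a, ha⟩
  have hq : Function.Bijective q :=
    (Nat.bijective_iff_surjective_and_card q).2 ⟨hqs, by
      rw [hD.card_boundaryCurve, Nat.card_eq_fintype_card]⟩
  let l : D.BoundaryCurve → α := Quot.lift h hc
  let F : D.Region → α := fun r => l ((Equiv.ofBijective q hq).symm r)
  have hF : ∀ a, F (D.region a) = h a := fun a => by
    have : (Equiv.ofBijective q hq).symm (D.region a) = Quot.mk _ a :=
      (Equiv.symm_apply_eq _).2 rfl
    simp only [F, this]; rfl
  rw [← hF a, ← hF b]
  refine region_const F (fun e => ?_) _ _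
  exact (hF (.left e)).trans ((hs e).trans (hF (.right e)).symm)

/-- In a connected diagram, a labelling of the pieces that does not change at crossings and
vertices is constant. -/
theorem Good.piece_const (hD : D.Good) {α : Type*} (h : D.Piece → α) (hv : D.Vtx → α)
    (h₁ : ∀ a, h (.inl a) = hv (D.headVtx a)) (h₂ : ∀ a, h (.inl a) = hv (D.tailVtx a))
    (e e' : D.Piece) : h e = h e' := by
  refine hD.side_const (fun a => h (sidePiece a)) ?_ (fun _ => rfl) (.left e) (.left e')
  have hL : ∀ x, h (.inl (D.iL x)) = hv (.inl x) := fun x => by rw [h₁, headVtx_iL]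
  have hR : ∀ x, h (.inl (D.iR x)) = hv (.inl x) := fun x => by rw [h₁, headVtx_iR]
  have hS : ∀ x, h (.inl (D.iS x)) = hv (.inr x) := fun x => by rw [h₁, headVtx_iS]
  have gL : ∀ x, h (.inl (D.oL x)) = hv (.inl (.inl x)) := fun x => by rw [h₂, tailVtx_oL]
  have gR : ∀ x, h (.inl (D.oR x)) = hv (.inl (.inl x)) := fun x => by rw [h₂, tailVtx_oR]
  have gM : ∀ x, h (.inl (D.oM x)) = hv (.inl (.inr x)) := fun x => by rw [h₂, tailVtx_oM]
  have gSL : ∀ x, h (.inl (D.oSL x)) = hv (.inr x) := fun x => by rw [h₂, tailVtx_oSL]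
  have gSR : ∀ x, h (.inl (D.oSR x)) = hv (.inr x) := fun x => by rw [h₂, tailVtx_oSR]
  intro a b hab
  cases hab with
  | crossW x => exact (hL (.inl x)).trans (gL x).symm
  | crossN x => exact (gL x).trans (gR x).symm
  | crossE x => exact (gR x).trans (hR (.inl x)).symm
  | crossS x => exact (hR (.inl x)).trans (hL (.inl x)).symm
  | mergeW m => exact (hL (.inr m)).trans (gM m).symm
  | mergeE m => exact (gM m).trans (hR (.inr m)).symm
  | mergeS m => exact (hR (.inr m)).trans (hL (.inr m)).symm
  | splitW s => exact (hS s).trans (gSL s).symm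
  | splitN s => exact (gSL s).trans (gSR s).symm
  | splitE s => exact (gSR s).trans (hS s).symm

/-- In a connected diagram with a free circle, the free circle is everything. -/
theorem Good.loop_cases (hD : D.Good) : IsEmpty D.Loop ∨ (IsEmpty D.Arc ∧ Subsingleton D.Piece) := by
  classical
  by_cases hl : Nonempty D.Loop
  · right
    obtain ⟨l⟩ := hl
    -- Being the circle `l` is a label that is false on all arcs, so it is compatible with the label
    -- `false` on all vertices.
    have key : ∀ e : D.Piece, e = .inr l := fun e => by
      have := hD.piece_const (fun e => decide (e = .inr l)) (fun _ => false)
        (fun a => by simp) (fun a => by simp) e (.inr l)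
      simpa using this
    exact ⟨⟨fun a => by simpa using key (.inl a)⟩, ⟨fun a b => (key a).trans (key b).symm⟩⟩
  · exact .inl (not_nonempty_iff.1 hl)

theorem isEmpty_node_of_arc (h : IsEmpty D.Arc) : IsEmpty D.Node :=
  ⟨fun x => h.elim (D.iL x)⟩

theorem isEmpty_vtx_of_arc (h : IsEmpty D.Arc) : IsEmpty D.Vtx :=
  ⟨fun x => x.elim (fun x => h.elim (D.iL x)) (fun s => h.elim (D.iS s))⟩

/-- Summation by parts: differences of region functions are balanced at each vertex. -/
theorem sum_div_mul_diff {K : Type*} [CommRing K] (h : D.Vtx → K) (g : D.Region → K) :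
    ∑ a, (h (D.headVtx a) - h (D.tailVtx a)) * (g (D.rightR (.inl a)) - g (D.leftR (.inl a))) = 0 := by
  simp only [sub_mul, Finset.sum_sub_distrib]
  -- Sorted by heads or by tails, the differences at a vertex telescope to its rightmost minus its
  -- leftmost region.
  rw [sub_eq_zero, D.sum_head, D.sum_tail]
  simp only [headVtx_iL, headVtx_iR, headVtx_iS, tailVtx_oL, tailVtx_oR, tailVtx_oM, tailVtx_oSL,
    tailVtx_oSR, left_iL, right_iL, left_iR, right_iR, left_iS, right_iS, left_oL, right_oL,
    left_oR, right_oR, left_oM, right_oM, left_oSL, right_oSL, left_oSR, right_oSR]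
  rw [Fintype.sum_sum_type]
  congr 1
  · congr 1 <;> exact Finset.sum_congr rfl fun x _ => by ring
  · exact Finset.sum_congr rfl fun x _ => by ring

end Diagram

end MOY

/-! ### Exactness: the sphere has no first cohomology -/

namespace MOY

open Module in
theorem finrank_ker_le_one {R A K : Type*} [Field K] [Fintype R] [Fintype A]
    (P : Matrix A R K) (h : ∀ v, P.mulVec v = 0 → ∀ r r', v r = v r') :
    finrank K (LinearMap.ker P.mulVecLin) ≤ 1 := by
  have hle : LinearMap.ker P.mulVecLin ≤ Submodule.span K {(fun _ => 1 : R → K)} := by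
    intro v hv
    have hv' : P.mulVec v = 0 := by simpa using hv
    rw [Submodule.mem_span_singleton]
    by_cases hR : Nonempty R
    · obtain ⟨r⟩ := hR
      exact ⟨v r, funext fun r' => by simpa using h v hv' r r'⟩
    · exact ⟨0, funext fun r' => (hR ⟨r'⟩).elim⟩
  calc finrank K (LinearMap.ker P.mulVecLin)
      ≤ finrank K (Submodule.span K {(fun _ => 1 : R → K)}) := Submodule.finrank_mono hle
    _ ≤ 1 := by
      have := finrank_span_le_card (R := K) ({(fun _ => 1 : R → K)} : Set (R → K))
      simpa using this

open Module in
-- Rank counting in the complex given by `P` and `Q`: the rank of `P` is at least `#R - 1`, that of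
-- `Q` at least `#V - k`, and the range of `P` lies in the kernel of `Q`. In the case of equality
-- there is no room for cohomology in the middle.
theorem card_add_card_le {R A V K : Type*} [Field K] [Fintype R] [Fintype A] [Fintype V]
    (P : Matrix A R K) (Q : Matrix V A K) (hQP : Q * P = 0) {k : ℕ}
    (hP : finrank K (LinearMap.ker P.mulVecLin) ≤ 1)
    (hQ : finrank K (LinearMap.ker Q.transpose.mulVecLin) ≤ k) :
    Fintype.card R + Fintype.card V ≤ Fintype.card A + 1 + k ∧
    (Fintype.card R + Fintype.card V = Fintype.card A + 1 + k →
      LinearMap.ker Q.mulVecLin ≤ LinearMap.range P.mulVecLin) := by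
  classical
  have h₁ := LinearMap.finrank_range_add_finrank_ker P.mulVecLin
  have h₂ := LinearMap.finrank_range_add_finrank_ker Q.mulVecLin
  have h₃ := LinearMap.finrank_range_add_finrank_ker Q.transpose.mulVecLin
  have h₄ : finrank K (LinearMap.range Q.transpose.mulVecLin)
      = finrank K (LinearMap.range Q.mulVecLin) := Q.rank_transpose
  have hle : LinearMap.range P.mulVecLin ≤ LinearMap.ker Q.mulVecLin := by
    rintro _ ⟨v, rfl⟩
    simp [Matrix.mulVec_mulVec, hQP]
  have h₅ := Submodule.finrank_mono hle
  simp only [finrank_fintype_fun_eq_card] at h₁ h₂ h₃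
  refine ⟨by omega, fun h => ?_⟩
  exact (Submodule.eq_of_le_of_finrank_le hle (by omega)).ge

namespace Diagram

variable {D : Diagram}

open Classical in
/-- The matrix of the boundary map from arcs to crossings and vertices. -/
noncomputable def divMatrix (D : Diagram) (K : Type) [CommRing K] : Matrix D.Vtx D.Arc K :=
  fun v a => (if D.headVtx a = v then 1 else 0) - (if D.tailVtx a = v then 1 else 0)

open Classical in
/-- The matrix of the difference map from functions on regions to functions on arcs. -/
noncomputable def diffMatrix (D : Diagram) (K : Type) [CommRing K] : Matrix D.Arc D.Region K :=
  fun a r => (if D.rightR (.inl a) = r then 1 else 0) - (if D.leftR (.inl a) = r then 1 else 0)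

variable {K : Type}

theorem diffMatrix_mulVec [CommRing K] (g : D.Region → K) (a : D.Arc) :
    (D.diffMatrix K).mulVec g a = g (D.rightR (.inl a)) - g (D.leftR (.inl a)) := by
  classical
  simp [Matrix.mulVec, dotProduct, diffMatrix, sub_mul, Finset.sum_sub_distrib]

theorem divMatrix_transpose_mulVec [CommRing K] (h : D.Vtx → K) (a : D.Arc) :
    (D.divMatrix K).transpose.mulVec h a = h (D.headVtx a) - h (D.tailVtx a) := by
  classical
  simp [Matrix.mulVec, dotProduct, divMatrix, sub_mul, Finset.sum_sub_distrib]

theorem divMatrix_mulVec [CommRing K] (z : D.Arc → K) (h : D.Vtx → K) :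
    dotProduct h ((D.divMatrix K).mulVec z)
      = ∑ a, (h (D.headVtx a) - h (D.tailVtx a)) * z a := by
  rw [Matrix.dotProduct_mulVec, ← Matrix.mulVec_transpose, dotProduct]
  simp only [divMatrix_transpose_mulVec]

theorem divMatrix_mul_diffMatrix [CommRing K] : D.divMatrix K * D.diffMatrix K = 0 := by
  classical
  ext v r
  have h : ((D.divMatrix K * D.diffMatrix K).mulVec (Pi.single r 1)) v = 0 := by
    rw [← Matrix.mulVec_mulVec]
    have h₂ := divMatrix_mulVec ((D.diffMatrix K).mulVec (Pi.single r 1)) (Pi.single v 1)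
    rw [single_dotProduct, one_mul] at h₂
    rw [h₂]
    simp only [diffMatrix_mulVec]
    exact sum_div_mul_diff _ _
  simpa using h

/-- `z` is balanced at all crossings and vertices. -/
def Balanced [CommRing K] (z : D.Arc → K) : Prop :=
  ∀ h : D.Vtx → K, ∑ a, (h (D.headVtx a) - h (D.tailVtx a)) * z a = 0

theorem Good.left_ne_right_of_loop (hD : D.Good) (hA : IsEmpty D.Arc) (hP : Subsingleton D.Piece)
    (e : D.Piece) : D.leftR e ≠ D.rightR e := by
  intro h
  have := isEmpty_node_of_arc hA
  have hc : Fintype.card D.Region = 2 := by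
    have := hD; simp only [Good] at this; rw [this]; simp [Fintype.card_eq_zero]
  have : Fintype.card D.Region ≤ 1 := by
    have key : ∀ r, r = D.leftR e := fun r => by
      obtain ⟨a, rfl⟩ := hD.exists_side r
      rcases a with e' | e' <;> obtain rfl := Subsingleton.elim e e'
      · rfl
      · exact h.symm
    exact Fintype.card_le_one_iff.2 fun a b => (key a).trans (key b).symm
  omega

/-- On a connected diagram every balanced function on the pieces is a difference of region
functions. -/
theorem Good.exact (hD : D.Good) [Field K] (z : D.Piece → K)
    (hz : Balanced fun a => z (.inl a)) :
    ∃ g : D.Region → K, ∀ e, z e = g (D.rightR e) - g (D.leftR e) := by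
  classical
  rcases hD.loop_cases with hL | ⟨hA, hP⟩
  · have hP := finrank_ker_le_one (D.diffMatrix K) (fun v hv => by
      refine region_const v fun e => ?_
      rcases e with a | l
      · have := congrFun hv a
        rw [diffMatrix_mulVec, Pi.zero_apply, sub_eq_zero] at this
        exact this.symm
      · exact hL.elim l)
    have hQ := finrank_ker_le_one (D.divMatrix K).transpose (fun v hv => by
      have hv' : ∀ a, v (D.headVtx a) = v (D.tailVtx a) := fun a => by
        have := congrFun hv a
        rwa [divMatrix_transpose_mulVec, Pi.zero_apply, sub_eq_zero] at this
      have key : ∀ x, ∃ a, D.headVtx a = x := by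
        rintro (x | s)
        · exact ⟨D.iL x, by simp⟩
        · exact ⟨D.iS s, by simp⟩
      intro r r'
      obtain ⟨a, rfl⟩ := key r
      obtain ⟨b, rfl⟩ := key r'
      exact hD.piece_const (fun e => e.elim (fun a => v (D.headVtx a)) (fun l => hL.elim l)) v
        (fun a => rfl) hv' (.inl a) (.inl b))
    -- Here `k = 1`, and `#R + #V = #A + 2` is Euler's formula for a connected diagram.
    have h := (card_add_card_le _ _ divMatrix_mul_diffMatrix hP hQ).2 (by
      have h₁ := D.card_arc
      have h₂ := D.card_merge_eq_card_split
      have := hD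
      simp only [Good, Node, Fintype.card_sum] at this
      simp only [Vtx, Node, Fintype.card_sum]
      omega)
    have hmem : (fun a => z (.inl a)) ∈ LinearMap.ker (D.divMatrix K).mulVecLin := by
      rw [LinearMap.mem_ker]
      funext v
      have := divMatrix_mulVec (fun a => z (.inl a)) (Pi.single v 1)
      rw [single_dotProduct, one_mul, hz] at this
      simpa using this
    obtain ⟨g, hg⟩ := h hmem
    refine ⟨g, fun e => ?_⟩
    rcases e with a | l
    · rw [← diffMatrix_mulVec]
      exact (congrFun hg a).symm
    · exact hL.elim l
  · by_cases he : Nonempty D.Piece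
    · obtain ⟨e⟩ := he
      have hne := hD.left_ne_right_of_loop hA hP e
      refine ⟨fun r => if r = D.rightR e then z e else 0, fun e' => ?_⟩
      obtain rfl := Subsingleton.elim e e'
      simp [hne]
    · exact ⟨0, fun e => (he ⟨e⟩).elim⟩

/-- On a connected diagram every balanced integral function on the pieces is the jump of an integral
function on the regions which vanishes on the unbounded region. -/
theorem Good.exists_winding (hD : D.Good) (z : D.Piece → ℤ)
    (hz : Balanced fun a => z (.inl a)) :
    ∃ w : D.Region → ℤ, w D.outer = 0 ∧ ∀ e, w (D.rightR e) = w (D.leftR e) + z e := by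
  obtain ⟨g, hg⟩ := hD.exact (K := ℚ) (fun e => (z e : ℚ)) (by
    classical
    intro h
    have h₁ : ∀ v : D.Vtx, ∑ a, (((if D.headVtx a = v then 1 else 0 : ℤ)
        - (if D.tailVtx a = v then 1 else 0 : ℤ) : ℤ) : ℚ) * (z (.inl a) : ℚ) = 0 := fun v => by
      have := hz (Pi.single v 1)
      simp only [Pi.single_apply] at this
      exact_mod_cast this
    calc _ = ∑ a, ∑ v, h v * ((((if D.headVtx a = v then 1 else 0 : ℤ)
        - (if D.tailVtx a = v then 1 else 0 : ℤ) : ℤ) : ℚ) * (z (.inl a) : ℚ)) := by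
          refine Finset.sum_congr rfl fun a _ => ?_
          simp only [Int.cast_sub, Int.cast_ite, Int.cast_one, Int.cast_zero, sub_mul, mul_sub,
            Finset.sum_sub_distrib, ite_mul, zero_mul, one_mul, mul_ite, mul_zero,
            Finset.sum_ite_eq, Finset.mem_univ, if_true]
      _ = 0 := by
          rw [Finset.sum_comm]
          refine Finset.sum_eq_zero fun v _ => ?_
          rw [← Finset.mul_sum, h₁, mul_zero])
  -- The jumps of the rational solution are integers, so integrality relative to the unbounded
  -- region spreads from region to region.
  have hint : ∀ r, ∃ n : ℤ, g r - g D.outer = n := by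
    intro r
    have := region_const (D := D) (fun r => (∃ n : ℤ, g r - g D.outer = n)) (fun e => by
      have h := hg e
      apply propext
      constructor
      · rintro ⟨n, hn⟩
        exact ⟨n + z e, by push_cast; linarith⟩
      · rintro ⟨n, hn⟩
        exact ⟨n - z e, by push_cast; linarith⟩) D.outer r
    rw [← this]
    exact ⟨0, by simp⟩
  choose w hw using hint
  refine ⟨w, ?_, fun e => ?_⟩
  · have := hw D.outer
    rw [sub_self] at this
    exact_mod_cast this.symm
  · have h₁ := hw (D.rightR e)
    have h₂ := hw (D.leftR e)
    have h₃ := hg e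
    have : (w (D.rightR e) : ℚ) = w (D.leftR e) + z e := by linarith
    exact_mod_cast this

theorem winding_unique {z : D.Piece → ℤ} {w w' : D.Region → ℤ} (h₀ : w D.outer = 0)
    (h₀' : w' D.outer = 0) (h : ∀ e, w (D.rightR e) = w (D.leftR e) + z e)
    (h' : ∀ e, w' (D.rightR e) = w' (D.leftR e) + z e) : w = w' := by
  funext r
  have := region_const (fun r => w r - w' r) (fun e => by simp only [h, h']; ring) r D.outer
  simp only [h₀, h₀'] at this
  omega

variable (c : D.PosColoring)

theorem balanced_iff_sums [CommRing K] (z : D.Arc → K)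
    (hX : ∀ x, z (D.iL (.inl x)) + z (D.iR (.inl x)) = z (D.oL x) + z (D.oR x))
    (hM : ∀ m, z (D.iL (.inr m)) + z (D.iR (.inr m)) = z (D.oM m))
    (hS : ∀ s, z (D.iS s) = z (D.oSL s) + z (D.oSR s)) : Balanced z := by
  intro h
  simp only [sub_mul, Finset.sum_sub_distrib]
  rw [sub_eq_zero, D.sum_head, D.sum_tail]
  simp only [headVtx_iL, headVtx_iR, headVtx_iS, tailVtx_oL, tailVtx_oR, tailVtx_oM, tailVtx_oSL,
    tailVtx_oSR, ← mul_add, hS, ← hX, ← hM]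
  rw [Fintype.sum_sum_type]

theorem PosColoring.balanced : Balanced fun a => c.color (.inl a) := by
  apply balanced_iff_sums
  · intro x
    rw [add_comm]
    exact congrArg₂ _ (c.cross₂ x) (c.cross₁ x)
  · exact c.merge
  · exact c.split

/-- `index` is an arbitrary function unless an index exists; it does, by exactness applied to the
coloring. -/
theorem Good.isIndex (hD : D.Good) : IsIndex c (index c) :=
  Classical.epsilon_spec (p := IsIndex c) (hD.exists_winding c.color c.balanced)

theorem Good.index_right (hD : D.Good) (e : D.Piece) :
    index c (D.rightR e) = index c (D.leftR e) + c.color e := (hD.isIndex c).2 e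

theorem Good.index_lt (hD : D.Good) (e : D.Piece) :
    index c (D.leftR e) < index c (D.rightR e) := by
  have := c.pos e
  have := hD.index_right c e
  omega

end Diagram

end MOY

/-! ### Reduction of states to crossings and merges -/

namespace MOY

namespace Diagram

variable {D : Diagram}

/-- A reduced state: a choice of a corner at each crossing and each merge, such that the chosen
corners lie in different regions and these are the regions which are not adjacent to `δ`. -/
def IsReducedState (δ : D.Piece) (s : D.Node → Corner) : Prop :=
  Set.BijOn (fun x => D.corner x (s x)) Set.univ {r | r ≠ D.leftR δ ∧ r ≠ D.rightR δ}

open Classical in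
/-- The sum over the reduced states with weights in any ring. -/
noncomputable def reducedSum {K : Type} [CommRing K] (δ : D.Piece) (w : D.Node → Corner → K) : K :=
  ∑ s : D.Node → Corner with IsReducedState δ s, ∏ x, w x (s x)

/-- The corner at the left circle point of a merge. -/
def mergeLeftCorner : Corner → CircleCorner
  | .W => .W
  | .E => .N
  | .S => .E
  | .N => .N

/-- The corner at the right circle point of a merge. -/
def mergeRightCorner : Corner → CircleCorner
  | .W => .N
  | .E => .E
  | .S => .N
  | .N => .W

/-- The choice of corners that belongs to a reduced one. -/
def expand (s : D.Node → Corner) : D.CornerChoice :=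
  (fun x => s (.inl x), fun p => match p with
    | .inl (.inl m) => mergeLeftCorner (s (.inr m))
    | .inl (.inr m) => mergeRightCorner (s (.inr m))
    | .inr _ => .N)

/-- The generalized crossing that chooses the given corner of a node, or the circle region of a
given vertex. -/
def expandPoint (s : D.Node → Corner) : D.Node ⊕ D.Vertex → D.Cr
  | .inl (.inl x) => .inl x
  | .inl (.inr m) => .inr (.inl (match s (.inr m) with
    | .W => .inl m
    | .S => .inl m
    | .E => .inr m
    | .N => .inr m))
  | .inr (.inl m) => .inr (.inl (match s (.inr m) with
    | .W => .inr m
    | .S => .inr m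
    | .E => .inl m
    | .N => .inl m))
  | .inr (.inr t) => .inr (.inr t)

/-- One of the two circle points of a merge chooses a region of the plane, the other one the circle
region; `s` decides which is which. -/
theorem expandPoint_bijective (s : D.Node → Corner) : Function.Bijective (expandPoint s) := by
  constructor
  · rintro ((x | m) | (m | t)) ((x' | m') | (m' | t')) h <;> simp only [expandPoint] at h <;>
      first
      | (simp at h; done)
      | (simp at h; subst h; rfl)
      | (by_cases hm : m = m'
         · subst hm
           cases hs : s (.inr m) <;> simp [hs] at h ⊢
         · cases hs : s (.inr m) <;> cases hs' : s (.inr m') <;> simp [hs, hs', hm] at h)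
  · rintro (x | ((m | m) | t))
    · exact ⟨.inl (.inl x), rfl⟩
    · cases hs : s (.inr m)
      · exact ⟨.inr (.inl m), by simp [expandPoint, hs]⟩
      · exact ⟨.inl (.inr m), by simp [expandPoint, hs]⟩
      · exact ⟨.inl (.inr m), by simp [expandPoint, hs]⟩
      · exact ⟨.inr (.inl m), by simp [expandPoint, hs]⟩
    · cases hs : s (.inr m)
      · exact ⟨.inl (.inr m), by simp [expandPoint, hs]⟩
      · exact ⟨.inr (.inl m), by simp [expandPoint, hs]⟩
      · exact ⟨.inr (.inl m), by simp [expandPoint, hs]⟩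
      · exact ⟨.inl (.inr m), by simp [expandPoint, hs]⟩
    · exact ⟨.inr (.inr t), rfl⟩

/-- After reindexing by `expandPoint`, the choice on the circle regions is the identity. So they
drop out of the bijectivity condition for states. -/
theorem chosenRegion_expand (s : D.Node → Corner) (y : D.Node ⊕ D.Vertex) :
    D.chosenRegion (expand s) (expandPoint s y)
      = Sum.map (fun x => D.corner x (s x)) id y := by
  rcases y with (x | m) | (m | t)
  · cases hs : s (.inl x) <;> simp [expandPoint, chosenRegion, expand, hs, crossRegion, corner]
  · have hl : D.leftR (D.into (.mergeR m)) = D.rightR (D.into (.mergeL m)) :=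
      D.region_eq (.mergeS m)
    cases hs : s (.inr m) <;>
      simp [expandPoint, chosenRegion, expand, hs, circleRegion, corner, mergeLeftCorner,
        mergeRightCorner, CirclePoint.arc, hl]
  · cases hs : s (.inr m) <;>
      simp [expandPoint, chosenRegion, expand, hs, circleRegion, mergeLeftCorner,
        mergeRightCorner, CirclePoint.vertex]
  · simp [expandPoint, chosenRegion, expand, circleRegion, CirclePoint.vertex]

theorem isState_expand_iff (δ : D.Piece) (s : D.Node → Corner) :
    D.IsState δ (expand s) ↔ IsReducedState δ s := by
  have h₁ : D.IsState δ (expand s) ↔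
      Set.BijOn (Sum.map (fun x => D.corner x (s x)) id : D.Node ⊕ D.Vertex → D.Re) Set.univ
        {r | r ≠ .inl (D.leftR δ) ∧ r ≠ .inl (D.rightR δ)} := by
    have he : Set.BijOn (expandPoint s) Set.univ Set.univ :=
      Set.bijOn_univ.2 (expandPoint_bijective s)
    have hfun : (Sum.map (fun x => D.corner x (s x)) id : D.Node ⊕ D.Vertex → D.Re)
        = D.chosenRegion (expand s) ∘ expandPoint s :=
      funext fun y => (chosenRegion_expand s y).symm
    rw [hfun]
    constructor
    · intro h
      exact Set.BijOn.comp h he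
    · intro h
      refine ⟨?_, ?_, ?_⟩
      · intro z _
        obtain ⟨y, rfl⟩ := (expandPoint_bijective s).2 z
        exact h.mapsTo (Set.mem_univ y)
      · intro z _ z' _ hz
        obtain ⟨y, rfl⟩ := (expandPoint_bijective s).2 z
        obtain ⟨y', rfl⟩ := (expandPoint_bijective s).2 z'
        rw [h.injOn (Set.mem_univ y) (Set.mem_univ y') hz]
      · intro r hr
        obtain ⟨y, _, rfl⟩ := h.surjOn hr
        exact ⟨expandPoint s y, Set.mem_univ _, rfl⟩
  rw [h₁]
  constructor
  · intro h
    refine ⟨?_, ?_, ?_⟩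
    · intro x _
      simpa using h.mapsTo (Set.mem_univ (.inl x))
    · intro x _ x' _ hx
      have := h.injOn (Set.mem_univ (.inl x)) (Set.mem_univ (.inl x')) (by simpa using hx)
      simpa using this
    · intro r hr
      obtain ⟨y, _, hy⟩ := h.surjOn (show (.inl r : D.Re) ∈ _ by simpa using hr)
      rcases y with x | v
      · exact ⟨x, Set.mem_univ _, by simpa using hy⟩
      · simp at hy
  · intro h
    refine ⟨?_, ?_, ?_⟩
    · rintro (x | v) _
      · simpa using h.mapsTo (Set.mem_univ x)
      · simp
    · rintro (x | v) _ (x' | v') _ hx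
      · rw [h.injOn (Set.mem_univ x) (Set.mem_univ x') (by simpa using hx)]
      · simp at hx
      · simp at hx
      · simpa using hx
    · rintro (r | v) hr
      · obtain ⟨x, _, hx⟩ := h.surjOn (show r ∈ _ by simpa using hr)
        exact ⟨.inl x, Set.mem_univ _, by simpa using hx⟩
      · exact ⟨.inr v, Set.mem_univ _, rfl⟩

theorem expand_injective : Function.Injective (expand (D := D)) := by
  intro s s' h
  funext x
  rcases x with x | m
  · exact congrFun (congrArg Prod.fst h) x
  · have h₁ := congrFun (congrArg Prod.snd h) (.inl (.inl m))
    have h₂ := congrFun (congrArg Prod.snd h) (.inl (.inr m))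
    simp only [expand] at h₁ h₂
    revert h₁ h₂
    cases s (.inr m) <;> cases s' (.inr m) <;> simp [mergeLeftCorner, mergeRightCorner]

/-- Each circle region is chosen exactly once. This forces `N` at a split, and `N` at exactly one
circle point of a merge; the other circle point has two options left, which makes four reduced
corners. -/
theorem exists_expand {δ : D.Piece} {t : D.CornerChoice} (ht : D.IsState δ t) :
    ∃ s, expand s = t := by
  have hN : ∀ v : D.Vertex, ∃ p : D.CirclePoint, CirclePoint.vertex p = v ∧ t.2 p = .N := by
    intro v
    obtain ⟨y, _, hy⟩ := ht.surjOn (show (.inr v : D.Re) ∈ _ by simp)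
    rcases y with x | p
    · exfalso
      revert hy
      simp only [chosenRegion]
      cases t.1 x <;> simp [crossRegion]
    · refine ⟨p, ?_⟩
      revert hy
      simp only [chosenRegion]
      cases t.2 p <;> simp [circleRegion]
  have hm : ∀ m : D.M, ∃ k : Corner, mergeLeftCorner k = t.2 (.inl (.inl m)) ∧
      mergeRightCorner k = t.2 (.inl (.inr m)) := by
    intro m
    have hne : ¬(t.2 (.inl (.inl m)) = .N ∧ t.2 (.inl (.inr m)) = .N) := by
      rintro ⟨h₁, h₂⟩
      have := ht.injOn (Set.mem_univ (.inr (.inl (.inl m)))) (Set.mem_univ (.inr (.inl (.inr m))))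
        (by simp [chosenRegion, h₁, h₂, circleRegion, CirclePoint.vertex])
      simp at this
    have hor : t.2 (.inl (.inl m)) = .N ∨ t.2 (.inl (.inr m)) = .N := by
      obtain ⟨p, hp, hpN⟩ := hN (.inl m)
      rcases p with (m' | m') | s <;> simp only [CirclePoint.vertex] at hp
      · obtain rfl := Sum.inl_injective hp
        exact .inl hpN
      · obtain rfl := Sum.inl_injective hp
        exact .inr hpN
      · simp at hp
    revert hne hor
    cases t.2 (.inl (.inl m)) <;> cases t.2 (.inl (.inr m)) <;> intro hne hor <;>
      first
      | exact ⟨.W, rfl, rfl⟩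
      | exact ⟨.E, rfl, rfl⟩
      | exact ⟨.S, rfl, rfl⟩
      | exact ⟨.N, rfl, rfl⟩
      | simp at hne hor
  have hs : ∀ s : D.S, t.2 (.inr s) = .N := by
    intro s
    obtain ⟨p, hp, hpN⟩ := hN (.inr s)
    rcases p with (m' | m') | s' <;> simp only [CirclePoint.vertex] at hp
    · simp at hp
    · simp at hp
    · obtain rfl := Sum.inr_injective hp
      exact hpN
  choose k hk₁ hk₂ using hm
  refine ⟨Sum.elim t.1 k, ?_⟩
  refine Prod.ext rfl (funext fun p => ?_)
  rcases p with (m | m) | s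
  · exact hk₁ m
  · exact hk₂ m
  · exact (hs s).symm

/-- `t ^ (k / 2) - t ^ (- k / 2)`. -/
noncomputable def tdiff (k : ℤ) : RatFunc ℚ := tq (2 * k) - tq (-(2 * k))

variable (c : D.PosColoring)

/-- The weights of the reduced state sum. -/
noncomputable def nodeWeight : D.Node → Corner → RatFunc ℚ
  | .inl x, k => signM k * weightA c x k
  | .inr m, .W => tq (2 * c.color (D.into (.mergeL m))) * tdiff (c.color (D.into (.mergeR m)))
  | .inr m, .E => tdiff (c.color (D.into (.mergeL m))) * tq (-(2 * c.color (D.into (.mergeR m))))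
  | .inr m, .S => tq (-(2 * c.color (D.into (.mergeL m)))) * tdiff (c.color (D.into (.mergeR m)))
  | .inr m, .N => tdiff (c.color (D.into (.mergeL m))) * tq (2 * c.color (D.into (.mergeR m)))

theorem stateSum_eq (δ : D.Piece) :
    stateSum c δ = (∏ s, tdiff (c.color (D.into (.split s)))) * reducedSum δ (nodeWeight c) := by
  classical
  rw [stateSum, reducedSum, Finset.mul_sum]
  symm
  refine Finset.sum_nbij expand ?_ ?_ ?_ ?_
  · intro s hs
    simpa [isState_expand_iff] using hs
  · exact fun _ _ _ _ h => expand_injective h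
  · intro t ht
    have ht' : D.IsState δ t := by simpa using ht
    obtain ⟨s, rfl⟩ := exists_expand ht'
    exact ⟨s, by simpa [isState_expand_iff] using ht', rfl⟩
  · intro s _
    rw [Fintype.prod_sum_type, Fintype.prod_sum_type, Fintype.prod_sum_type]
    have : ∀ m : D.M, nodeWeight c (.inr m) (s (.inr m))
        = circleWeightA c (.inl (.inl m)) ((expand s).2 (.inl (.inl m)))
        * circleWeightA c (.inl (.inr m)) ((expand s).2 (.inl (.inr m))) := fun m => by
      simp only [expand]
      cases s (.inr m) <;> rfl
    rw [Finset.prod_congr rfl fun m _ => this m, Finset.prod_mul_distrib]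
    simp only [expand, nodeWeight, circleWeightA, tdiff, CirclePoint.arc]
    ring

/-- At most two regions are adjacent to `δ`, so a state gives `#Region ≤ #Node + 2`. The Euler
relation with `#Region ≤ #BoundaryCurve` gives the opposite inequality. -/
theorem IsReducedState.good {δ : D.Piece} {s : D.Node → Corner} (hs : IsReducedState δ s) :
    D.Good := by
  classical
  have h₁ : Fintype.card D.Node = Fintype.card {r // r ≠ D.leftR δ ∧ r ≠ D.rightR δ} := by
    refine Fintype.card_congr (Equiv.ofBijective
      (fun x => ⟨D.corner x (s x), hs.mapsTo (Set.mem_univ x)⟩) ⟨?_, ?_⟩)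
    · intro x y h
      exact hs.injOn (Set.mem_univ _) (Set.mem_univ _) (congrArg Subtype.val h)
    · rintro ⟨r, hr⟩
      obtain ⟨x, _, hx⟩ := hs.surjOn hr
      exact ⟨x, Subtype.ext hx⟩
  have h₂ : Fintype.card {r // r ≠ D.leftR δ ∧ r ≠ D.rightR δ}
      + ({D.leftR δ, D.rightR δ} : Finset D.Region).card = Fintype.card D.Region := by
    have : Fintype.card {r // r ≠ D.leftR δ ∧ r ≠ D.rightR δ}
        = (Finset.univ \ {D.leftR δ, D.rightR δ}).card := by
      rw [Fintype.card_subtype]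
      congr 1
      ext r
      simp
    rw [this, Finset.card_sdiff_of_subset (Finset.subset_univ _), Finset.card_univ]
    have := Finset.card_le_univ ({D.leftR δ, D.rightR δ} : Finset D.Region)
    omega
  have h₃ : ({D.leftR δ, D.rightR δ} : Finset D.Region).card ≤ 2 := Finset.card_le_two
  have h₄ := card_region_le_card_boundaryCurve δ
  have h := D.euler
  have h₅ := D.card_arc
  have h₆ := D.card_merge_eq_card_split
  simp only [Node, Fintype.card_sum] at h₁
  simp only [Wiring.Vertex, Fintype.card_sum] at h
  simp only [Good, Node, Fintype.card_sum]
  omega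

theorem reducedSum_eq_zero {K : Type} [CommRing K] (hD : ¬ D.Good) (δ : D.Piece)
    (w : D.Node → Corner → K) : reducedSum δ w = 0 := by
  classical
  rw [reducedSum, Finset.filter_eq_empty_iff.2 fun s _ hs => hD hs.good, Finset.sum_empty]

end Diagram

end MOY

/-! ### Sign changes of kernel vectors -/

namespace MOY

namespace Diagram

variable {D : Diagram}

/-- A Kasteleyn signature on the corners. -/
def kappa : D.Node → Corner → ℤ
  | .inl _, .S => -1
  | .inl _, _ => 1
  | .inr _, .S => -1
  | .inr _, .N => -1
  | .inr _, _ => 1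

theorem sum_corner {K : Type*} [AddCommMonoid K] (F : Corner → K) :
    ∑ k, F k = F .N + F .S + F .W + F .E := by
  have : (Finset.univ : Finset Corner) = {.N, .S, .W, .E} := rfl
  rw [this, Finset.sum_insert (by decide), Finset.sum_insert (by decide),
    Finset.sum_insert (by decide), Finset.sum_singleton, add_assoc, add_assoc]

open Classical in
/-- The signs of `g`, with a rule `τ` for the zeros of `g`. -/
noncomputable def signRule (g : D.Region → ℝ) (τ : D.Region → Bool) (r : D.Region) : Bool :=
  if g r = 0 then τ r else decide (0 < g r)

theorem signRule_of_zero {g : D.Region → ℝ} {τ : D.Region → Bool} {r : D.Region} (h : g r = 0) :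
    signRule g τ r = τ r := by simp [signRule, h]

theorem signRule_of_pos {g : D.Region → ℝ} {τ : D.Region → Bool} {r : D.Region} (h : 0 < g r) :
    signRule g τ r = true := by simp [signRule, h.ne', h]

theorem signRule_of_neg {g : D.Region → ℝ} {τ : D.Region → Bool} {r : D.Region} (h : g r < 0) :
    signRule g τ r = false := by simp [signRule, h.ne, h.le]

theorem nonneg_of_signRule {g : D.Region → ℝ} {τ : D.Region → Bool} {r : D.Region}
    (h : signRule g τ r = true) : 0 ≤ g r := by
  by_contra hr
  rw [signRule_of_neg (not_le.1 hr)] at h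
  simp at h

theorem nonpos_of_signRule {g : D.Region → ℝ} {τ : D.Region → Bool} {r : D.Region}
    (h : signRule g τ r = false) : g r ≤ 0 := by
  by_contra hr
  rw [signRule_of_pos (not_le.1 hr)] at h
  simp at h

/-- The linear relations that a kernel vector satisfies at the crossings and merges. -/
structure IsKernelVector (w : D.Node → Corner → ℝ) (g : D.Region → ℝ) : Prop where
  cross : ∀ x : D.X, w (.inl x) .W * g (D.corner (.inl x) .W)
    + w (.inl x) .N * g (D.corner (.inl x) .N) + w (.inl x) .E * g (D.corner (.inl x) .E)
    = w (.inl x) .S * g (D.corner (.inl x) .S)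
  merge : ∀ m : D.M, w (.inr m) .W * g (D.corner (.inr m) .W)
    + w (.inr m) .E * g (D.corner (.inr m) .E)
    = (w (.inr m) .S + w (.inr m) .N) * g (D.corner (.inr m) .S)

theorem isKernelVector_of_sum {w : D.Node → Corner → ℝ} {g : D.Region → ℝ}
    (h : ∀ x, ∑ k, (kappa x k : ℝ) * w x k * g (D.corner x k) = 0) : IsKernelVector w g := by
  constructor
  · intro x
    have := h (.inl x)
    simp only [sum_corner, kappa] at this
    push_cast at this
    linarith
  · intro m
    have := h (.inr m)
    simp only [sum_corner, kappa, corner_merge_N] at this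
    push_cast at this
    linarith

/-- `τ` is compatible with the order of the corners of each node. -/
def IsMonotoneRule (τ : D.Region → Bool) : Prop :=
  ∀ x, τ (D.corner x .W) = τ (D.corner x .E) → τ (D.corner x .S) = τ (D.corner x .W)

theorem isMonotoneRule_const (β : Bool) : IsMonotoneRule (fun _ : D.Region => β) :=
  fun _ _ => rfl

/-- At each node the index increases strictly from `W` over `S` to `E`, so every threshold on the
index gives a monotone rule. A threshold at the smaller of the two indices separates the two
regions. -/
theorem Good.exists_rule (hD : D.Good) (c : D.PosColoring) {r₁ r₂ : D.Region}
    (h : index c r₁ ≠ index c r₂) (β : Bool) :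
    ∃ τ : D.Region → Bool, IsMonotoneRule τ ∧ τ r₁ = β ∧ τ r₂ = !β := by
  have hf : ∀ x : D.Node, index c (D.corner x .W) < index c (D.corner x .S) ∧
      index c (D.corner x .S) < index c (D.corner x .E) := fun x => by
    have h₁ := hD.index_lt c (.inl (D.iL x))
    have h₂ := hD.index_lt c (.inl (D.iR x))
    rw [left_iL, right_iL] at h₁
    rw [left_iR, right_iR] at h₂
    exact ⟨h₁, h₂⟩
  have hup : ∀ θ : ℤ, IsMonotoneRule (fun r : D.Region => decide (θ < index c r)) := by
    intro θ x hx
    obtain ⟨h₁, h₂⟩ := hf x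
    simp only [decide_eq_decide] at hx ⊢
    omega
  have hdown : ∀ θ : ℤ, IsMonotoneRule (fun r : D.Region => decide (index c r ≤ θ)) := by
    intro θ x hx
    obtain ⟨h₁, h₂⟩ := hf x
    simp only [decide_eq_decide] at hx ⊢
    omega
  rcases lt_or_gt_of_ne h with h | h <;> cases β
  · exact ⟨_, hup (index c r₁), by simp, by simpa using h⟩
  · exact ⟨_, hdown (index c r₁), by simp, by simpa using h⟩
  · exact ⟨_, hdown (index c r₂), by simpa using h, by simp⟩
  · exact ⟨_, hup (index c r₂), by simpa using h, by simp⟩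

theorem sum_signs_zero {a b c A B C : ℝ} (ha : 0 < a) (hb : 0 < b) (hc : 0 < c) (hA : 0 ≤ A)
    (hB : 0 ≤ B) (hC : 0 ≤ C) (h : a * A + b * B + c * C ≤ 0) : A = 0 ∧ B = 0 ∧ C = 0 := by
  have h₁ := mul_nonneg ha.le hA
  have h₂ := mul_nonneg hb.le hB
  have h₃ := mul_nonneg hc.le hC
  refine ⟨?_, ?_, ?_⟩
  · exact (mul_eq_zero.1 (show a * A = 0 by linarith)).resolve_left ha.ne'
  · exact (mul_eq_zero.1 (show b * B = 0 by linarith)).resolve_left hb.ne'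
  · exact (mul_eq_zero.1 (show c * C = 0 by linarith)).resolve_left hc.ne'

section

variable {w : D.Node → Corner → ℝ} (hw : ∀ x k, 0 < w x k) {g : D.Region → ℝ}
  (hg : IsKernelVector w g) {τ : D.Region → Bool} (hτ : IsMonotoneRule τ)

include hw hg hτ

/-- If `S` alone had the other sign, the two sides of the kernel relation would have opposite signs,
so all four values would vanish. Then the signs are those of `τ`, which is monotone. -/
theorem signRule_cross (x : D.X) :
    ¬(signRule g τ (D.corner (.inl x) .N) = signRule g τ (D.corner (.inl x) .W) ∧
      signRule g τ (D.corner (.inl x) .E) = signRule g τ (D.corner (.inl x) .W) ∧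
      signRule g τ (D.corner (.inl x) .S) ≠ signRule g τ (D.corner (.inl x) .W)) := by
  rintro ⟨hN, hE, hS⟩
  have hr := hg.cross x
  have pW := hw (.inl x) .W
  have pN := hw (.inl x) .N
  have pE := hw (.inl x) .E
  have pS := hw (.inl x) .S
  have hfin : g (D.corner (.inl x) .W) = 0 → g (D.corner (.inl x) .E) = 0 →
      g (D.corner (.inl x) .S) = 0 → False := by
    intro h₁ h₂ h₃
    rw [signRule_of_zero h₁] at hE hS
    rw [signRule_of_zero h₂] at hE
    rw [signRule_of_zero h₃] at hS
    exact hS (hτ _ hE.symm)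
  cases hW : signRule g τ (D.corner (.inl x) .W) <;> rw [hW] at hN hE hS
  · have a₁ := nonpos_of_signRule hW
    have a₂ := nonpos_of_signRule hN
    have a₃ := nonpos_of_signRule hE
    have a₄ := nonneg_of_signRule (Bool.eq_true_of_not_eq_false hS)
    have a₅ := mul_nonneg pS.le a₄
    obtain ⟨b₁, b₂, b₃⟩ := sum_signs_zero pW pN pE (neg_nonneg.2 a₁) (neg_nonneg.2 a₂)
      (neg_nonneg.2 a₃) (by linarith)
    rw [neg_eq_zero] at b₁ b₂ b₃
    refine hfin b₁ b₃ ?_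
    rw [b₁, b₂, b₃] at hr
    exact (mul_eq_zero.1 (show w (.inl x) .S * g (D.corner (.inl x) .S) = 0 by linarith)).resolve_left
      pS.ne'
  · have a₁ := nonneg_of_signRule hW
    have a₂ := nonneg_of_signRule hN
    have a₃ := nonneg_of_signRule hE
    have a₄ := nonpos_of_signRule (Bool.eq_false_of_not_eq_true hS)
    have a₅ := mul_nonneg pS.le (neg_nonneg.2 a₄)
    obtain ⟨b₁, b₂, b₃⟩ := sum_signs_zero pW pN pE a₁ a₂ a₃ (by linarith)
    refine hfin b₁ b₃ ?_
    rw [b₁, b₂, b₃] at hr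
    exact (mul_eq_zero.1 (show w (.inl x) .S * g (D.corner (.inl x) .S) = 0 by linarith)).resolve_left
      pS.ne'

theorem signRule_merge (m : D.M)
    (hE : signRule g τ (D.corner (.inr m) .E) = signRule g τ (D.corner (.inr m) .W)) :
    signRule g τ (D.corner (.inr m) .S) = signRule g τ (D.corner (.inr m) .W) := by
  by_contra hS
  have hr := hg.merge m
  have pW := hw (.inr m) .W
  have pE := hw (.inr m) .E
  have pS := add_pos (hw (.inr m) .S) (hw (.inr m) .N)
  have hfin : g (D.corner (.inr m) .W) = 0 → g (D.corner (.inr m) .E) = 0 →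
      g (D.corner (.inr m) .S) = 0 → False := by
    intro h₁ h₂ h₃
    rw [signRule_of_zero h₁] at hE hS
    rw [signRule_of_zero h₂] at hE
    rw [signRule_of_zero h₃] at hS
    exact hS (hτ _ hE.symm)
  cases hW : signRule g τ (D.corner (.inr m) .W) <;> rw [hW] at hE hS
  · have a₁ := nonpos_of_signRule hW
    have a₃ := nonpos_of_signRule hE
    have a₄ := nonneg_of_signRule (Bool.eq_true_of_not_eq_false hS)
    obtain ⟨b₁, b₂, b₃⟩ := sum_signs_zero pW pE pS (neg_nonneg.2 a₁) (neg_nonneg.2 a₃)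
      a₄ (by linarith)
    rw [neg_eq_zero] at b₁ b₂
    exact hfin b₁ b₂ b₃
  · have a₁ := nonneg_of_signRule hW
    have a₃ := nonneg_of_signRule hE
    have a₄ := nonpos_of_signRule (Bool.eq_false_of_not_eq_true hS)
    obtain ⟨b₁, b₂, b₃⟩ := sum_signs_zero pW pE pS a₁ a₃ (neg_nonneg.2 a₄) (by linarith)
    rw [neg_eq_zero] at b₃
    exact hfin b₁ b₂ b₃

/-- The number of sign changes across arcs is the same before and after each crossing and each
vertex. -/
theorem signRule_balanced :
    (∀ x : D.X, signRule g τ (D.corner (.inl x) .E) = signRule g τ (D.corner (.inl x) .W) →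
      signRule g τ (D.corner (.inl x) .S) = signRule g τ (D.corner (.inl x) .W) →
      signRule g τ (D.corner (.inl x) .N) = signRule g τ (D.corner (.inl x) .W)) ∧
    ∀ s : D.S, signRule g τ (D.splitE s) = signRule g τ (D.splitW s) →
      signRule g τ (D.splitN s) = signRule g τ (D.splitW s) := by
  have hc := signRule_cross hw hg hτ
  have hm := signRule_merge hw hg hτ
  set σ := signRule g τ
  -- `q` detects a sign change across an arc. `F₁`, `F₂`, `F₃` are the outgoing minus the incoming
  -- changes at crossings, merges and splits. All are nonnegative, and their total vanishes because
  -- each arc is counted once at its head and once at its tail.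
  let q : Bool → Bool → ℤ := fun a b => if a = b then 0 else 1
  let d : D.Arc → ℤ := fun a => q (σ (D.leftR (.inl a))) (σ (D.rightR (.inl a)))
  have hsum := (D.sum_head d).symm.trans (D.sum_tail d)
  simp only [d, left_iL, right_iL, left_iR, right_iR, left_iS, right_iS, left_oL, right_oL,
    left_oR, right_oR, left_oM, right_oM, left_oSL, right_oSL, left_oSR, right_oSR] at hsum
  rw [Fintype.sum_sum_type] at hsum
  let F₁ : D.X → ℤ := fun x => q (σ (D.corner (.inl x) .W)) (σ (D.corner (.inl x) .N))
    + q (σ (D.corner (.inl x) .N)) (σ (D.corner (.inl x) .E))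
    - (q (σ (D.corner (.inl x) .W)) (σ (D.corner (.inl x) .S))
    + q (σ (D.corner (.inl x) .S)) (σ (D.corner (.inl x) .E)))
  let F₂ : D.M → ℤ := fun m => q (σ (D.corner (.inr m) .W)) (σ (D.corner (.inr m) .E))
    - (q (σ (D.corner (.inr m) .W)) (σ (D.corner (.inr m) .S))
    + q (σ (D.corner (.inr m) .S)) (σ (D.corner (.inr m) .E)))
  let F₃ : D.S → ℤ := fun s => q (σ (D.splitW s)) (σ (D.splitN s))
    + q (σ (D.splitN s)) (σ (D.splitE s)) - q (σ (D.splitW s)) (σ (D.splitE s))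
  have h₁ : ∀ x, 0 ≤ F₁ x := fun x => by
    have := hc x
    revert this
    simp only [F₁, q]
    cases σ (D.corner (.inl x) .W) <;> cases σ (D.corner (.inl x) .N) <;>
      cases σ (D.corner (.inl x) .E) <;> cases σ (D.corner (.inl x) .S) <;> simp
  have h₂ : ∀ m, 0 ≤ F₂ m := fun m => by
    have := hm m
    revert this
    simp only [F₂, q]
    cases σ (D.corner (.inr m) .W) <;>
      cases σ (D.corner (.inr m) .E) <;> cases σ (D.corner (.inr m) .S) <;> simp
  have h₃ : ∀ s, 0 ≤ F₃ s := fun s => by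
    simp only [F₃, q]
    cases σ (D.splitW s) <;> cases σ (D.splitE s) <;> cases σ (D.splitN s) <;> simp
  have htot : ∑ x, F₁ x + ∑ m, F₂ m + ∑ s, F₃ s = 0 := by
    simp only [F₁, F₂, F₃, Finset.sum_sub_distrib]
    linarith
  have k₁ := Finset.sum_nonneg (s := Finset.univ) fun x _ => h₁ x
  have k₂ := Finset.sum_nonneg (s := Finset.univ) fun x _ => h₂ x
  have k₃ := Finset.sum_nonneg (s := Finset.univ) fun x _ => h₃ x
  have z₁ := (Finset.sum_eq_zero_iff_of_nonneg (s := Finset.univ) fun x _ => h₁ x).1 (by linarith)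
  have z₃ := (Finset.sum_eq_zero_iff_of_nonneg (s := Finset.univ) fun x _ => h₃ x).1 (by linarith)
  constructor
  · intro x
    have := z₁ x (Finset.mem_univ _)
    revert this
    simp only [F₁, q]
    cases σ (D.corner (.inl x) .W) <;> cases σ (D.corner (.inl x) .N) <;>
      cases σ (D.corner (.inl x) .E) <;> cases σ (D.corner (.inl x) .S) <;> simp
  · intro s
    have := z₃ s (Finset.mem_univ _)
    revert this
    simp only [F₃, q]
    cases σ (D.splitW s) <;> cases σ (D.splitE s) <;> cases σ (D.splitN s) <;> simp

end

theorem mul_pos_or {a b A B : ℝ} (ha : 0 < a) (hb : 0 < b) (h : a * A = b * B) (hA : A ≠ 0) :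
    (0 < A ∧ 0 < B) ∨ (A < 0 ∧ B < 0) := by
  rcases lt_or_gt_of_ne hA with hA | hA
  · right
    refine ⟨hA, ?_⟩
    by_contra hB
    have := mul_nonneg hb.le (not_lt.1 hB)
    have := mul_neg_of_pos_of_neg ha hA
    linarith
  · left
    refine ⟨hA, ?_⟩
    by_contra hB
    have := mul_nonpos_of_nonneg_of_nonpos hb.le (not_lt.1 hB)
    have := mul_pos ha hA
    linarith

section

variable (hD : D.Good) (c : D.PosColoring) {w : D.Node → Corner → ℝ} (hw : ∀ x k, 0 < w x k)
  {g : D.Region → ℝ} (hg : IsKernelVector w g)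

theorem signRule_eq_of_ne {r : D.Region} (h : g r ≠ 0) :
    ∃ β : Bool, ∀ τ, signRule g τ r = β := by
  rcases lt_or_gt_of_ne h with h | h
  · exact ⟨false, fun τ => signRule_of_neg h⟩
  · exact ⟨true, fun τ => signRule_of_pos h⟩

include hw hg in
-- If the value at `N` were nonzero, the remaining corner would have the opposite sign. When all
-- zeros are given the sign of that corner, `N` alone differs, which `signRule_balanced` forbids.
theorem kernel_cross_in {x : D.X} (hS : g (D.corner (.inl x) .S) = 0)
    (h : g (D.corner (.inl x) .W) = 0 ∨ g (D.corner (.inl x) .E) = 0) :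
    ∀ k, g (D.corner (.inl x) k) = 0 := by
  have hr := hg.cross x
  have pW := hw (.inl x) .W
  have pN := hw (.inl x) .N
  have pE := hw (.inl x) .E
  rw [hS, mul_zero] at hr
  have hN : g (D.corner (.inl x) .N) = 0 := by
    by_contra hN
    rcases h with h | h
    · rw [h, mul_zero, zero_add] at hr
      have := mul_pos_or (B := - g (D.corner (.inl x) .E)) pN pE (by linarith) hN
      rcases this with ⟨h₁, h₂⟩ | ⟨h₁, h₂⟩
      · have := (signRule_balanced hw hg (isMonotoneRule_const false)).1 x
        simp [signRule_of_zero h, signRule_of_pos h₁, signRule_of_neg (neg_pos.1 h₂),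
          signRule_of_zero hS] at this
      · have := (signRule_balanced hw hg (isMonotoneRule_const true)).1 x
        simp [signRule_of_zero h, signRule_of_neg h₁, signRule_of_pos (neg_neg_iff_pos.1 h₂),
          signRule_of_zero hS] at this
    · rw [h, mul_zero, add_zero] at hr
      have := mul_pos_or (B := - g (D.corner (.inl x) .W)) pN pW (by linarith) hN
      rcases this with ⟨h₁, h₂⟩ | ⟨h₁, h₂⟩
      · have := (signRule_balanced hw hg (isMonotoneRule_const false)).1 x
        simp [signRule_of_zero h, signRule_of_pos h₁, signRule_of_neg (neg_pos.1 h₂),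
          signRule_of_zero hS] at this
      · have := (signRule_balanced hw hg (isMonotoneRule_const true)).1 x
        simp [signRule_of_zero h, signRule_of_neg h₁, signRule_of_pos (neg_neg_iff_pos.1 h₂),
          signRule_of_zero hS] at this
  have hWE : g (D.corner (.inl x) .W) = 0 ∧ g (D.corner (.inl x) .E) = 0 := by
    rcases h with h | h
    · rw [h, hN] at hr
      exact ⟨h, by simpa [pE.ne'] using hr⟩
    · rw [h, hN] at hr
      exact ⟨by simpa [pW.ne'] using hr, h⟩
  intro k
  cases k
  · exact hN
  · exact hS
  · exact hWE.1
  · exact hWE.2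

include hD c hw hg in
-- If the value at `S` were nonzero, the remaining corner would have the same sign. A constant rule
-- for the zeros gives no contradiction here. A rule that separates the two zero corners does: it
-- can be chosen such that only `N` differs.
theorem kernel_cross_out {x : D.X} (hN : g (D.corner (.inl x) .N) = 0)
    (h : g (D.corner (.inl x) .W) = 0 ∨ g (D.corner (.inl x) .E) = 0) :
    ∀ k, g (D.corner (.inl x) k) = 0 := by
  have hr := hg.cross x
  have pW := hw (.inl x) .W
  have pS := hw (.inl x) .S
  have pE := hw (.inl x) .E
  rw [hN, mul_zero, add_zero] at hr
  have f₁ := hD.index_lt c (.inl (D.oL x))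
  have f₂ := hD.index_lt c (.inl (D.oR x))
  rw [left_oL, right_oL] at f₁
  rw [left_oR, right_oR] at f₂
  have hS : g (D.corner (.inl x) .S) = 0 := by
    by_contra hS
    rcases h with h | h
    · rw [h, mul_zero, zero_add] at hr
      rcases mul_pos_or pS pE hr.symm hS with ⟨h₁, h₂⟩ | ⟨h₁, h₂⟩
      · obtain ⟨τ, hτ, t₁, t₂⟩ := hD.exists_rule c f₁.ne true
        have := (signRule_balanced hw hg hτ).1 x
        simp [signRule_of_zero h, signRule_of_pos h₁, signRule_of_pos h₂,
          signRule_of_zero hN, t₁, t₂] at this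
      · obtain ⟨τ, hτ, t₁, t₂⟩ := hD.exists_rule c f₁.ne false
        have := (signRule_balanced hw hg hτ).1 x
        simp [signRule_of_zero h, signRule_of_neg h₁, signRule_of_neg h₂,
          signRule_of_zero hN, t₁, t₂] at this
    · rw [h, mul_zero, add_zero] at hr
      rcases mul_pos_or pS pW hr.symm hS with ⟨h₁, h₂⟩ | ⟨h₁, h₂⟩
      · obtain ⟨τ, hτ, t₁, t₂⟩ := hD.exists_rule c f₂.ne false
        have := (signRule_balanced hw hg hτ).1 x
        simp [signRule_of_zero h, signRule_of_pos h₁, signRule_of_pos h₂,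
          signRule_of_zero hN, t₁, t₂] at this
      · obtain ⟨τ, hτ, t₁, t₂⟩ := hD.exists_rule c f₂.ne true
        have := (signRule_balanced hw hg hτ).1 x
        simp [signRule_of_zero h, signRule_of_neg h₁, signRule_of_neg h₂,
          signRule_of_zero hN, t₁, t₂] at this
  exact kernel_cross_in hw hg hS h

include hw hg in
theorem kernel_merge {m : D.M}
    (h : (g (D.corner (.inr m) .W) = 0 ∧ g (D.corner (.inr m) .E) = 0) ∨
      (g (D.corner (.inr m) .W) = 0 ∧ g (D.corner (.inr m) .S) = 0) ∨
      (g (D.corner (.inr m) .S) = 0 ∧ g (D.corner (.inr m) .E) = 0)) :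
    ∀ k, g (D.corner (.inr m) k) = 0 := by
  have hr := hg.merge m
  have pW := hw (.inr m) .W
  have pE := hw (.inr m) .E
  have pS := add_pos (hw (.inr m) .S) (hw (.inr m) .N)
  have key : g (D.corner (.inr m) .W) = 0 ∧ g (D.corner (.inr m) .E) = 0 ∧
      g (D.corner (.inr m) .S) = 0 := by
    rcases h with ⟨h₁, h₂⟩ | ⟨h₁, h₂⟩ | ⟨h₁, h₂⟩
    · rw [h₁, h₂] at hr
      exact ⟨h₁, h₂, by simpa [pS.ne'] using hr⟩
    · rw [h₁, h₂] at hr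
      exact ⟨h₁, by simpa [pE.ne'] using hr, h₂⟩
    · rw [h₁, h₂] at hr
      exact ⟨by simpa [pW.ne'] using hr, h₂, h₁⟩
  intro k
  cases k
  · exact key.2.2
  · exact key.2.2
  · exact key.1
  · exact key.2.1

include hD c hw hg in
-- No linear relation holds at a split, only the balance of sign changes. The rule for the zeros is
-- chosen such that the two outer corners agree and `splitN` differs from them.
theorem kernel_split {s : D.S}
    (h : (g (D.splitW s) = 0 ∧ g (D.splitE s) = 0) ∨ (g (D.splitW s) = 0 ∧ g (D.splitN s) = 0) ∨
      (g (D.splitN s) = 0 ∧ g (D.splitE s) = 0)) :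
    g (D.splitW s) = 0 ∧ g (D.splitN s) = 0 ∧ g (D.splitE s) = 0 := by
  have f₁ := hD.index_lt c (.inl (D.oSL s))
  have f₂ := hD.index_lt c (.inl (D.oSR s))
  rw [left_oSL, right_oSL] at f₁
  rw [left_oSR, right_oSR] at f₂
  rcases h with ⟨h₁, h₂⟩ | ⟨h₁, h₂⟩ | ⟨h₁, h₂⟩
  · refine ⟨h₁, ?_, h₂⟩
    by_contra h₃
    obtain ⟨β, hβ⟩ := signRule_eq_of_ne h₃
    have := (signRule_balanced hw hg (isMonotoneRule_const (!β))).2 s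
    rw [signRule_of_zero h₁, signRule_of_zero h₂, hβ] at this
    simp at this
  · refine ⟨h₁, h₂, ?_⟩
    by_contra h₃
    obtain ⟨β, hβ⟩ := signRule_eq_of_ne h₃
    obtain ⟨τ, hτ, t₁, t₂⟩ := hD.exists_rule c f₁.ne β
    have := (signRule_balanced hw hg hτ).2 s
    rw [signRule_of_zero h₁, signRule_of_zero h₂, hβ, t₁, t₂] at this
    simp at this
  · refine ⟨?_, h₁, h₂⟩
    by_contra h₃
    obtain ⟨β, hβ⟩ := signRule_eq_of_ne h₃
    obtain ⟨τ, hτ, t₁, t₂⟩ := hD.exists_rule c f₂.ne' β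
    have := (signRule_balanced hw hg hτ).2 s
    rw [signRule_of_zero h₁, signRule_of_zero h₂, hβ, t₁, t₂] at this
    simp at this

include hD c hw hg in
/-- For positive weights there is no kernel vector which vanishes on both sides of a piece. -/
theorem kernelVector_eq_zero (δ : D.Piece) (hL : g (D.leftR δ) = 0) (hR : g (D.rightR δ) = 0) :
    g = 0 := by
  let h : D.Piece → Prop := fun e => g (D.leftR e) = 0 ∧ g (D.rightR e) = 0
  let hv : D.Vtx → Prop := Sum.elim (fun x => ∀ k, g (D.corner x k) = 0)
    (fun s => g (D.splitW s) = 0 ∧ g (D.splitN s) = 0 ∧ g (D.splitE s) = 0)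
  -- Vanishing on both sides of an arc is equivalent to vanishing in all corners at either end of
  -- it, so it spreads along the diagram.
  have key := hD.piece_const h hv (fun a => propext (by
      rcases D.arc_head_cases a with ⟨x | m, rfl⟩ | ⟨x | m, rfl⟩ | ⟨s, rfl⟩
      · simp only [h, hv, headVtx_iL, left_iL, right_iL, Sum.elim_inl]
        exact ⟨fun h => kernel_cross_in hw hg h.2 (.inl h.1), fun h => ⟨h _, h _⟩⟩
      · simp only [h, hv, headVtx_iL, left_iL, right_iL, Sum.elim_inl]
        exact ⟨fun h => kernel_merge hw hg (.inr (.inl h)), fun h => ⟨h _, h _⟩⟩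
      · simp only [h, hv, headVtx_iR, left_iR, right_iR, Sum.elim_inl]
        exact ⟨fun h => kernel_cross_in hw hg h.1 (.inr h.2), fun h => ⟨h _, h _⟩⟩
      · simp only [h, hv, headVtx_iR, left_iR, right_iR, Sum.elim_inl]
        exact ⟨fun h => kernel_merge hw hg (.inr (.inr h)), fun h => ⟨h _, h _⟩⟩
      · simp only [h, hv, headVtx_iS, left_iS, right_iS, Sum.elim_inr]
        exact ⟨fun h => kernel_split hD c hw hg (.inl h), fun h => ⟨h.1, h.2.2⟩⟩))
    (fun a => propext (by
      rcases D.arc_tail_cases a with ⟨x, rfl⟩ | ⟨x, rfl⟩ | ⟨m, rfl⟩ | ⟨s, rfl⟩ | ⟨s, rfl⟩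
      · simp only [h, hv, tailVtx_oL, left_oL, right_oL, Sum.elim_inl]
        exact ⟨fun h => kernel_cross_out hD c hw hg h.2 (.inl h.1), fun h => ⟨h _, h _⟩⟩
      · simp only [h, hv, tailVtx_oR, left_oR, right_oR, Sum.elim_inl]
        exact ⟨fun h => kernel_cross_out hD c hw hg h.1 (.inr h.2), fun h => ⟨h _, h _⟩⟩
      · simp only [h, hv, tailVtx_oM, left_oM, right_oM, Sum.elim_inl]
        exact ⟨fun h => kernel_merge hw hg (.inl h), fun h => ⟨h _, h _⟩⟩
      · simp only [h, hv, tailVtx_oSL, left_oSL, right_oSL, Sum.elim_inr]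
        exact ⟨fun h => kernel_split hD c hw hg (.inr (.inl h)), fun h => ⟨h.1, h.2.1⟩⟩
      · simp only [h, hv, tailVtx_oSR, left_oSR, right_oSR, Sum.elim_inr]
        exact ⟨fun h => kernel_split hD c hw hg (.inr (.inr h)), fun h => ⟨h.2.1, h.2.2⟩⟩))
  have all : ∀ e, h e := fun e => (key δ e).mp ⟨hL, hR⟩
  funext r
  obtain ⟨e | e, rfl⟩ := hD.exists_side r
  · exact (all e).1
  · exact (all e).2

end

end Diagram

end MOY

/-! ### The signed determinant and the common sign of the states -/

namespace MOY

namespace Diagram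

variable {D : Diagram}

/-- The regions that are not adjacent to `δ`. -/
abbrev FarRegion (δ : D.Piece) : Type := {r : D.Region // r ≠ D.leftR δ ∧ r ≠ D.rightR δ}

theorem Good.nonempty_equiv (hD : D.Good) (c : D.PosColoring) (δ : D.Piece) :
    Nonempty (D.Node ≃ FarRegion δ) := by
  classical
  refine ⟨Fintype.equivOfCardEq ?_⟩
  have hδ : D.leftR δ ≠ D.rightR δ := fun h => (hD.index_lt c δ).ne (congrArg _ h)
  have h₁ : Fintype.card (FarRegion δ) = (Finset.univ \ {D.leftR δ, D.rightR δ}).card := by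
    rw [Fintype.card_subtype]
    congr 1
    ext r
    simp
  rw [h₁, Finset.card_sdiff_of_subset (Finset.subset_univ _), Finset.card_pair hδ,
    Finset.card_univ, hD]
  rfl

variable {δ : D.Piece} (e : D.Node ≃ FarRegion δ)

open Classical in
/-- The signed matrix of weights. -/
noncomputable def cornerMatrix {K : Type} [CommRing K] (w : D.Node → Corner → K) :
    Matrix D.Node D.Node K :=
  fun x y => ∑ k, if D.corner x k = (e y).1 then (kappa x k : K) * w x k else 0

open Classical in
/-- The incidence matrix of a choice of corners. -/
noncomputable def choiceMatrix (s : D.Node → Corner) : Matrix D.Node D.Node ℤ :=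
  fun x y => if D.corner x (s x) = (e y).1 then 1 else 0

open Classical in
-- Each row is a sum over four corners; expand by multilinearity.
theorem det_cornerMatrix {K : Type} [CommRing K] (w : D.Node → Corner → K) :
    (cornerMatrix e w).det
      = ∑ s : D.Node → Corner, ((∏ x, kappa x (s x)) * (choiceMatrix e s).det : ℤ)
        * ∏ x, w x (s x) := by
  have h₁ : cornerMatrix e w = fun x => ∑ k, ((kappa x k : K) * w x k) •
      (fun y => if D.corner x k = (e y).1 then (1 : K) else 0) := by
    funext x y
    simp [cornerMatrix, Finset.sum_apply]
  have h₂ := (Matrix.detRowAlternating (R := K) (n := D.Node)).toMultilinearMap.map_sum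
    (fun x k => ((kappa x k : K) * w x k) •
      (fun y => if D.corner x k = (e y).1 then (1 : K) else 0))
  rw [h₁]
  refine h₂.trans (Finset.sum_congr rfl fun s _ => ?_)
  rw [MultilinearMap.map_smul_univ, Finset.prod_mul_distrib, smul_eq_mul]
  have h₃ : (((choiceMatrix e s).det : ℤ) : K)
      = Matrix.det (fun x y => if D.corner x (s x) = (e y).1 then (1 : K) else 0) := by
    have := (Int.castRingHom K).map_det (choiceMatrix e s)
    rw [eq_intCast] at this
    rw [this]
    congr 1
    funext x y
    simp [choiceMatrix, RingHom.mapMatrix_apply]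
  rw [Int.cast_mul, h₃, Int.cast_prod]
  rw [mul_right_comm]
  rfl

open Classical in
theorem det_choiceMatrix_of_state {s : D.Node → Corner} (hs : IsReducedState δ s) :
    (choiceMatrix e s).det = 1 ∨ (choiceMatrix e s).det = -1 := by
  let f : D.Node → D.Node := fun x => e.symm ⟨D.corner x (s x), hs.mapsTo (Set.mem_univ x)⟩
  have hf : Function.Injective f := by
    intro x y h
    have := congrArg Subtype.val (e.symm.injective h)
    exact hs.injOn (Set.mem_univ _) (Set.mem_univ _) this
  let σ : Equiv.Perm D.Node := Equiv.ofBijective f (Finite.injective_iff_bijective.1 hf)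
  have : choiceMatrix e s = (1 : Matrix D.Node D.Node ℤ).submatrix σ id := by
    ext x y
    simp only [choiceMatrix, Matrix.submatrix_apply, Matrix.one_apply, id, σ,
      Equiv.ofBijective_apply, f]
    congr 1
    rw [Equiv.symm_apply_eq, Subtype.ext_iff]
  rw [this, Matrix.det_permute, Matrix.det_one, mul_one]
  rcases Int.units_eq_one_or (Equiv.Perm.sign σ) with h | h <;> simp [h]

open Classical in
-- A region chosen twice gives two equal rows, and a region adjacent to `δ` gives a zero row.
theorem det_choiceMatrix_of_not_state {s : D.Node → Corner} (hs : ¬ IsReducedState δ s) :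
    (choiceMatrix e s).det = 0 := by
  by_cases hm : ∀ x, D.corner x (s x) ≠ D.leftR δ ∧ D.corner x (s x) ≠ D.rightR δ
  · by_cases hi : Function.Injective fun x => D.corner x (s x)
    · refine absurd ⟨fun x _ => hm x, hi.injOn, ?_⟩ hs
      intro r hr
      let f : D.Node → D.Node := fun x => e.symm ⟨D.corner x (s x), hm x⟩
      have hf : Function.Injective f := fun x y h =>
        hi (congrArg Subtype.val (e.symm.injective h))
      obtain ⟨x, hx⟩ := (Finite.injective_iff_surjective.1 hf) (e.symm ⟨r, hr⟩)
      exact ⟨x, Set.mem_univ _, congrArg Subtype.val (e.symm.injective hx)⟩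
    · simp only [Function.Injective, not_forall] at hi
      obtain ⟨x, y, hxy, hne⟩ := hi
      refine Matrix.det_zero_of_row_eq hne (funext fun z => ?_)
      simp only [choiceMatrix, hxy]
  · simp only [not_forall] at hm
    obtain ⟨x, hx⟩ := hm
    refine Matrix.det_eq_zero_of_row_eq_zero x fun y => ?_
    simp only [choiceMatrix, ite_eq_right_iff, one_ne_zero, imp_false]
    intro h
    rw [h] at hx
    exact hx (e y).2

open Classical in
-- Extended by zero to the two regions next to `δ`, a kernel vector of the matrix falls under
-- `kernelVector_eq_zero`.
theorem Good.det_cornerMatrix_ne_zero (hD : D.Good) (c : D.PosColoring)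
    {w : D.Node → Corner → ℝ} (hw : ∀ x k, 0 < w x k) : (cornerMatrix e w).det ≠ 0 := by
  intro h
  obtain ⟨v, hv, hMv⟩ := Matrix.exists_mulVec_eq_zero_iff.2 h
  let g : D.Region → ℝ := fun r => if h : r ≠ D.leftR δ ∧ r ≠ D.rightR δ then v (e.symm ⟨r, h⟩) else 0
  have hge : ∀ y, g (e y).1 = v y := fun y => by
    simp only [g]
    rw [dif_pos (e y).2]
    simp
  have hgL : g (D.leftR δ) = 0 := by simp [g]
  have hgR : g (D.rightR δ) = 0 := by simp [g]
  have hg : g = 0 := by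
    refine kernelVector_eq_zero hD c hw (isKernelVector_of_sum fun x => ?_) δ hgL hgR
    refine Eq.trans ?_ (congrFun hMv x)
    simp only [Matrix.mulVec, dotProduct, cornerMatrix, Finset.sum_mul]
    rw [Finset.sum_comm]
    refine Finset.sum_congr rfl fun k _ => ?_
    by_cases hk : D.corner x k ≠ D.leftR δ ∧ D.corner x k ≠ D.rightR δ
    · rw [Finset.sum_eq_single (e.symm ⟨_, hk⟩)]
      · simp [← hge]
      · intro y _ hy
        rw [if_neg, zero_mul]
        intro hxy
        apply hy
        rw [Equiv.eq_symm_apply]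
        exact Subtype.ext hxy.symm
      · simp
    · rw [Finset.sum_eq_zero]
      · simp only [g]
        rw [dif_neg hk, mul_zero]
      · intro y _
        rw [if_neg, zero_mul]
        intro hxy
        rw [hxy] at hk
        exact hk (e y).2
  apply hv
  funext y
  rw [← hge, hg]
  rfl

open Classical in
/-- All states occur with the same sign in the determinant of the signed matrix of weights. -/
theorem Good.exists_sign (hD : D.Good) (c : D.PosColoring) :
    ∃ ε : ℤ, (ε = 1 ∨ ε = -1) ∧ ∀ (K : Type) [CommRing K] (w : D.Node → Corner → K),
      (cornerMatrix e w).det = (ε : K) * reducedSum δ w := by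
  let a : (D.Node → Corner) → ℤ := fun s => (∏ x, kappa x (s x)) * (choiceMatrix e s).det
  have hκ : ∀ s : D.Node → Corner, (∏ x, kappa x (s x)) = 1 ∨ (∏ x, kappa x (s x)) = -1 := by
    intro s
    rw [← Int.isUnit_iff, ← Finset.univ.prod_coe_sort]
    refine IsUnit.prod_univ_iff.2 fun x => ?_
    rcases x with ⟨x | m, -⟩ <;> simp only [] <;> cases s _ <;> simp [kappa]
  have ha : ∀ s, IsReducedState δ s → a s = 1 ∨ a s = -1 := by
    intro s hs
    simp only [a]
    rcases hκ s with h | h <;> rcases det_choiceMatrix_of_state e hs with h' | h' <;>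
      rw [h, h'] <;> norm_num
  have ha' : ∀ s, ¬ IsReducedState δ s → a s = 0 := by
    intro s hs
    simp only [a]
    rw [det_choiceMatrix_of_not_state e hs, mul_zero]
  let F : (D.Node → Corner → ℝ) → ℝ := fun w => ∑ s, (a s : ℝ) * ∏ x, w x (s x)
  have hFdet : ∀ w, (cornerMatrix e w).det = F w := det_cornerMatrix e
  have hFc : Continuous F := by fun_prop
  let P : Set (D.Node → Corner → ℝ) := {w | ∀ x k, 0 < w x k}
  have hP : IsPreconnected P := by
    refine Convex.isPreconnected ?_
    intro w hw w' hw' p q hp hq hpq x k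
    simp only [Pi.add_apply, Pi.smul_apply, smul_eq_mul]
    rcases hp.eq_or_lt with rfl | hp
    · rw [zero_add] at hpq
      rw [hpq]
      simpa using hw' x k
    · have := mul_pos hp (hw x k)
      have := mul_nonneg hq (hw' x k).le
      linarith
  have hF0 : ∀ w ∈ P, F w ≠ 0 := fun w hw => by
    rw [← hFdet]
    exact hD.det_cornerMatrix_ne_zero e c hw
  -- The positive weights form a convex set on which `F` has no zero, so `F` has a constant sign
  -- there.
  have hsame : ∀ w ∈ P, ∀ w' ∈ P, F w < 0 → ¬ 0 < F w' := by
    intro w hw w' hw' h h'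
    obtain ⟨u, hu, hu0⟩ := hP.intermediate_value hw hw' hFc.continuousOn ⟨h.le, h'.le⟩
    exact hF0 u hu hu0
  -- Weights concentrated on the corners of `s`. At `u = 0` only the term of `s` survives in `F`, so
  -- `a s` is a limit of values of `F` at positive weights and has their common sign.
  let W : (D.Node → Corner) → ℝ → D.Node → Corner → ℝ :=
    fun s u x k => (if k = s x then 1 else 0) + u
  have hWc : ∀ s, Continuous (W s) := fun s => by
    refine continuous_pi fun x => continuous_pi fun k => ?_
    simp only [W]
    fun_prop
  have hW : ∀ s u, 0 < u → W s u ∈ P := by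
    intro s u hu x k
    simp only [W]
    split_ifs <;> linarith
  have hW0 : ∀ s, F (W s 0) = a s := by
    intro s
    simp only [F, W, add_zero]
    rw [Finset.sum_eq_single s]
    · simp
    · intro s' _ hne
      obtain ⟨x, hx⟩ := Function.ne_iff.1 hne
      rw [Finset.prod_eq_zero (Finset.mem_univ x) (if_neg hx), mul_zero]
    · simp
  have htend : ∀ s, Filter.Tendsto (fun u => F (W s u)) (nhdsWithin 0 (Set.Ioi 0))
      (nhds (a s : ℝ)) := by
    intro s
    rw [← hW0]
    exact ((hFc.comp (hWc s)).tendsto 0).mono_left nhdsWithin_le_nhds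
  have hpos : (fun _ _ => 1 : D.Node → Corner → ℝ) ∈ P := fun _ _ => one_pos
  obtain ⟨ε, hε, hall⟩ : ∃ ε : ℤ, (ε = 1 ∨ ε = -1) ∧ ∀ s, IsReducedState δ s → a s = ε := by
    rcases lt_or_gt_of_ne (hF0 _ hpos) with h | h
    · refine ⟨-1, .inr rfl, fun s hs => (ha s hs).resolve_left fun h1 => ?_⟩
      have : (a s : ℝ) ≤ 0 := le_of_tendsto (htend s) (by
        filter_upwards [self_mem_nhdsWithin] with u hu
        exact not_lt.1 (hsame _ hpos _ (hW s u hu) h))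
      rw [h1] at this
      norm_num at this
    · refine ⟨1, .inl rfl, fun s hs => (ha s hs).resolve_right fun h1 => ?_⟩
      have : 0 ≤ (a s : ℝ) := ge_of_tendsto (htend s) (by
        filter_upwards [self_mem_nhdsWithin] with u hu
        by_contra hlt
        exact hsame _ (hW s u hu) _ hpos (not_le.1 hlt) h)
      rw [h1] at this
      norm_num at this
  refine ⟨ε, hε, fun K _ w => ?_⟩
  rw [det_cornerMatrix, reducedSum, Finset.mul_sum, Finset.sum_filter]
  refine Finset.sum_congr rfl fun s _ => ?_
  split_ifs with hs
  · rw [← hall s hs]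
  · rw [show ((∏ x, kappa x (s x)) * (choiceMatrix e s).det : ℤ) = 0 from ha' s hs]
    simp

end Diagram

end MOY

/-! ### Cofactors of singular matrices, and the walk on the arcs -/

namespace MOY

section Matrices

variable {n K : Type*} [Fintype n] [DecidableEq n]

/-- The rows of `M` add up to zero. So, once row `i` is replaced by a unit vector, adding the other
rows to row `j` turns it into minus the removed row; swapping the two rows absorbs the sign. -/
theorem adjugate_eq_diag_of_colSum [CommRing K] (M : Matrix n n K) (h : ∀ b, ∑ a, M a b = 0)
    (j i : n) : M.adjugate j i = M.adjugate j j := by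
  by_cases hij : i = j
  · rw [hij]
  rw [Matrix.adjugate_apply, Matrix.adjugate_apply]
  set N := M.updateRow i (Pi.single j 1) with hN
  have h₁ := Matrix.det_updateRow_sum N j (fun k => if k = i then 0 else 1)
  rw [if_neg (fun h => hij h.symm), one_smul] at h₁
  have h₂ : ∑ k, (if k = i then (0 : K) else 1) • N k = (-1 : K) • M i := by
    funext b
    simp only [Finset.sum_apply, Pi.smul_apply, smul_eq_mul, neg_one_mul]
    have h₃ := h b
    rw [← Finset.add_sum_erase _ _ (Finset.mem_univ i)] at h₃ ⊢
    rw [if_pos rfl, zero_mul, zero_add, eq_neg_iff_add_eq_zero, add_comm, ← h₃]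
    congr 1
    refine Finset.sum_congr rfl fun k hk => ?_
    have hk' := Finset.ne_of_mem_erase hk
    rw [if_neg hk', one_mul, hN, Matrix.updateRow_ne hk']
  rw [h₂, Matrix.det_updateRow_smul] at h₁
  have h₄ : N.updateRow j (M i) = (M.updateRow j (Pi.single j 1)).submatrix (Equiv.swap i j) id := by
    ext a b
    rw [Matrix.submatrix_apply, id]
    by_cases ha : a = j
    · subst ha
      rw [Matrix.updateRow_self, Equiv.swap_apply_right, Matrix.updateRow_ne hij]
    · rw [Matrix.updateRow_ne ha]
      by_cases ha' : a = i
      · subst ha'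
        rw [Equiv.swap_apply_left, hN, Matrix.updateRow_self, Matrix.updateRow_self]
      · rw [Equiv.swap_apply_of_ne_of_ne ha' ha, hN, Matrix.updateRow_ne ha',
          Matrix.updateRow_ne ha]
  rw [h₄, Matrix.det_permute, Equiv.Perm.sign_swap hij] at h₁
  rw [← h₁]
  simp

/-- The diagonal of the adjugate of a singular matrix with vanishing column sums is proportional to
a kernel vector. -/
theorem adjugate_diag_mul [CommRing K] (M : Matrix n n K) (h : ∀ b, ∑ a, M a b = 0) (v : n → K)
    (hv : M.mulVec v = 0) (i j : n) :
    M.adjugate i i * v j = M.adjugate j j * v i := by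
  set N := M.updateRow i (Pi.single i 1) with hN
  have h₁ : N.mulVec v = v i • Pi.single i 1 := by
    funext a
    by_cases ha : a = i
    · subst ha
      simp [hN, Matrix.mulVec]
    · have := congrFun hv a
      simp only [Matrix.mulVec] at this
      simp [hN, Matrix.mulVec, ha, this]
  -- Cramer's rule for the system `N v = v i • e_i`. Its relevant cofactors are those of `M`, since
  -- only row `i` was changed.
  have h₂ : N.adjugate.mulVec (N.mulVec v) = N.det • v := by
    rw [Matrix.mulVec_mulVec, Matrix.adjugate_mul, Matrix.smul_mulVec, Matrix.one_mulVec]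
  have h₃ := congrFun h₂ j
  rw [h₁, Matrix.mulVec_smul, Matrix.mulVec_single_one] at h₃
  simp only [Pi.smul_apply, smul_eq_mul, Matrix.col_apply] at h₃
  rw [Matrix.adjugate_apply, hN, Matrix.updateRow_idem, ← Matrix.adjugate_apply,
    adjugate_eq_diag_of_colSum M h] at h₃
  rw [Matrix.adjugate_apply M i i, ← h₃, mul_comm]

/-- The hypothesis says that `N` is the transpose of `M` conjugated by the diagonal matrix of `v`;
neither operation changes principal minors. -/
theorem adjugate_diag_conj_transpose [Field K] (M : Matrix n n K) (v : n → K) (hv : ∀ a, v a ≠ 0)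
    (N : Matrix n n K) (hN : ∀ a b, N a b * v b = v a * M b a) (d : n) :
    N.adjugate d d = M.adjugate d d := by
  have h₁ : M.adjugate d d = M.transpose.adjugate d d := by
    rw [← Matrix.adjugate_transpose, Matrix.transpose_apply]
  rw [h₁, Matrix.adjugate_apply, Matrix.adjugate_apply]
  have h₂ : N.updateRow d (Pi.single d 1) * Matrix.diagonal v
      = Matrix.diagonal v * M.transpose.updateRow d (Pi.single d 1) := by
    ext a b
    rw [Matrix.mul_diagonal, Matrix.diagonal_mul]
    by_cases ha : a = d
    · subst ha
      rw [Matrix.updateRow_self, Matrix.updateRow_self]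
      by_cases hb : b = a
      · subst hb; simp
      · simp [hb]
    · rw [Matrix.updateRow_ne ha, Matrix.updateRow_ne ha, hN, Matrix.transpose_apply]
  have h₃ := congrArg Matrix.det h₂
  rw [Matrix.det_mul, Matrix.det_mul, mul_comm] at h₃
  refine mul_left_cancel₀ ?_ h₃
  rw [Matrix.det_diagonal]
  exact Finset.prod_ne_zero_iff.2 fun a _ => hv a

/-- For `0 ≤ x < 1` the matrix `1 - x • B` is strictly diagonally dominant in its columns. So the
determinant, which is `1` at `x = 0`, cannot change sign before `x = 1`. -/
theorem det_one_sub_nonneg (B : Matrix n n ℝ) (hB : ∀ a b, 0 ≤ B a b)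
    (hs : ∀ b, ∑ a, B a b ≤ 1) : 0 ≤ (1 - B).det := by
  by_contra hneg
  let f : ℝ → ℝ := fun x => (1 - x • B).det
  have hf : Continuous f := by
    refine Continuous.matrix_det ?_
    fun_prop
  have h₀ : f 0 = 1 := by simp [f]
  have h₁ : f 1 < 0 := by simpa [f] using hneg
  obtain ⟨x, hx, hx0⟩ := intermediate_value_Icc' (zero_le_one' ℝ) hf.continuousOn
    (show (0 : ℝ) ∈ Set.Icc (f 1) (f 0) from ⟨h₁.le, by rw [h₀]; exact zero_le_one⟩)
  have hx1 : x < 1 := lt_of_le_of_ne hx.2 (by rintro rfl; rw [hx0] at h₁; exact lt_irrefl _ h₁)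
  refine det_ne_zero_of_sum_col_lt_diag (A := 1 - x • B) (fun k => ?_) hx0
  have hk : B k k ≤ 1 := (Finset.single_le_sum (fun a _ => hB a k) (Finset.mem_univ k)).trans (hs k)
  have hxk : x * B k k < 1 :=
    (mul_le_of_le_one_right hx.1 hk).trans_lt hx1
  have e₁ : ∑ i ∈ Finset.univ.erase k, ‖(1 - x • B) i k‖ = ∑ i ∈ Finset.univ.erase k, x * B i k := by
    refine Finset.sum_congr rfl fun i hi => ?_
    have := Finset.ne_of_mem_erase hi
    rw [Matrix.sub_apply, Matrix.one_apply_ne this, zero_sub, norm_neg, Matrix.smul_apply,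
      smul_eq_mul, Real.norm_of_nonneg (mul_nonneg hx.1 (hB i k))]
  have e₂ : ‖(1 - x • B) k k‖ = 1 - x * B k k := by
    rw [Matrix.sub_apply, Matrix.one_apply_eq, Matrix.smul_apply, smul_eq_mul,
      Real.norm_of_nonneg (by linarith)]
  rw [e₁, e₂, ← Finset.mul_sum]
  have h₃ := hs k
  rw [← Finset.add_sum_erase _ _ (Finset.mem_univ k)] at h₃
  have h₄ := mul_le_mul_of_nonneg_left h₃ hx.1
  rw [mul_add] at h₄
  linarith

theorem adjugate_one_sub_nonneg (B : Matrix n n ℝ) (hB : ∀ a b, 0 ≤ B a b)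
    (hs : ∀ b, ∑ a, B a b ≤ 1) (d : n) : 0 ≤ (1 - B).adjugate d d := by
  rw [Matrix.adjugate_apply]
  -- The principal minor has the same shape `1 - B'`, where row `d` of `B` is set to zero.
  have : (1 - B).updateRow d (Pi.single d 1) = 1 - B.updateRow d 0 := by
    ext a b
    by_cases ha : a = d
    · subst ha
      simp [Matrix.one_apply, Pi.single_apply, eq_comm]
    · simp [Matrix.updateRow_ne ha]
  rw [this]
  have hle : ∀ a b, 0 ≤ B.updateRow d 0 a b ∧ B.updateRow d 0 a b ≤ B a b := fun a b => by
    by_cases ha : a = d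
    · subst ha
      simp [hB]
    · simp [Matrix.updateRow_ne ha, hB]
  exact det_one_sub_nonneg _ (fun a b => (hle a b).1)
    fun b => (Finset.sum_le_sum fun a _ => (hle a b).2).trans (hs b)

end Matrices

namespace Diagram

variable {D : Diagram} {K : Type}

/-- The weights of each crossing and each merge are normalized and have alternating sum `0`. -/
structure IsNormalized [CommRing K] (w : D.Node → Corner → K) : Prop where
  cross : ∀ x : D.X, w (.inl x) .W + w (.inl x) .N + w (.inl x) .E = 1
  crossS : ∀ x : D.X, w (.inl x) .S = 1
  merge : ∀ m : D.M, w (.inr m) .W + w (.inr m) .E = 1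
  mergeS : ∀ m : D.M, w (.inr m) .S + w (.inr m) .N = 1

open Classical in
/-- The transition weights of the random walk on the arcs, against the orientation. -/
noncomputable def walkRow [CommRing K] (w : D.Node → Corner → K) :
    (D.Node ⊕ D.Node) ⊕ D.S → D.Arc → K
  | .inl (.inl (.inl x)) => (1 - w (.inl x) .W) • Pi.single (D.oL x) 1
      + w (.inl x) .E • Pi.single (D.oR x) 1
  | .inl (.inl (.inr m)) => w (.inr m) .E • Pi.single (D.oM m) 1
  | .inl (.inr (.inl x)) => w (.inl x) .W • Pi.single (D.oL x) 1
      + (1 - w (.inl x) .E) • Pi.single (D.oR x) 1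
  | .inl (.inr (.inr m)) => w (.inr m) .W • Pi.single (D.oM m) 1
  | .inr s => Pi.single (D.oSL s) 1 + Pi.single (D.oSR s) 1

/-- The transition matrix of the random walk on the arcs. -/
noncomputable def walkMatrix [CommRing K] (w : D.Node → Corner → K) : Matrix D.Arc D.Arc K :=
  fun a => walkRow w (D.headEquiv a)

section

variable [CommRing K] (w : D.Node → Corner → K) (z : D.Arc → K)

theorem headEquiv_iL (x : D.Node) : D.headEquiv (D.iL x) = .inl (.inl x) :=
  D.headEquiv.apply_symm_apply _

theorem headEquiv_iR (x : D.Node) : D.headEquiv (D.iR x) = .inl (.inr x) :=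
  D.headEquiv.apply_symm_apply _

theorem headEquiv_iS (s : D.S) : D.headEquiv (D.iS s) = .inr s :=
  D.headEquiv.apply_symm_apply _

theorem walk_iL_cross (x : D.X) : (walkMatrix w).mulVec z (D.iL (.inl x))
    = (1 - w (.inl x) .W) * z (D.oL x) + w (.inl x) .E * z (D.oR x) := by
  change walkRow w (D.headEquiv _) ⬝ᵥ z = _
  simp only [headEquiv_iL, walkRow, add_dotProduct, smul_dotProduct, single_dotProduct, one_mul,
    smul_eq_mul]

theorem walk_iL_merge (m : D.M) : (walkMatrix w).mulVec z (D.iL (.inr m))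
    = w (.inr m) .E * z (D.oM m) := by
  change walkRow w (D.headEquiv _) ⬝ᵥ z = _
  simp only [headEquiv_iL, walkRow, smul_dotProduct, single_dotProduct, one_mul,
    smul_eq_mul]

theorem walk_iR_cross (x : D.X) : (walkMatrix w).mulVec z (D.iR (.inl x))
    = w (.inl x) .W * z (D.oL x) + (1 - w (.inl x) .E) * z (D.oR x) := by
  change walkRow w (D.headEquiv _) ⬝ᵥ z = _
  simp only [headEquiv_iR, walkRow, add_dotProduct, smul_dotProduct, single_dotProduct, one_mul,
    smul_eq_mul]

theorem walk_iR_merge (m : D.M) : (walkMatrix w).mulVec z (D.iR (.inr m))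
    = w (.inr m) .W * z (D.oM m) := by
  change walkRow w (D.headEquiv _) ⬝ᵥ z = _
  simp only [headEquiv_iR, walkRow, smul_dotProduct, single_dotProduct, one_mul,
    smul_eq_mul]

theorem walk_iS (s : D.S) : (walkMatrix w).mulVec z (D.iS s)
    = z (D.oSL s) + z (D.oSR s) := by
  change walkRow w (D.headEquiv _) ⬝ᵥ z = _
  simp only [headEquiv_iS, walkRow, add_dotProduct, single_dotProduct, one_mul]

variable {w}

theorem IsNormalized.sum_walk (hw : IsNormalized w) : ∑ a, (walkMatrix w).mulVec z a = ∑ a, z a := by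
  rw [D.sum_head, D.sum_tail, Fintype.sum_sum_type]
  simp only [walk_iL_cross, walk_iL_merge, walk_iR_cross, walk_iR_merge, walk_iS]
  congr 1
  congr 1
  · exact Finset.sum_congr rfl fun x _ => by ring
  · refine Finset.sum_congr rfl fun m _ => ?_
    rw [← add_mul, add_comm (w _ _), hw.merge, one_mul]

open Classical in
theorem IsNormalized.walk_colSum (hw : IsNormalized w) (b : D.Arc) : ∑ a, walkMatrix w a b = 1 := by
  have := hw.sum_walk (Pi.single b 1)
  simpa using this

open Classical in
theorem IsNormalized.sub_walk_colSum (hw : IsNormalized w) (b : D.Arc) :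
    ∑ a, (1 - walkMatrix w) a b = 0 := by
  simp only [Matrix.sub_apply, Finset.sum_sub_distrib, hw.walk_colSum]
  simp [Matrix.one_apply]

end

end Diagram

end MOY

/-! ### The reduced state sum as a principal minor of the walk -/

namespace MOY

namespace Diagram

variable {D : Diagram} {K : Type}

/-- The signed arcs crossed by a path from `r` to `r'`; the differences of `g` telescope along it.
The same integral chain serves for all rings and all `g`. -/
theorem exists_path (hL : IsEmpty D.Loop) (r r' : D.Region) :
    ∃ P : D.Arc → ℤ, ∀ (K : Type) [CommRing K] (g : D.Region → K),
      ∑ a, (P a : K) * (g (D.rightR (.inl a)) - g (D.leftR (.inl a))) = g r' - g r := by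
  classical
  induction D.connected r r' with
  | rel a b h =>
    obtain ⟨e | l, rfl, rfl⟩ := h
    · refine ⟨Pi.single e 1, fun K _ g => ?_⟩
      rw [Finset.sum_eq_single e]
      · rw [Pi.single_eq_same, Int.cast_one, one_mul]
        rfl
      · intro b _ hb
        simp [hb]
      · simp
    · exact hL.elim l
  | refl a => exact ⟨0, fun K _ g => by simp⟩
  | symm a b _ ih =>
    obtain ⟨P, hP⟩ := ih
    refine ⟨-P, fun K _ g => ?_⟩
    have := hP K g
    simp only [Pi.neg_apply, Int.cast_neg, neg_mul, Finset.sum_neg_distrib, this]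
    ring
  | trans a b c _ _ ih₁ ih₂ =>
    obtain ⟨P, hP⟩ := ih₁
    obtain ⟨Q, hQ⟩ := ih₂
    refine ⟨P + Q, fun K _ g => ?_⟩
    have h₁ := hP K g
    have h₂ := hQ K g
    simp only [Pi.add_apply, Int.cast_add, add_mul, Finset.sum_add_distrib, h₁, h₂]
    ring

open Classical in
/-- A square matrix with the given rows for the crossings and merges, a coordinate row, and the
balance conditions at all but one of the crossings and vertices. -/
noncomputable def frameMatrix [CommRing K] (i d : D.Arc) (F : D.Node → D.Arc → K) :
    Matrix D.Arc D.Arc K :=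
  fun a => if a = i then Pi.single d 1 else
    match D.headEquiv a with
    | .inl (.inl x) => F x
    | _ => D.divMatrix K (D.headVtx a)

section

variable [CommRing K] {i : D.Arc} (hi : ∀ x, i ≠ D.iL x) (d : D.Arc) (F : D.Node → D.Arc → K)

open Classical in
theorem frameMatrix_self : frameMatrix i d F i = Pi.single d 1 := if_pos rfl

include hi in
theorem frameMatrix_iL (x : D.Node) : frameMatrix i d F (D.iL x) = F x := by
  simp only [frameMatrix, headEquiv_iL]
  rw [if_neg (fun h => hi x h.symm)]

theorem frameMatrix_of_ne {a : D.Arc} (ha : a ≠ i) (ha' : ∀ x, a ≠ D.iL x) :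
    frameMatrix i d F a = D.divMatrix K (D.headVtx a) := by
  simp only [frameMatrix]
  rw [if_neg ha]
  rcases D.arc_head_cases a with ⟨x, rfl⟩ | ⟨x, rfl⟩ | ⟨s, rfl⟩
  · exact absurd rfl (ha' x)
  · simp only [headEquiv_iR]
  · simp only [headEquiv_iS]

theorem iL_injective : Function.Injective D.iL := fun x y h => by
  have := congrArg D.headEquiv h
  rw [headEquiv_iL, headEquiv_iL] at this
  exact Sum.inl_injective (Sum.inl_injective this)

theorem iL_ne_iR (x y : D.Node) : D.iL x ≠ D.iR y := fun h => by
  have := congrArg D.headEquiv h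
  rw [headEquiv_iL, headEquiv_iR] at this
  simp at this

theorem iL_ne_iS (x : D.Node) (s : D.S) : D.iL x ≠ D.iS s := fun h => by
  have := congrArg D.headEquiv h
  rw [headEquiv_iL, headEquiv_iS] at this
  simp at this

end

open Classical in
theorem frameMatrix_map [CommRing K] (i d : D.Arc) (F : D.Node → D.Arc → ℤ) :
    (frameMatrix i d F).map (Int.cast : ℤ → K) = frameMatrix i d (fun x a => (F x a : K)) := by
  ext a b
  simp only [Matrix.map_apply, frameMatrix]
  split_ifs with h
  · simp only [Pi.single_apply]
    split_ifs <;> simp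
  · rcases D.headEquiv a with (x | x) | s
    · rfl
    · simp only [divMatrix]
      split_ifs <;> simp
    · simp only [divMatrix]
      split_ifs <;> simp

section

variable (hD : D.Good) (hL : IsEmpty D.Loop) {i : D.Arc} (hi : ∀ x, i ≠ D.iL x) {d : D.Arc}
  (e : D.Node ≃ FarRegion (D := D) (.inl d)) (P : D.Node → D.Arc → ℤ)
  (hP : ∀ x (K : Type) [CommRing K] (g : D.Region → K),
    ∑ a, (P x a : K) * (g (D.rightR (.inl a)) - g (D.leftR (.inl a)))
      = g (e x).1 - g (D.leftR (.inl d)))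

include hD hL hi hP in
open Classical in
-- A kernel vector is balanced, hence by `Good.exact` the difference of a region function `g`. Since
-- it vanishes at `d` and sums to zero along all paths, `g` is constant.
theorem det_frameMatrix_path_ne_zero (K : Type) [Field K] :
    (frameMatrix i d (fun x a => (P x a : K))).det ≠ 0 := by
  intro h
  obtain ⟨z, hz, hMz⟩ := Matrix.exists_mulVec_eq_zero_iff.2 h
  have hrow : ∀ a, frameMatrix i d (fun x a => (P x a : K)) a ⬝ᵥ z = 0 := fun a => congrFun hMz a
  have hdiv : ∀ v, v ≠ D.headVtx i → (D.divMatrix K).mulVec z v = 0 := by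
    have : ∀ a, a ≠ i → (∀ x, a ≠ D.iL x) → (D.divMatrix K).mulVec z (D.headVtx a) = 0 := by
      intro a ha ha'
      have := hrow a
      rwa [frameMatrix_of_ne _ _ ha ha'] at this
    rintro (x | s) hv
    · have := this (D.iR x) (fun h => hv (by rw [← h, headVtx_iR])) (fun y => (iL_ne_iR y x).symm)
      rwa [headVtx_iR] at this
    · have := this (D.iS s) (fun h => hv (by rw [← h, headVtx_iS])) (fun y => (iL_ne_iS y s).symm)
      rwa [headVtx_iS] at this
  -- The balance conditions of all vertices add up to zero, so the one missing in the frame matrix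
  -- follows from the others.
  have htot : ∑ v, (D.divMatrix K).mulVec z v = 0 := by
    have := divMatrix_mulVec z (fun _ => (1 : K))
    simpa [dotProduct] using this
  have hdiv0 : (D.divMatrix K).mulVec z = 0 := by
    funext v
    by_cases hv : v = D.headVtx i
    · rw [← Finset.add_sum_erase _ _ (Finset.mem_univ v)] at htot
      rw [Finset.sum_eq_zero, add_zero] at htot
      · exact htot
      · intro v' hv'
        exact hdiv v' (hv ▸ Finset.ne_of_mem_erase hv')
    · exact hdiv v hv
  obtain ⟨g, hg⟩ := hD.exact (fun a => a.elim z (fun l => hL.elim l)) (by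
    intro h
    have := divMatrix_mulVec z h
    rw [hdiv0, dotProduct_zero] at this
    exact this.symm)
  have hzd : z d = 0 := by
    have := hrow i
    rw [frameMatrix_self] at this
    simpa using this
  have hgd : g (D.rightR (.inl d)) = g (D.leftR (.inl d)) := by
    have := hg (.inl d)
    simp only [Sum.elim_inl, hzd] at this
    exact (sub_eq_zero.1 this.symm)
  have hgall : ∀ r, g r = g (D.leftR (.inl d)) := by
    intro r
    by_cases hr : r ≠ D.leftR (.inl d) ∧ r ≠ D.rightR (.inl d)
    · have h₁ := hrow (D.iL (e.symm ⟨r, hr⟩))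
      rw [frameMatrix_iL hi] at h₁
      have h₂ := hP (e.symm ⟨r, hr⟩) K g
      rw [Equiv.apply_symm_apply] at h₂
      have h₃ : ∑ a, (P (e.symm ⟨r, hr⟩) a : K) * (g (D.rightR (.inl a)) - g (D.leftR (.inl a)))
          = 0 := by
        rw [← h₁]
        refine Finset.sum_congr rfl fun a _ => ?_
        rw [← hg (.inl a)]
        rfl
      rw [h₃] at h₂
      exact sub_eq_zero.1 h₂.symm
    · rw [not_and_or, not_not, not_not] at hr
      rcases hr with rfl | rfl
      · rfl
      · exact hgd
  apply hz
  funext a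
  have := hg (.inl a)
  simp only [Sum.elim_inl] at this
  rw [this, hgall (D.rightR _), hgall (D.leftR (.inl a))]
  exact sub_self _

include hD hL hi hP in
open Classical in
-- An integral matrix that is invertible modulo every prime has determinant `1` or `-1`.
theorem det_frameMatrix_path : (frameMatrix i d P).det = 1 ∨ (frameMatrix i d P).det = -1 := by
  rw [← Int.isUnit_iff, Int.isUnit_iff_natAbs_eq]
  by_contra hne
  obtain ⟨p, hp, hdvd⟩ := Nat.exists_prime_and_dvd hne
  have : Fact p.Prime := ⟨hp⟩
  refine det_frameMatrix_path_ne_zero hD hL hi e P hP (ZMod p) ?_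
  have h := (Int.castRingHom (ZMod p)).map_det (frameMatrix i d P)
  rw [← frameMatrix_map]
  refine h.symm.trans ?_
  rw [eq_intCast, ZMod.intCast_zmod_eq_zero_iff_dvd]
  exact Int.natCast_dvd.2 hdvd

include hD hL hi hP in
open Classical in
-- The path matrix serves as a change of basis: its inverse sends the unit vector at `iL y` to the
-- difference of the indicator function of the region `e y`. In the new basis the coordinate row and
-- the balance rows are unit rows, and a square block indexed by the nodes remains.
theorem det_frameMatrix (K : Type) [Field K] (F : D.Node → D.Arc → K) :
    (frameMatrix i d F).det = Matrix.det (fun x y =>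
        F x ⬝ᵥ (D.diffMatrix K).mulVec (Pi.single (e y).1 1))
      * ((frameMatrix i d P).det : ℤ) := by
  set N := frameMatrix i d (fun x a => (P x a : K)) with hN
  have hNdet : N.det = ((frameMatrix i d P).det : ℤ) := by
    rw [hN, ← frameMatrix_map]
    exact ((Int.castRingHom K).map_det _).symm
  have hunit : IsUnit N.det := (det_frameMatrix_path_ne_zero hD hL hi e P hP K).isUnit
  have hcol : ∀ y, N⁻¹.mulVec (Pi.single (D.iL y) 1)
      = (D.diffMatrix K).mulVec (Pi.single (e y).1 1) := by
    intro y
    have : N.mulVec ((D.diffMatrix K).mulVec (Pi.single (e y).1 1)) = Pi.single (D.iL y) 1 := by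
      funext a
      change N a ⬝ᵥ _ = _
      by_cases ha : ∃ x, a = D.iL x
      · obtain ⟨x, rfl⟩ := ha
        rw [hN, frameMatrix_iL hi]
        have h₁ := hP x K (Pi.single (e y).1 1)
        simp only [dotProduct, diffMatrix_mulVec]
        rw [h₁, Pi.single_eq_of_ne (e y).2.1.symm, sub_zero, Pi.single_apply, Pi.single_apply]
        simp only [iL_injective.eq_iff, Subtype.val_injective.eq_iff, e.injective.eq_iff]
      · simp only [not_exists] at ha
        rw [Pi.single_eq_of_ne (ha y)]
        by_cases hai : a = i
        · subst hai
          rw [hN, frameMatrix_self, single_dotProduct, one_mul, diffMatrix_mulVec,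
            Pi.single_eq_of_ne (e y).2.1.symm, Pi.single_eq_of_ne (e y).2.2.symm, sub_zero]
        · rw [hN, frameMatrix_of_ne _ _ hai ha]
          change (D.divMatrix K).mulVec _ _ = 0
          rw [Matrix.mulVec_mulVec, divMatrix_mul_diffMatrix, Matrix.zero_mulVec]
          rfl
    rw [← this, Matrix.mulVec_mulVec, Matrix.nonsing_inv_mul _ hunit, Matrix.one_mulVec]
  set T := frameMatrix i d F * N⁻¹ with hT
  have hTN : frameMatrix i d F = T * N := by
    rw [hT, Matrix.mul_assoc, Matrix.nonsing_inv_mul _ hunit, Matrix.mul_one]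
  have hrow : ∀ a, (∀ x, a ≠ D.iL x) → ∀ b, T a b = (1 : Matrix D.Arc D.Arc K) a b := by
    intro a ha b
    rw [← Matrix.mul_nonsing_inv _ hunit, hT, Matrix.mul_apply, Matrix.mul_apply]
    have : frameMatrix i d F a = N a := by
      by_cases hai : a = i
      · subst hai
        rw [hN, frameMatrix_self, frameMatrix_self]
      · rw [hN, frameMatrix_of_ne _ _ hai ha, frameMatrix_of_ne _ _ hai ha]
    rw [this]
  rw [hTN, Matrix.det_mul, hNdet]
  congr 1
  rw [Matrix.twoBlockTriangular_det T (fun a => ∃ x, a = D.iL x)]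
  · have h₁ : (T.toSquareBlockProp fun a => ¬∃ x, a = D.iL x) = 1 := by
      ext ⟨a, ha⟩ ⟨b, hb⟩
      rw [Matrix.toSquareBlockProp_def, Matrix.of_apply, hrow a (not_exists.1 ha)]
      simp [Matrix.one_apply]
    rw [h₁, Matrix.det_one, mul_one]
    let φ : D.Node ≃ {a // ∃ x, a = D.iL x} := Equiv.ofBijective (fun x => ⟨D.iL x, x, rfl⟩)
      ⟨fun x y h => iL_injective (congrArg Subtype.val h), fun ⟨a, x, h⟩ => ⟨x, Subtype.ext h.symm⟩⟩
    rw [← Matrix.det_submatrix_equiv_self φ]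
    congr 1
    funext x y
    rw [← hcol, ← frameMatrix_iL hi d F x]
    change T (D.iL x) (D.iL y) = _
    rw [Matrix.mulVec_single_one, hT, Matrix.mul_apply]
    rfl
  · intro a ha b hb
    rw [hrow a (not_exists.1 ha), Matrix.one_apply_ne]
    rintro rfl
    exact ha hb

end

section

variable [CommRing K] {w : D.Node → Corner → K}

/-- On differences of region functions, the rows of `1 - walkMatrix w` at left incoming arcs become,
up to sign, the rows of signed corner weights. The normalization is what makes the coefficients
match. -/
theorem one_sub_walk_diff_cross [DecidableEq D.Arc] (hw : IsNormalized w) (x : D.Node)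
    (g : D.Region → K) :
    (1 - walkMatrix w) (D.iL x) ⬝ᵥ (D.diffMatrix K).mulVec g
      = - ∑ k, (kappa x k : K) * w x k * g (D.corner x k) := by
  have : (1 - walkMatrix w) (D.iL x) ⬝ᵥ (D.diffMatrix K).mulVec g
      = (D.diffMatrix K).mulVec g (D.iL x)
        - (walkMatrix w).mulVec ((D.diffMatrix K).mulVec g) (D.iL x) := by
    change (1 - walkMatrix w).mulVec _ (D.iL x) = _
    rw [Matrix.sub_mulVec, Matrix.one_mulVec]
    rfl
  rw [this, sum_corner]
  rcases x with x | m
  · rw [walk_iL_cross]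
    simp only [diffMatrix_mulVec, left_iL, right_iL, left_oL, right_oL, left_oR, right_oR, kappa,
      hw.crossS]
    have := hw.cross x
    push_cast
    linear_combination (g (D.corner (.inl x) .N)) * this
  · rw [walk_iL_merge]
    simp only [diffMatrix_mulVec, left_iL, right_iL, left_oM, right_oM, kappa, corner_merge_N]
    have h₁ := hw.merge m
    have h₂ := hw.mergeS m
    push_cast
    linear_combination (g (D.corner (.inr m) .W)) * h₁ - g (D.corner (.inr m) .S) * h₂

open Classical in
/-- The diagonal cofactors of `1 - walkMatrix w` in terms of a frame matrix. -/
theorem IsNormalized.adjugate_eq_det (hw : IsNormalized w) {i : D.Arc} (hi : ∀ x, i ≠ D.iL x)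
    (d : D.Arc) : (1 - walkMatrix w).adjugate d d
      = (frameMatrix i d fun x => (1 - walkMatrix w) (D.iL x)).det := by
  rw [← adjugate_eq_diag_of_colSum _ hw.sub_walk_colSum d i, Matrix.adjugate_apply]
  set M := (1 - walkMatrix w).updateRow i (Pi.single d 1) with hM
  -- Row operations of determinant `1`, away from row `i`: adding row `iL x` to row `iR x` produces
  -- the balance condition at `x`. The row of a split is a balance condition already.
  let U : Matrix D.Arc D.Arc K := fun a => Pi.single a 1 + if a = i then 0 else
    match D.headEquiv a with
    | .inl (.inr x) => Pi.single (D.iL x) 1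
    | _ => 0
  have hdiv : ∀ (v : D.Vtx) (b : D.Arc), D.divMatrix K v b = ∑ a with D.headVtx a = v,
      (1 - walkMatrix w) a b := by
    intro v b
    have h₁ := divMatrix_mulVec (Pi.single b 1) (Pi.single v (1 : K))
    rw [single_dotProduct, one_mul, Matrix.mulVec_single_one, Matrix.col_apply] at h₁
    rw [h₁]
    simp only [sub_mul, Finset.sum_sub_distrib, Finset.sum_filter]
    have h₂ : ∑ a, (Pi.single v 1 : D.Vtx → K) (D.headVtx a) * (Pi.single b 1 : D.Arc → K) a
        = ∑ a, if D.headVtx a = v then (1 : Matrix D.Arc D.Arc K) a b else 0 := by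
      refine Finset.sum_congr rfl fun a _ => ?_
      simp only [Pi.single_apply, Matrix.one_apply]
      split_ifs <;> simp
    have h₃ : ∑ a, (Pi.single v 1 : D.Vtx → K) (D.tailVtx a) * (Pi.single b 1 : D.Arc → K) a
        = ∑ a, (Pi.single v 1 : D.Vtx → K) (D.headVtx a)
          * (walkMatrix w).mulVec (Pi.single b 1) a := by
      set z : D.Arc → K := Pi.single b 1
      rw [D.sum_tail, D.sum_head, Fintype.sum_sum_type]
      simp only [walk_iL_cross, walk_iL_merge, walk_iR_cross, walk_iR_merge, walk_iS, headVtx_iL,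
        headVtx_iR, headVtx_iS, tailVtx_oL, tailVtx_oR, tailVtx_oM, tailVtx_oSL, tailVtx_oSR]
      congr 1
      · congr 1
        · exact Finset.sum_congr rfl fun x _ => by ring
        · refine Finset.sum_congr rfl fun m _ => ?_
          rw [← mul_add, ← add_mul, add_comm (w _ _), hw.merge, one_mul]
      · exact Finset.sum_congr rfl fun x _ => by ring
    rw [h₂, h₃, ← Finset.sum_sub_distrib]
    refine Finset.sum_congr rfl fun a _ => ?_
    simp only [Pi.single_apply, Matrix.sub_apply, Matrix.mulVec_single_one, Matrix.col_apply]
    split_ifs <;> simp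
  have hdivx : ∀ x b, D.divMatrix K (.inl x) b
      = (1 - walkMatrix w) (D.iL x) b + (1 - walkMatrix w) (D.iR x) b := by
    intro x b
    rw [hdiv, Finset.sum_filter, D.sum_head]
    simp [-Fintype.sum_sum_type, Finset.sum_add_distrib]
  have hdivs : ∀ s b, D.divMatrix K (.inr s) b = (1 - walkMatrix w) (D.iS s) b := by
    intro s b
    rw [hdiv, Finset.sum_filter, D.sum_head]
    simp
  have hU : frameMatrix i d (fun x => (1 - walkMatrix w) (D.iL x)) = U * M := by
    ext a b
    have hmul : (U * M) a b = U a ⬝ᵥ fun k => M k b := rfl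
    rw [hmul]
    by_cases hai : a = i
    · subst hai
      simp only [U, frameMatrix_self, if_pos, add_zero, single_dotProduct, one_mul]
      rw [hM, Matrix.updateRow_self]
    · rcases D.arc_head_cases a with ⟨x, rfl⟩ | ⟨x, rfl⟩ | ⟨s, rfl⟩
      · simp only [U, frameMatrix_iL hi, if_neg hai, headEquiv_iL, add_zero, single_dotProduct,
          one_mul]
        rw [hM, Matrix.updateRow_ne hai]
      · rw [frameMatrix_of_ne _ _ hai fun y => (iL_ne_iR y x).symm]
        simp only [U, if_neg hai, headEquiv_iR, add_dotProduct, single_dotProduct, one_mul]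
        rw [hM, Matrix.updateRow_ne hai, Matrix.updateRow_ne (hi x).symm, headVtx_iR, hdivx,
          add_comm]
      · rw [frameMatrix_of_ne _ _ hai fun y => (iL_ne_iS y s).symm]
        simp only [U, if_neg hai, headEquiv_iS, add_zero, single_dotProduct, one_mul]
        rw [hM, Matrix.updateRow_ne hai, headVtx_iS, hdivs]
  have hdetU : U.det = 1 := by
    rw [Matrix.twoBlockTriangular_det' U (fun a => ∃ x, a = D.iL x)]
    · have h₁ : (U.toSquareBlockProp fun a => ∃ x, a = D.iL x) = 1 := by
        ext ⟨a, x, rfl⟩ ⟨b, hb⟩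
        rw [Matrix.toSquareBlockProp_def, Matrix.of_apply]
        simp only [U, headEquiv_iL, ite_self, add_zero]
        simp [Matrix.one_apply, Pi.single_apply, eq_comm]
      have h₂ : (U.toSquareBlockProp fun a => ¬∃ x, a = D.iL x) = 1 := by
        ext ⟨a, ha⟩ ⟨b, hb⟩
        rw [Matrix.toSquareBlockProp_def, Matrix.of_apply]
        have : (if a = i then (0 : D.Arc → K) else
            match D.headEquiv a with
            | .inl (.inr x) => Pi.single (D.iL x) 1
            | _ => 0) b = 0 := by
          split_ifs
          · rfl
          · rcases D.headEquiv a with (x | x) | s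
            · rfl
            · exact Pi.single_eq_of_ne (fun h => hb ⟨x, h⟩) _
            · rfl
        simp only [U, Pi.add_apply, this, add_zero]
        simp [Matrix.one_apply, Pi.single_apply, eq_comm]
      rw [h₁, h₂, Matrix.det_one, Matrix.det_one, mul_one]
    · rintro a ⟨x, rfl⟩ b hb
      simp only [U, headEquiv_iL, ite_self, add_zero]
      exact Pi.single_eq_of_ne (fun h => hb ⟨x, h⟩) _
  rw [hU, Matrix.det_mul, hdetU, one_mul]

end

theorem exists_ne_iL (d : D.Arc) : ∃ i : D.Arc, ∀ x, i ≠ D.iL x := by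
  rcases D.arc_head_cases d with ⟨x, rfl⟩ | ⟨x, rfl⟩ | ⟨s, rfl⟩
  · exact ⟨D.iR x, fun y => (iL_ne_iR y x).symm⟩
  · exact ⟨D.iR x, fun y => (iL_ne_iR y x).symm⟩
  · exact ⟨D.iS s, fun y => (iL_ne_iS y s).symm⟩

open Classical in
-- `η` collects the common sign of the states, the determinant of the path matrix, and one sign for
-- each node from `one_sub_walk_diff_cross`. None of them depends on the field or the weights, so
-- one test case can determine `η`.
theorem Good.adjugate_eq_sign_mul (hD : D.Good) (c : D.PosColoring) (d : D.Arc) :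
    ∃ η : ℤ, (η = 1 ∨ η = -1) ∧ ∀ (K : Type) [Field K] (w : D.Node → Corner → K),
      IsNormalized w → (1 - walkMatrix w).adjugate d d = (η : K) * reducedSum (.inl d) w := by
  have hL : IsEmpty D.Loop := hD.loop_cases.resolve_right fun h => h.1.elim d
  obtain ⟨e⟩ := hD.nonempty_equiv c (.inl d)
  obtain ⟨ε, hε, hdet⟩ := hD.exists_sign e c
  obtain ⟨i, hi⟩ := exists_ne_iL d
  choose P hP using fun x => exists_path hL (D.leftR (.inl d)) (e x).1
  have hu := det_frameMatrix_path hD hL hi e P hP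
  refine ⟨(-1) ^ Fintype.card D.Node * ε * (frameMatrix i d P).det, ?_, fun K _ w hw => ?_⟩
  · rcases neg_one_pow_eq_or ℤ (Fintype.card D.Node) with h | h <;> rcases hε with h' | h' <;>
      rcases hu with h'' | h'' <;> rw [h, h', h''] <;> norm_num
  · rw [hw.adjugate_eq_det hi, det_frameMatrix hD hL hi e P hP]
    have : (fun x y => (1 - walkMatrix w) (D.iL x) ⬝ᵥ
        (D.diffMatrix K).mulVec (Pi.single (e y).1 1) : Matrix D.Node D.Node K)
        = - cornerMatrix e w := by
      funext x y
      rw [one_sub_walk_diff_cross hw, Matrix.neg_apply, cornerMatrix]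
      congr 1
      refine Finset.sum_congr rfl fun k _ => ?_
      rw [Pi.single_apply]
      split_ifs <;> simp
    rw [this, Matrix.det_neg, hdet]
    push_cast
    ring

/-- Positive normalized weights. -/
noncomputable def uniformWeight : D.Node → Corner → ℝ
  | .inl _, .S => 1
  | .inl _, _ => 1 / 3
  | .inr _, _ => 1 / 2

theorem uniformWeight_pos (x : D.Node) (k : Corner) : 0 < uniformWeight x k := by
  rcases x with x | m <;> cases k <;> norm_num [uniformWeight]

theorem isNormalized_uniformWeight : IsNormalized (D := D) uniformWeight := by
  constructor <;> intro _ <;> norm_num [uniformWeight]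

open Classical in
theorem uniformWalk_nonneg (a b : D.Arc) : 0 ≤ walkMatrix (D := D) uniformWeight a b := by
  have hs : ∀ a b : D.Arc, 0 ≤ (Pi.single a 1 : D.Arc → ℝ) b := fun a b => by
    rw [Pi.single_apply]
    split_ifs <;> norm_num
  simp only [walkMatrix]
  rcases D.headEquiv a with ((x | m) | (x | m)) | s <;>
    simp only [walkRow, Pi.add_apply, Pi.smul_apply, smul_eq_mul]
  · exact add_nonneg (mul_nonneg (by norm_num [uniformWeight]) (hs _ _))
      (mul_nonneg (by norm_num [uniformWeight]) (hs _ _))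
  · exact mul_nonneg (by norm_num [uniformWeight]) (hs _ _)
  · exact add_nonneg (mul_nonneg (by norm_num [uniformWeight]) (hs _ _))
      (mul_nonneg (by norm_num [uniformWeight]) (hs _ _))
  · exact mul_nonneg (by norm_num [uniformWeight]) (hs _ _)
  · exact add_nonneg (hs _ _) (hs _ _)

open Classical in
/-- The reduced state sum is a principal minor of `1 - walkMatrix w`. -/
theorem Good.reducedSum_eq_adjugate (hD : D.Good) (c : D.PosColoring) (d : D.Arc) [Field K]
    {w : D.Node → Corner → K} (hw : IsNormalized w) :
    reducedSum (.inl d) w = (1 - walkMatrix w).adjugate d d := by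
  obtain ⟨η, hη | hη, h⟩ := hD.adjugate_eq_sign_mul c d
  · rw [h K w hw, hη, Int.cast_one, one_mul]
  -- The test case: at the uniform weights the minor is nonnegative, and the state sum is positive
  -- as soon as there is a state. So `η = -1` can only occur without states, and then both sides
  -- vanish.
  · have h₁ := h ℝ uniformWeight isNormalized_uniformWeight
    have h₂ := adjugate_one_sub_nonneg (walkMatrix (D := D) uniformWeight) uniformWalk_nonneg
      (fun b => (isNormalized_uniformWeight.walk_colSum b).le) d
    have hpos : ∀ s : D.Node → Corner, 0 < ∏ x, uniformWeight x (s x) :=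
      fun s => Finset.prod_pos fun x _ => uniformWeight_pos x _
    have hno : ∀ s, ¬ IsReducedState (D := D) (.inl d) s := by
      intro s hs
      have : 0 < reducedSum (D := D) (.inl d) uniformWeight :=
        Finset.sum_pos (fun s _ => hpos s) ⟨s, by simpa using hs⟩
      rw [h₁, hη] at h₂
      push_cast at h₂
      linarith
    have hz : reducedSum (.inl d) w = 0 := by
      rw [reducedSum, Finset.filter_eq_empty_iff.2 fun s _ hs => hno s hs, Finset.sum_empty]
    rw [h K w hw, hz, mul_zero]

end Diagram

end MOY

/-! ### Euler characteristic and rotation of parts of the sphere -/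

namespace MOY

theorem sum_subtype_mul {ι K : Type*} [Fintype ι] [CommRing K] (p : ι → Prop) [DecidablePred p]
    (F : ι → K) (v : {i // p i} → K) :
    ∑ i : {i // p i}, F i * v i = ∑ i, F i * (if h : p i then v ⟨i, h⟩ else 0) := by
  rw [← Finset.sum_filter_of_ne (p := p), Finset.sum_subtype (Finset.univ.filter p) (p := p)]
  · refine Finset.sum_congr rfl fun i _ => ?_
    rw [dif_pos i.2]
  · simp
  · intro i _ hi
    by_contra h
    rw [dif_neg h, mul_zero] at hi
    exact hi rfl

namespace Diagram

variable {D : Diagram}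

/-- An arc is inner to a set of regions if both its sides are. -/
def IsInnerArc (U : D.Region → Prop) (a : D.Arc) : Prop :=
  U (D.leftR (.inl a)) ∧ U (D.rightR (.inl a))

/-- A crossing or vertex is inner to a set of regions if all arcs at it are. -/
def IsInnerVtx (U : D.Region → Prop) (v : D.Vtx) : Prop :=
  ∀ a, D.headVtx a = v ∨ D.tailVtx a = v → IsInnerArc U a

open Classical in
/-- A connected open part of the sphere has Euler characteristic at most `1`. -/
theorem euler_le_one (U : D.Region → Prop)
    (hU : ∀ h : D.Region → ℚ, (∀ a, IsInnerArc U a →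
      h (D.leftR (.inl a)) = h (D.rightR (.inl a))) → ∀ r r', U r → U r' → h r = h r')
    (hV : ∀ h : D.Vtx → ℚ, (∀ a, h (D.headVtx a) = h (D.tailVtx a)) →
      (∀ v, ¬ IsInnerVtx U v → h v = 0) → ∀ v, h v = 0) :
    Fintype.card {r // U r} + Fintype.card {v // IsInnerVtx U v}
      ≤ Fintype.card {a // IsInnerArc U a} + 1 := by
  let P : Matrix {a // IsInnerArc U a} {r // U r} ℚ := fun a r => D.diffMatrix ℚ a r
  let Q : Matrix {v // IsInnerVtx U v} {a // IsInnerArc U a} ℚ := fun v a => D.divMatrix ℚ v a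
  have hQ0 : ∀ v, IsInnerVtx U v → ∀ a, ¬ IsInnerArc U a → D.divMatrix ℚ v a = 0 := by
    intro v hv a ha
    have h₁ : D.headVtx a ≠ v := fun h => ha (hv a (.inl h))
    have h₂ : D.tailVtx a ≠ v := fun h => ha (hv a (.inr h))
    simp [divMatrix, h₁, h₂]
  have hQP : Q * P = 0 := by
    ext ⟨v, hv⟩ ⟨r, hr⟩
    have h := congrFun (congrFun (divMatrix_mul_diffMatrix (D := D) (K := ℚ)) v) r
    rw [Matrix.mul_apply] at h
    rw [Matrix.mul_apply]
    refine (sum_subtype_mul (IsInnerArc U) (D.divMatrix ℚ v)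
      (fun a => D.diffMatrix ℚ a r)).trans (Eq.trans ?_ h)
    refine Finset.sum_congr rfl fun a _ => ?_
    by_cases ha : IsInnerArc U a
    · rw [dif_pos ha]
    · rw [hQ0 v hv a ha, zero_mul, zero_mul]
  have hP := finrank_ker_le_one P (fun v hv => by
    let h : D.Region → ℚ := fun r => if h : U r then v ⟨r, h⟩ else 0
    have h₁ := hU h (fun a ha => by
      have h₂ := congrFun hv ⟨a, ha⟩
      have h₃ := sum_subtype_mul U (D.diffMatrix ℚ a) v
      have h₄ := diffMatrix_mulVec h a
      exact (sub_eq_zero.1 (h₄.symm.trans (h₃.symm.trans h₂))).symm)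
    rintro ⟨r, hr⟩ ⟨r', hr'⟩
    have := h₁ r r' hr hr'
    simpa [h, hr, hr'] using this)
  -- Extended by zero, a kernel vector has equal values at the two ends of every arc, inner or not,
  -- so `hV` applies. Hence `k = 0` here, in contrast to the whole sphere.
  have hQ : Module.finrank ℚ (LinearMap.ker Q.transpose.mulVecLin) ≤ 0 := by
    have : LinearMap.ker Q.transpose.mulVecLin = ⊥ := by
      rw [LinearMap.ker_eq_bot']
      intro v hv
      let h : D.Vtx → ℚ := fun x => if hx : IsInnerVtx U x then v ⟨x, hx⟩ else 0
      have h₁ := hV h (fun a => by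
        by_cases ha : IsInnerArc U a
        · have h₂ := congrFun hv ⟨a, ha⟩
          have h₃ := sum_subtype_mul (IsInnerVtx U) (fun x => D.divMatrix ℚ x a) v
          have h₄ := divMatrix_transpose_mulVec h a
          exact (sub_eq_zero.1 (h₄.symm.trans (h₃.symm.trans h₂)))
        · have h₁ : ¬ IsInnerVtx U (D.headVtx a) := fun h => ha (h a (.inl rfl))
          have h₂ : ¬ IsInnerVtx U (D.tailVtx a) := fun h => ha (h a (.inr rfl))
          simp [h, h₁, h₂]) (fun v hv => by simp [h, hv])
      funext ⟨x, hx⟩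
      have := h₁ x
      simpa [h, hx] using this
    rw [this, finrank_bot]
  exact (card_add_card_le P Q hQP hP hQ).1

/-- The region to the left of a crossing or vertex. -/
def vtxW : D.Vtx → D.Region := Sum.elim (fun x => D.corner x .W) D.splitW

/-- The region to the right of a crossing or vertex. -/
def vtxE : D.Vtx → D.Region := Sum.elim (fun x => D.corner x .E) D.splitE

/-- The difference of the number of clockwise and counterclockwise circles in terms of the
indices of the regions. -/
def rotation (f : D.Region → ℤ) : ℤ := ∑ r, f r - ∑ x, f (D.corner x .S)

open Classical in
-- As `U` is closed under passing from left to right, an arc or vertex is inner as soon as the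
-- leftmost region at it lies in `U`. Counting by leftmost regions, the terms of the vertices cancel
-- against arcs, and only the `S` corners of the nodes remain.
theorem rotation_le_of_up (U : D.Region → Prop) (hup : ∀ a : D.Arc, U (D.leftR (.inl a)) →
      U (D.rightR (.inl a)))
    (h : Fintype.card {r // U r} + Fintype.card {v // IsInnerVtx U v}
      ≤ Fintype.card {a // IsInnerArc U a} + 1) :
    rotation (fun r => if U r then 1 else 0) ≤ 1 := by
  have hA : ∀ a, IsInnerArc U a ↔ U (D.leftR (.inl a)) := fun a => ⟨fun h => h.1, fun h => ⟨h, hup a h⟩⟩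
  have hVt : ∀ v, IsInnerVtx U v ↔ U (vtxW v) := by
    have uL : ∀ x, U (D.corner x .W) → U (D.corner x .S) := fun x => by
      simpa [left_iL, right_iL] using hup (D.iL x)
    rintro (x | s)
    · constructor
      · intro h
        have := (h (D.iL x) (.inl (by simp))).1
        rwa [left_iL] at this
      · intro h a ha
        rw [hA]
        rcases ha with ha | ha
        · rcases D.arc_head_cases a with ⟨y, rfl⟩ | ⟨y, rfl⟩ | ⟨s, rfl⟩
          · rw [headVtx_iL] at ha
            obtain rfl := Sum.inl_injective ha
            rwa [left_iL]
          · rw [headVtx_iR] at ha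
            obtain rfl := Sum.inl_injective ha
            rw [left_iR]
            exact uL _ h
          · simp at ha
        · rcases D.arc_tail_cases a with ⟨y, rfl⟩ | ⟨y, rfl⟩ | ⟨m, rfl⟩ | ⟨s, rfl⟩ | ⟨s, rfl⟩
          · rw [tailVtx_oL] at ha
            obtain rfl := Sum.inl_injective ha
            rwa [left_oL]
          · rw [tailVtx_oR] at ha
            obtain rfl := Sum.inl_injective ha
            have := hup (D.oL y) (by rwa [left_oL])
            rw [right_oL] at this
            rwa [left_oR]
          · rw [tailVtx_oM] at ha
            obtain rfl := Sum.inl_injective ha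
            rwa [left_oM]
          · simp at ha
          · simp at ha
    · constructor
      · intro h
        exact (h (D.iS s) (.inl (by simp))).1
      · intro h a ha
        rw [hA]
        rcases ha with ha | ha
        · rcases D.arc_head_cases a with ⟨y, rfl⟩ | ⟨y, rfl⟩ | ⟨s', rfl⟩
          · simp at ha
          · simp at ha
          · rw [headVtx_iS] at ha
            obtain rfl := Sum.inr_injective ha
            exact h
        · rcases D.arc_tail_cases a with ⟨y, rfl⟩ | ⟨y, rfl⟩ | ⟨m, rfl⟩ | ⟨s', rfl⟩ | ⟨s', rfl⟩
          · simp at ha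
          · simp at ha
          · simp at ha
          · rw [tailVtx_oSL] at ha
            obtain rfl := Sum.inr_injective ha
            rwa [left_oSL]
          · rw [tailVtx_oSR] at ha
            obtain rfl := Sum.inr_injective ha
            have := hup (D.oSL s') (by rwa [left_oSL])
            rw [right_oSL] at this
            rwa [left_oSR]
  let n : D.Region → ℕ := fun r => if U r then 1 else 0
  have c₁ : Fintype.card {r // U r} = ∑ r, n r := by
    rw [Fintype.card_subtype, Finset.card_filter]
  have c₂ : Fintype.card {v // IsInnerVtx U v} = ∑ v, n (vtxW v) := by
    rw [Fintype.card_subtype, Finset.card_filter]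
    exact Finset.sum_congr rfl fun v _ => if_congr (hVt v) rfl rfl
  have c₃ : Fintype.card {a // IsInnerArc U a} = ∑ a, n (D.leftR (.inl a)) := by
    rw [Fintype.card_subtype, Finset.card_filter]
    exact Finset.sum_congr rfl fun a _ => if_congr (hA a) rfl rfl
  rw [c₁, c₂, c₃, D.sum_head, Fintype.sum_sum_type (f := fun v => n (vtxW v))] at h
  simp only [left_iL, left_iR, left_iS, Finset.sum_add_distrib, vtxW, Sum.elim_inl,
    Sum.elim_inr] at h
  have hr : rotation (fun r => if U r then 1 else 0)
      = ((∑ r, n r : ℕ) : ℤ) - ((∑ x, n (D.corner x .S) : ℕ) : ℤ) := by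
    simp [rotation, n]
  rw [hr]
  omega

open Classical in
theorem rotation_le_of_down (U : D.Region → Prop) (hdn : ∀ a : D.Arc, U (D.rightR (.inl a)) →
      U (D.leftR (.inl a)))
    (h : Fintype.card {r // U r} + Fintype.card {v // IsInnerVtx U v}
      ≤ Fintype.card {a // IsInnerArc U a} + 1) :
    rotation (fun r => if U r then 1 else 0) ≤ 1 := by
  have hA : ∀ a, IsInnerArc U a ↔ U (D.rightR (.inl a)) :=
    fun a => ⟨fun h => h.2, fun h => ⟨hdn a h, h⟩⟩
  have hVt : ∀ v, IsInnerVtx U v ↔ U (vtxE v) := by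
    have uR : ∀ x, U (D.corner x .E) → U (D.corner x .S) := fun x => by
      simpa [left_iR, right_iR] using hdn (D.iR x)
    rintro (x | s)
    · constructor
      · intro h
        have := (h (D.iR x) (.inl (by simp))).2
        rwa [right_iR] at this
      · intro h a ha
        rw [hA]
        rcases ha with ha | ha
        · rcases D.arc_head_cases a with ⟨y, rfl⟩ | ⟨y, rfl⟩ | ⟨s, rfl⟩
          · rw [headVtx_iL] at ha
            obtain rfl := Sum.inl_injective ha
            rw [right_iL]
            exact uR _ h
          · rw [headVtx_iR] at ha
            obtain rfl := Sum.inl_injective ha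
            rwa [right_iR]
          · simp at ha
        · rcases D.arc_tail_cases a with ⟨y, rfl⟩ | ⟨y, rfl⟩ | ⟨m, rfl⟩ | ⟨s, rfl⟩ | ⟨s, rfl⟩
          · rw [tailVtx_oL] at ha
            obtain rfl := Sum.inl_injective ha
            have := hdn (D.oR y) (by rwa [right_oR])
            rw [left_oR] at this
            rwa [right_oL]
          · rw [tailVtx_oR] at ha
            obtain rfl := Sum.inl_injective ha
            rwa [right_oR]
          · rw [tailVtx_oM] at ha
            obtain rfl := Sum.inl_injective ha
            rwa [right_oM]
          · simp at ha
          · simp at ha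
    · constructor
      · intro h
        exact (h (D.iS s) (.inl (by simp))).2
      · intro h a ha
        rw [hA]
        rcases ha with ha | ha
        · rcases D.arc_head_cases a with ⟨y, rfl⟩ | ⟨y, rfl⟩ | ⟨s', rfl⟩
          · simp at ha
          · simp at ha
          · rw [headVtx_iS] at ha
            obtain rfl := Sum.inr_injective ha
            exact h
        · rcases D.arc_tail_cases a with ⟨y, rfl⟩ | ⟨y, rfl⟩ | ⟨m, rfl⟩ | ⟨s', rfl⟩ | ⟨s', rfl⟩
          · simp at ha
          · simp at ha
          · simp at ha
          · rw [tailVtx_oSL] at ha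
            obtain rfl := Sum.inr_injective ha
            have := hdn (D.oSR s') (by rwa [right_oSR])
            rw [left_oSR] at this
            rwa [right_oSL]
          · rw [tailVtx_oSR] at ha
            obtain rfl := Sum.inr_injective ha
            rwa [right_oSR]
  let n : D.Region → ℕ := fun r => if U r then 1 else 0
  have c₁ : Fintype.card {r // U r} = ∑ r, n r := by
    rw [Fintype.card_subtype, Finset.card_filter]
  have c₂ : Fintype.card {v // IsInnerVtx U v} = ∑ v, n (vtxE v) := by
    rw [Fintype.card_subtype, Finset.card_filter]
    exact Finset.sum_congr rfl fun v _ => if_congr (hVt v) rfl rfl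
  have c₃ : Fintype.card {a // IsInnerArc U a} = ∑ a, n (D.rightR (.inl a)) := by
    rw [Fintype.card_subtype, Finset.card_filter]
    exact Finset.sum_congr rfl fun a _ => if_congr (hA a) rfl rfl
  rw [c₁, c₂, c₃, D.sum_head, Fintype.sum_sum_type (f := fun v => n (vtxE v))] at h
  simp only [right_iL, right_iR, right_iS, Finset.sum_add_distrib, vtxE, Sum.elim_inl,
    Sum.elim_inr] at h
  have hr : rotation (fun r => if U r then 1 else 0)
      = ((∑ r, n r : ℕ) : ℤ) - ((∑ x, n (D.corner x .S) : ℕ) : ℤ) := by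
    simp [rotation, n]
  rw [hr]
  omega

end Diagram

end MOY

/-! ### Resolved circles stay at one level of the index -/

namespace MOY

namespace Diagram

variable {D : Diagram}

/-- The places of `headPos` and `tailPos`. -/
def place : D.Vtx → D.X ⊕ D.Vertex
  | .inl (.inl x) => .inl x
  | .inl (.inr m) => .inr (.inl m)
  | .inr s => .inr (.inr s)

theorem place_injective : Function.Injective (place (D := D)) := by
  rintro ((x | m) | s) ((x' | m') | s') h <;> simp [place] at h <;> rw [h]

section

variable (hD : D.Good) (c : D.PosColoring)

include hD

/-- The position of a strand among those arriving at a vertex is its level minus the index of the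
leftmost region there. So `Joined` depends only on the vertex and the level. -/
theorem headPos_eq (a : D.Arc) (k : ℕ) : ∃ j : ℕ, headPos c a k = (place (D.headVtx a), j) ∧
    index c (D.leftR (.inl a)) + k = index c (vtxW (D.headVtx a)) + j := by
  rcases D.arc_head_cases a with ⟨x | m, rfl⟩ | ⟨x | m, rfl⟩ | ⟨s, rfl⟩
  · have h : D.head (D.iL (.inl x)) = .crossL x := D.head.apply_symm_apply _
    exact ⟨k, by rw [headPos, h, headVtx_iL]; rfl, by rw [headVtx_iL, left_iL]; rfl⟩
  · have h : D.head (D.iL (.inr m)) = .mergeL m := D.head.apply_symm_apply _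
    exact ⟨k, by rw [headPos, h, headVtx_iL]; rfl, by rw [headVtx_iL, left_iL]; rfl⟩
  · have h : D.head (D.iR (.inl x)) = .crossR x := D.head.apply_symm_apply _
    refine ⟨_, by rw [headPos, h, headVtx_iR]; rfl, ?_⟩
    have h₁ := hD.index_right c (.inl (D.iL (.inl x)))
    have h₂ := c.pos (.inl (D.iL (.inl x)))
    rw [right_iL, left_iL] at h₁
    rw [headVtx_iR, left_iR, h₁]
    simp only [vtxW, Sum.elim_inl]
    change _ = _ + (((c.color (.inl (D.iL (.inl x)))).toNat + k : ℕ) : ℤ)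
    push_cast
    rw [Int.toNat_of_nonneg h₂.le]
    ring
  · have h : D.head (D.iR (.inr m)) = .mergeR m := D.head.apply_symm_apply _
    refine ⟨_, by rw [headPos, h, headVtx_iR]; rfl, ?_⟩
    have h₁ := hD.index_right c (.inl (D.iL (.inr m)))
    have h₂ := c.pos (.inl (D.iL (.inr m)))
    rw [right_iL, left_iL] at h₁
    rw [headVtx_iR, left_iR, h₁]
    simp only [vtxW, Sum.elim_inl]
    change _ = _ + (((c.color (.inl (D.iL (.inr m)))).toNat + k : ℕ) : ℤ)
    push_cast
    rw [Int.toNat_of_nonneg h₂.le]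
    ring
  · have h : D.head (D.iS s) = .split s := D.head.apply_symm_apply _
    exact ⟨k, by rw [headPos, h, headVtx_iS]; rfl, by rw [headVtx_iS, left_iS]; rfl⟩

theorem tailPos_eq (a : D.Arc) (k : ℕ) : ∃ j : ℕ, tailPos c a k = (place (D.tailVtx a), j) ∧
    index c (D.leftR (.inl a)) + k = index c (vtxW (D.tailVtx a)) + j := by
  rcases D.arc_tail_cases a with ⟨x, rfl⟩ | ⟨x, rfl⟩ | ⟨m, rfl⟩ | ⟨s, rfl⟩ | ⟨s, rfl⟩
  · have h : D.tail (D.oL x) = .crossL x := D.tail.apply_symm_apply _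
    exact ⟨k, by rw [tailPos, h, tailVtx_oL]; rfl, by rw [tailVtx_oL, left_oL]; rfl⟩
  · have h : D.tail (D.oR x) = .crossR x := D.tail.apply_symm_apply _
    refine ⟨_, by rw [tailPos, h, tailVtx_oR]; rfl, ?_⟩
    have h₁ := hD.index_right c (.inl (D.oL x))
    have h₂ := c.pos (.inl (D.oL x))
    rw [right_oL, left_oL] at h₁
    rw [tailVtx_oR, left_oR, h₁]
    simp only [vtxW, Sum.elim_inl]
    change _ = _ + (((c.color (.inl (D.oL x))).toNat + k : ℕ) : ℤ)
    push_cast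
    rw [Int.toNat_of_nonneg h₂.le]
    ring
  · have h : D.tail (D.oM m) = .merge m := D.tail.apply_symm_apply _
    exact ⟨k, by rw [tailPos, h, tailVtx_oM]; rfl, by rw [tailVtx_oM, left_oM]; rfl⟩
  · have h : D.tail (D.oSL s) = .splitL s := D.tail.apply_symm_apply _
    exact ⟨k, by rw [tailPos, h, tailVtx_oSL]; rfl, by rw [tailVtx_oSL, left_oSL]; rfl⟩
  · have h : D.tail (D.oSR s) = .splitR s := D.tail.apply_symm_apply _
    refine ⟨_, by rw [tailPos, h, tailVtx_oSR]; rfl, ?_⟩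
    have h₁ := hD.index_right c (.inl (D.oSL s))
    have h₂ := c.pos (.inl (D.oSL s))
    rw [right_oSL, left_oSL] at h₁
    rw [tailVtx_oSR, left_oSR, h₁]
    simp only [vtxW, Sum.elim_inr]
    change _ = _ + (((c.color (.inl (D.oSL s))).toNat + k : ℕ) : ℤ)
    push_cast
    rw [Int.toNat_of_nonneg h₂.le]
    ring

theorem headPos_eq_tailPos_iff (a b : D.Arc) (k l : ℕ) :
    headPos c a k = tailPos c b l ↔ D.headVtx a = D.tailVtx b ∧
      index c (D.leftR (.inl a)) + k = index c (D.leftR (.inl b)) + l := by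
  obtain ⟨i, h₁, h₂⟩ := headPos_eq hD c a k
  obtain ⟨j, h₃, h₄⟩ := tailPos_eq hD c b l
  rw [h₁, h₃, h₂, h₄, Prod.mk.injEq, place_injective.eq_iff]
  constructor
  · rintro ⟨h, rfl⟩
    rw [h]
    exact ⟨rfl, rfl⟩
  · rintro ⟨h, h'⟩
    rw [h] at h'
    exact ⟨h, by omega⟩

end

/-- The level of a strand. -/
noncomputable def level (c : D.PosColoring) (s : Strand c) : ℤ :=
  index c (D.leftR s.1) + (s.2 : ℕ)

section

variable (hD : D.Good) {c : D.PosColoring}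

include hD

theorem level_lt (s : Strand c) : level c s < index c (D.rightR s.1) := by
  obtain ⟨e, k⟩ := s
  have h₁ := hD.index_right c e
  have h₂ := k.2
  simp only [level]
  omega

omit hD in
theorem le_level (s : Strand c) : index c (D.leftR s.1) ≤ level c s := by
  simp only [level]
  omega

/-- Joining strands preserves the level. Since a piece has one strand at each of its levels, a
circle runs along a piece at most once. -/
theorem Good.level_eq_of_mk_eq {s t : Strand c} (h : Quot.mk (Joined c) s = Quot.mk (Joined c) t) :
    level c s = level c t :=
  congrArg (Quot.lift (level c) (by
    rintro _ _ ⟨a, b, k, l, h⟩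
    exact ((headPos_eq_tailPos_iff hD c a b k l).1 h).2)) h

theorem Good.strand_unique {e : D.Piece} {k l : Fin (c.color e).toNat}
    (h : Quot.mk (Joined c) ⟨e, k⟩ = Quot.mk (Joined c) ⟨e, l⟩) : k = l := by
  have := hD.level_eq_of_mk_eq h
  simp only [level] at this
  exact Fin.ext (by omega)

end

/-- The circle `γ` runs along the piece `e`. -/
def Passes {c : D.PosColoring} (γ : ResolvedCircle c) (e : D.Piece) : Prop :=
  ∃ k, Quot.mk (Joined c) ⟨e, k⟩ = γ

section

variable (hD : D.Good) {c : D.PosColoring} {γ : ResolvedCircle c}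

open Classical in
include hD in
theorem Good.mult_eq (γ : ResolvedCircle c) (e : D.Piece) :
    mult c γ e = if Passes γ e then 1 else 0 := by
  rw [mult]
  split_ifs with h
  · rw [Nat.card_eq_one_iff_unique]
    obtain ⟨k, hk⟩ := h
    exact ⟨⟨fun a b => Subtype.ext (hD.strand_unique (a.2.trans b.2.symm))⟩, ⟨k, hk⟩⟩
  · rw [Nat.card_eq_zero]
    exact .inl ⟨fun k => h ⟨k.1, k.2⟩⟩

include hD in
theorem Good.exists_level (γ : ResolvedCircle c) : ∃ n, ∀ e, Passes γ e →
    index c (D.leftR e) ≤ n ∧ n < index c (D.rightR e) := by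
  obtain ⟨s, rfl⟩ := Quot.exists_rep γ
  refine ⟨level c s, fun e ⟨k, hk⟩ => ?_⟩
  rw [← hD.level_eq_of_mk_eq hk]
  exact ⟨le_level _, level_lt hD _⟩

include hD in
/-- A circle that arrives at a vertex goes on along the outgoing arc at its level. -/
theorem Good.exists_next {a : D.Arc} (ha : Passes γ (.inl a)) :
    ∃ b, D.tailVtx b = D.headVtx a ∧ Passes γ (.inl b) := by
  obtain ⟨k, rfl⟩ := ha
  set n := level c ⟨.inl a, k⟩ with hn
  -- The index intervals of the outgoing arcs fill the interval from the leftmost to the rightmost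
  -- region at the vertex, so one of them contains `n`.
  have key : ∃ b, D.tailVtx b = D.headVtx a ∧ index c (D.leftR (.inl b)) ≤ n ∧
      n < index c (D.rightR (.inl b)) := by
    have h₁ : index c (D.leftR (.inl a)) ≤ n := le_level _
    have h₂ : n < index c (D.rightR (.inl a)) := level_lt hD _
    have h₃ : index c (vtxW (D.headVtx a)) ≤ n ∧ n < index c (vtxE (D.headVtx a)) := by
      rcases D.arc_head_cases a with ⟨x, rfl⟩ | ⟨x, rfl⟩ | ⟨s, rfl⟩
      · have := hD.index_lt c (.inl (D.iR x))
        rw [left_iR, right_iR] at this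
        rw [left_iL] at h₁
        rw [right_iL] at h₂
        rw [headVtx_iL]
        exact ⟨h₁, h₂.trans this⟩
      · have := hD.index_lt c (.inl (D.iL x))
        rw [left_iL, right_iL] at this
        rw [left_iR] at h₁
        rw [right_iR] at h₂
        rw [headVtx_iR]
        exact ⟨this.le.trans h₁, h₂⟩
      · rw [headVtx_iS]
        exact ⟨h₁, h₂⟩
    revert h₃
    generalize D.headVtx a = v
    intro h₃
    rcases v with (x | m) | s
    · by_cases h : n < index c (D.corner (.inl x) .N)
      · exact ⟨D.oL x, by simp, by rw [left_oL]; exact h₃.1, by rwa [right_oL]⟩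
      · exact ⟨D.oR x, by simp, by rw [left_oR]; omega, by rw [right_oR]; exact h₃.2⟩
    · exact ⟨D.oM m, by simp, by rw [left_oM]; exact h₃.1, by rw [right_oM]; exact h₃.2⟩
    · by_cases h : n < index c (D.splitN s)
      · exact ⟨D.oSL s, by simp, by rw [left_oSL]; exact h₃.1, by rwa [right_oSL]⟩
      · exact ⟨D.oSR s, by simp, by rw [left_oSR]; omega, by rw [right_oSR]; exact h₃.2⟩
  obtain ⟨b, hb, h₁, h₂⟩ := key
  have h₃ := hD.index_right c (.inl b)
  refine ⟨b, hb, ⟨(n - index c (D.leftR (.inl b))).toNat, by omega⟩, ?_⟩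
  refine (Quot.sound ⟨a, b, k, _, ?_⟩).symm
  rw [headPos_eq_tailPos_iff hD]
  refine ⟨hb.symm, ?_⟩
  rw [Int.toNat_of_nonneg (by omega)]
  simp only [hn, level]
  ring

include hD in
theorem Good.not_passes_iL_and_iR {x : D.Node} (h : Passes γ (.inl (D.iL x)))
    (h' : Passes γ (.inl (D.iR x))) : False := by
  obtain ⟨n, hn⟩ := hD.exists_level γ
  have h₁ := (hn _ h).2
  have h₂ := (hn _ h').1
  rw [right_iL] at h₁
  rw [left_iR] at h₂
  omega

include hD in
theorem Good.not_passes_oL_and_oR {x : D.X} (h : Passes γ (.inl (D.oL x)))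
    (h' : Passes γ (.inl (D.oR x))) : False := by
  obtain ⟨n, hn⟩ := hD.exists_level γ
  have h₁ := (hn _ h).2
  have h₂ := (hn _ h').1
  rw [right_oL] at h₁
  rw [left_oR] at h₂
  omega

include hD in
theorem Good.not_passes_oSL_and_oSR {s : D.S} (h : Passes γ (.inl (D.oSL s)))
    (h' : Passes γ (.inl (D.oSR s))) : False := by
  obtain ⟨n, hn⟩ := hD.exists_level γ
  have h₁ := (hn _ h).2
  have h₂ := (hn _ h').1
  rw [right_oSL] at h₁
  rw [left_oSR] at h₂
  omega

include hD in
theorem Good.passes_head_unique {a b : D.Arc} (ha : Passes γ (.inl a)) (hb : Passes γ (.inl b))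
    (h : D.headVtx a = D.headVtx b) : a = b := by
  rcases D.arc_head_cases a with ⟨x, rfl⟩ | ⟨x, rfl⟩ | ⟨s, rfl⟩ <;>
    rcases D.arc_head_cases b with ⟨y, rfl⟩ | ⟨y, rfl⟩ | ⟨t, rfl⟩ <;>
    simp only [headVtx_iL, headVtx_iR, headVtx_iS, Sum.inl.injEq, Sum.inr.injEq, reduceCtorEq] at h
  · rw [h]
  · subst h
    exact (hD.not_passes_iL_and_iR ha hb).elim
  · subst h
    exact (hD.not_passes_iL_and_iR hb ha).elim
  · rw [h]
  · rw [h]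

include hD in
theorem Good.mult_balanced (γ : ResolvedCircle c) :
    Balanced fun a => (mult c γ (.inl a) : ℤ) := by
  classical
  intro h
  simp only [hD.mult_eq, Nat.cast_ite, Nat.cast_one, Nat.cast_zero, mul_ite, mul_one, mul_zero]
  rw [← Finset.sum_filter, Finset.sum_sub_distrib, sub_eq_zero]
  choose nx h₁ h₂ using fun (a : D.Arc) (ha : Passes γ (.inl a)) => hD.exists_next ha
  let T := {a : D.Arc // Passes γ (.inl a)}
  -- The successor map on the arcs of `γ` is injective, because only one arc of `γ` arrives at a
  -- given vertex. So it is a permutation, and it matches heads with tails.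
  let φ : T → T := fun a => ⟨nx a.1 a.2, h₂ _ _⟩
  have hφ : Function.Injective φ := by
    rintro ⟨a, ha⟩ ⟨b, hb⟩ hab
    have := congrArg Subtype.val hab
    simp only [φ] at this
    refine Subtype.ext (hD.passes_head_unique ha hb ?_)
    rw [← h₁ a ha, ← h₁ b hb, this]
  have hb := Finite.injective_iff_bijective.1 hφ
  rw [Finset.sum_subtype (p := fun a => Passes γ (.inl a)) _ (by simp),
    Finset.sum_subtype (p := fun a => Passes γ (.inl a)) _ (by simp)]
  refine Eq.trans ?_ (Function.Bijective.sum_comp hb fun a : T => h (D.tailVtx a.1))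
  exact Finset.sum_congr rfl fun a _ => congrArg h (h₁ a.1 a.2).symm

end

end Diagram

end MOY

/-! ### Curliness as the rotation of the index -/

namespace MOY

namespace Diagram

variable {D : Diagram}

section

variable (hD : D.Good) {c : D.PosColoring} {γ : ResolvedCircle c}

include hD in
/-- A function on the regions that changes only across `γ` has, to the left and to the right of
`γ`, the same values as in the corners of the vertices on `γ`. -/
theorem Good.eq_at_vtx {α : Type*} (h : D.Region → α)
    (hh : ∀ b : D.Arc, ¬ Passes γ (.inl b) → h (D.leftR (.inl b)) = h (D.rightR (.inl b)))
    {a : D.Arc} (ha : Passes γ (.inl a)) :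
    (h (D.leftR (.inl a)) = h (vtxW (D.headVtx a)) ∧ h (D.rightR (.inl a)) = h (vtxE (D.headVtx a)))
    ∧ (h (D.leftR (.inl a)) = h (vtxW (D.tailVtx a)) ∧
      h (D.rightR (.inl a)) = h (vtxE (D.tailVtx a))) := by
  constructor
  · rcases D.arc_head_cases a with ⟨x, rfl⟩ | ⟨x, rfl⟩ | ⟨s, rfl⟩
    · have := hh _ fun h' => hD.not_passes_iL_and_iR ha h'
      rw [left_iR, right_iR] at this
      rw [left_iL, right_iL, headVtx_iL]
      exact ⟨rfl, this⟩
    · have := hh _ fun h' => hD.not_passes_iL_and_iR h' ha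
      rw [left_iL, right_iL] at this
      rw [left_iR, right_iR, headVtx_iR]
      exact ⟨this.symm, rfl⟩
    · rw [headVtx_iS]
      exact ⟨rfl, rfl⟩
  · rcases D.arc_tail_cases a with ⟨x, rfl⟩ | ⟨x, rfl⟩ | ⟨m, rfl⟩ | ⟨s, rfl⟩ | ⟨s, rfl⟩
    · have := hh _ fun h' => hD.not_passes_oL_and_oR ha h'
      rw [left_oR, right_oR] at this
      rw [left_oL, right_oL, tailVtx_oL]
      exact ⟨rfl, this⟩
    · have := hh _ fun h' => hD.not_passes_oL_and_oR h' ha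
      rw [left_oL, right_oL] at this
      rw [left_oR, right_oR, tailVtx_oR]
      exact ⟨this.symm, rfl⟩
    · rw [left_oM, right_oM, tailVtx_oM]
      exact ⟨rfl, rfl⟩
    · have := hh _ fun h' => hD.not_passes_oSL_and_oSR ha h'
      rw [left_oSR, right_oSR] at this
      rw [left_oSL, right_oSL, tailVtx_oSL]
      exact ⟨rfl, this⟩
    · have := hh _ fun h' => hD.not_passes_oSL_and_oSR h' ha
      rw [left_oSL, right_oSL] at this
      rw [left_oSR, right_oSR, tailVtx_oSR]
      exact ⟨this.symm, rfl⟩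

include hD in
theorem Good.eq_along {α : Type*} (h : D.Region → α)
    (hh : ∀ b : D.Arc, ¬ Passes γ (.inl b) → h (D.leftR (.inl b)) = h (D.rightR (.inl b)))
    {e e' : D.Piece} (he : Passes γ e) (he' : Passes γ e') :
    h (D.leftR e) = h (D.leftR e') ∧ h (D.rightR e) = h (D.rightR e') := by
  classical
  obtain ⟨k, hk⟩ := he
  obtain ⟨l, hl⟩ := he'
  -- The pair of values on the two sides agrees for joined strands of `γ`; strands of other circles
  -- get `none`, so that the function is defined on the whole quotient.
  have key := congrArg (Quot.lift (fun s : Strand c => if Quot.mk (Joined c) s = γ then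
      some (h (D.leftR s.1), h (D.rightR s.1)) else none) (by
    intro s t hst
    have hq := Quot.sound hst
    simp only [hq]
    split_ifs with ht
    · obtain ⟨a, b, k, l, hkl⟩ := hst
      have hv := ((headPos_eq_tailPos_iff hD c a b k l).1 hkl).1
      have h₁ := (hD.eq_at_vtx h hh ⟨k, hq.trans ht⟩).1
      have h₂ := (hD.eq_at_vtx h hh ⟨l, ht⟩).2
      rw [hv] at h₁
      simp only [h₁, h₂]
    · rfl)) (hk.trans hl.symm)
  exact Prod.mk.inj (Option.some.inj ((if_pos hk).symm.trans (key.trans (if_pos hl))))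

include hD in
/-- Each of the two sides of a resolved circle is a connected part of the sphere. -/
theorem Good.euler_side_le_one (U : D.Region → Prop)
    (h₀ : ∀ b, ¬ Passes γ b → (U (D.leftR b) ↔ U (D.rightR b)))
    (h₁ : (∀ e, Passes γ e → U (D.rightR e) ∧ ¬ U (D.leftR e)) ∨
      ∀ e, Passes γ e → U (D.leftR e) ∧ ¬ U (D.rightR e)) [DecidablePred U]
    [DecidablePred (IsInnerVtx U)] [DecidablePred (IsInnerArc U)] :
    Fintype.card {r // U r} + Fintype.card {v // IsInnerVtx U v}
      ≤ Fintype.card {a // IsInnerArc U a} + 1 := by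
  obtain ⟨⟨e₀, k₀⟩, hk₀⟩ := Quot.exists_rep γ
  have he₀ : Passes γ e₀ := ⟨k₀, hk₀⟩
  have hloop : ∀ l : D.Loop, Passes γ (.inr l) := fun l => by
    rcases hD.loop_cases with hL | ⟨_, hP⟩
    · exact hL.elim l
    · exact Subsingleton.elim e₀ (.inr l) ▸ he₀
  convert euler_le_one U ?_ ?_
  · intro h hh
    -- Outside `U`, continue `h` by the constant `k`, its value next to `γ` inside `U`. The result
    -- does not change across `γ` either, so it is constant.
    have main : ∀ k : ℚ, (∀ e, Passes γ e → U (D.rightR e) ∧ ¬ U (D.leftR e) ∧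
        h (D.rightR e₀) = k ∨ U (D.leftR e) ∧ ¬ U (D.rightR e) ∧ h (D.leftR e₀) = k) →
        ∀ r r', U r → U r' → h r = h r' := by
      intro k hk r r' hr hr'
      let g : D.Region → ℚ := fun r => if U r then h r else k
      have hg : ∀ b : D.Arc, ¬ Passes γ (.inl b) →
          g (D.leftR (.inl b)) = g (D.rightR (.inl b)) := fun b hb => by
        simp only [g]
        by_cases hU : U (D.leftR (.inl b))
        · have hU' := (h₀ _ hb).1 hU
          rw [if_pos hU, if_pos hU', hh b ⟨hU, hU'⟩]
        · rw [if_neg hU, if_neg (fun hU' => hU ((h₀ _ hb).2 hU'))]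
      have hc := region_const g (fun e => by
        by_cases he : Passes γ e
        · obtain ⟨h₂, h₃⟩ := hD.eq_along g hg he he₀
          rw [h₂, h₃]
          rcases hk e₀ he₀ with ⟨h₄, h₅, h₆⟩ | ⟨h₄, h₅, h₆⟩
          · simp only [g, if_pos h₄, if_neg h₅, h₆]
          · simp only [g, if_pos h₄, if_neg h₅, h₆]
        · rcases e with a | l
          · exact hg a he
          · exact (he (hloop l)).elim) r r'
      simpa only [g, if_pos hr, if_pos hr'] using hc
    rcases h₁ with h₁ | h₁
    · exact main _ fun e he => .inl ⟨(h₁ e he).1, (h₁ e he).2, rfl⟩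
    · exact main _ fun e he => .inr ⟨(h₁ e he).1, (h₁ e he).2, rfl⟩
  · intro h hh hz v
    rcases hD.loop_cases with hL | ⟨hA, _⟩
    · rcases e₀ with a₀ | l
      -- An arc on `γ` is not inner, so `h` vanishes at its end; and `h` is constant on the
      -- connected diagram.
      · have hni : ¬ IsInnerArc U a₀ := fun hi => by
          rcases h₁ with h₁ | h₁
          · exact (h₁ _ he₀).2 hi.1
          · exact (h₁ _ he₀).2 hi.2
        have ha₀ : h (D.headVtx a₀) = 0 := hz _ fun hv => hni (hv a₀ (.inl rfl))
        have hc : ∀ a, h (D.headVtx a) = 0 := fun a => by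
          rw [← ha₀]
          exact hD.piece_const (fun e => e.elim (fun a => h (D.headVtx a)) fun l => hL.elim l) h
            (fun _ => rfl) (fun a => hh a) (.inl a) (.inl a₀)
        rcases v with x | s
        · simpa using hc (D.iL x)
        · simpa using hc (D.iS s)
      · exact hL.elim l
    · exact (isEmpty_vtx_of_arc hA).elim v

end

theorem rotation_add (f g : D.Region → ℤ) :
    rotation (fun r => f r + g r) = rotation f + rotation g := by
  simp only [rotation, Finset.sum_add_distrib]
  ring

/-- The factor `2` is the Euler characteristic of the sphere in the form `#Region - #Node`. -/
theorem Good.rotation_const (hD : D.Good) (k : ℤ) : rotation (fun _ : D.Region => k) = 2 * k := by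
  unfold Good at hD
  simp only [rotation, Finset.sum_const, Finset.card_univ, hD, nsmul_eq_mul]
  push_cast
  ring

section

variable (hD : D.Good) {c : D.PosColoring}

include hD

theorem Good.exists_isWinding (γ : ResolvedCircle c) : ∃ w, IsWinding c γ w :=
  hD.exists_winding (fun e => (mult c γ e : ℤ)) (hD.mult_balanced γ)

/-- The indicator functions of the two sides of `γ` have rotation at most `1` each and `2` together,
hence exactly `1` each. As `w` is the indicator function of the right side plus `k`, its rotation is
`1 + 2 * k`. -/
theorem Good.winding_values {γ : ResolvedCircle c} {w : D.Region → ℤ} (hw : IsWinding c γ w) :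
    ∃ k : ℤ, (∀ r, w r = k ∨ w r = k + 1) ∧ (∃ r, w r = k) ∧ (∃ r, w r = k + 1) ∧
      rotation w = 2 * k + 1 := by
  classical
  obtain ⟨⟨e₀, k₀⟩, hk₀⟩ := Quot.exists_rep γ
  have he₀ : Passes γ e₀ := ⟨k₀, hk₀⟩
  have hn : ∀ e, ¬ Passes γ e → w (D.leftR e) = w (D.rightR e) := fun e he => by
    rw [hw.2, hD.mult_eq, if_neg he, Nat.cast_zero, add_zero]
  have hp : ∀ e, Passes γ e → w (D.rightR e) = w (D.leftR e) + 1 := fun e he => by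
    rw [hw.2, hD.mult_eq, if_pos he, Nat.cast_one]
  set k := w (D.leftR e₀) with hk
  have hl : ∀ e, Passes γ e → w (D.leftR e) = k := fun e he =>
    (hD.eq_along w (fun b hb => hn _ hb) he he₀).1
  have hv : ∀ r, w r = k ∨ w r = k + 1 := fun r => by
    refine (region_const (fun r => w r = k ∨ w r = k + 1) (fun e => propext ?_) (D.leftR e₀) r).mp
      (.inl rfl)
    by_cases he : Passes γ e
    · have := hl e he
      have := hp e he
      constructor <;> intro <;> omega
    · rw [hn e he]
  refine ⟨k, hv, ⟨_, rfl⟩, ⟨_, hp e₀ he₀⟩, ?_⟩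
  have h₁ : rotation (fun r => if w r = k + 1 then (1 : ℤ) else 0) ≤ 1 := by
    convert rotation_le_of_up (fun r => w r = k + 1) ?_ ?_
    · intro a ha
      by_cases he : Passes γ (.inl a)
      · rw [hp _ he, hl _ he]
      · rwa [← hn _ he]
    · convert hD.euler_side_le_one (γ := γ) (fun r => w r = k + 1) (fun b hb => by simp only [hn b hb]) (.inl fun e he => by
        have := hl e he
        have := hp e he
        constructor <;> omega)
  have h₂ : rotation (fun r => if w r = k then (1 : ℤ) else 0) ≤ 1 := by
    convert rotation_le_of_down (fun r => w r = k) ?_ ?_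
    · intro a ha
      by_cases he : Passes γ (.inl a)
      · exact hl _ he
      · rwa [hn _ he]
    · convert hD.euler_side_le_one (γ := γ) (fun r => w r = k) (fun b hb => by simp only [hn b hb]) (.inr fun e he => by
        have := hl e he
        have := hp e he
        constructor <;> omega)
  have h₃ := rotation_add (fun r => if w r = k + 1 then (1 : ℤ) else 0)
    (fun r => if w r = k then (1 : ℤ) else 0)
  have h₄ := rotation_add (fun r => if w r = k + 1 then (1 : ℤ) else 0) (fun _ => k)
  rw [show (fun r => (if w r = k + 1 then (1 : ℤ) else 0) + (if w r = k then (1 : ℤ) else 0))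
      = fun _ => 1 from funext fun r => by rcases hv r with h | h <;> simp [h],
    hD.rotation_const] at h₃
  rw [show (fun r => (if w r = k + 1 then (1 : ℤ) else 0) + k) = w from
      funext fun r => by rcases hv r with h | h <;> simp [h, add_comm],
    hD.rotation_const] at h₄
  omega

open Classical in
/-- The rotation of a winding function tells the orientation of the circle. -/
theorem Good.rotation_winding {γ : ResolvedCircle c} {w : D.Region → ℤ} (hw : IsWinding c γ w) :
    rotation w = (if IsClockwise c γ then 1 else 0) - if IsCounterclockwise c γ then 1 else 0 := by
  obtain ⟨k, hv, ⟨r₀, h₀⟩, ⟨r₁, h₁⟩, hr⟩ := hD.winding_values hw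
  have hu : ∀ w', IsWinding c γ w' → w' = w := fun w' hw' =>
    winding_unique hw'.1 hw.1 hw'.2 hw.2
  -- The unbounded region has value `0`, so `k` is `0` (the clockwise case) or `-1` (the
  -- counterclockwise case).
  have ho := hv D.outer
  rw [hw.1] at ho
  have hc : IsClockwise c γ ↔ k = 0 := by
    constructor
    · rintro ⟨w', hw', h⟩
      rw [hu w' hw'] at h
      have := h r₀
      omega
    · intro hk
      exact ⟨w, hw, fun r => by have := hv r; omega⟩
  have hcc : IsCounterclockwise c γ ↔ k = -1 := by
    constructor
    · rintro ⟨w', hw', h⟩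
      rw [hu w' hw'] at h
      have := h r₁
      omega
    · intro hk
      exact ⟨w, hw, fun r => by have := hv r; omega⟩
  rw [hr]
  simp only [hc, hcc]
  rcases ho with ho | ho
  · rw [← ho]; simp
  · obtain rfl : k = -1 := by omega
    simp

omit hD in
theorem sum_mult [Fintype (ResolvedCircle c)] (e : D.Piece) :
    ∑ γ, (mult c γ e : ℤ) = c.color e := by
  have h : ∑ γ, mult c γ e = (c.color e).toNat := by
    simp only [mult]
    refine Nat.card_sigma.symm.trans ((Nat.card_congr (Equiv.sigmaFiberEquiv
      fun k : Fin (c.color e).toNat => (Quot.mk (Joined c) ⟨e, k⟩ : ResolvedCircle c))).trans ?_)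
    exact Nat.card_fin _
  rw [← Int.toNat_of_nonneg (c.pos e).le, ← h, Nat.cast_sum]

/-- The index is the sum of the winding functions of all resolved circles, because `c.color e`
strands run along `e`; and `rotation` is additive. -/
theorem Good.curliness_eq : curliness c = tq (2 * rotation (index c)) := by
  classical
  have : Finite (ResolvedCircle c) := Quot.finite _
  have := Fintype.ofFinite (ResolvedCircle c)
  choose w hw using hD.exists_isWinding (c := c)
  have hs : index c = fun r => ∑ γ, w γ r := by
    refine winding_unique (hD.isIndex c).1 (by simp [fun γ => (hw γ).1]) (hD.isIndex c).2
      fun e => ?_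
    simp only [(hw _).2, Finset.sum_add_distrib, sum_mult]
  have hr : rotation (index c) = ∑ γ, rotation (w γ) := by
    simp only [hs, rotation, Finset.sum_sub_distrib]
    rw [Finset.sum_comm, Finset.sum_comm (s := (Finset.univ : Finset D.Node))]
  rw [curliness, hr]
  simp only [hD.rotation_winding (hw _), Finset.sum_sub_distrib, Nat.card_eq_fintype_card,
    Fintype.card_subtype, Finset.sum_boole]

end

/-- Passing to the reversed diagram changes the sign of the rotation. -/
theorem rotation_reverse (f : D.Region → ℤ) :
    rotation (D := D.reverse) (fun r => - f r) = - rotation f := by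
  -- Counting the left regions of all arcs by heads and by tails shows that the `S` corners of `D`
  -- and those of the reversed diagram have the same sum.
  have h := D.sum_head fun a => f (D.leftR (.inl a))
  rw [D.sum_tail] at h
  simp only [left_iL, left_iR, left_iS, left_oL, left_oR, left_oM, left_oSL, left_oSR,
    Fintype.sum_sum_type, Finset.sum_add_distrib] at h
  have h₁ : ∑ x : D.reverse.Node, f (D.reverse.corner x .S)
      = ∑ x, f (D.corner (.inl x) .N) + ∑ s, f (D.splitN s) := by
    rw [Fintype.sum_sum_type]
    congr 1
    · refine Finset.sum_congr rfl fun x _ => congrArg f ?_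
      exact D.left_oR x
    · refine Finset.sum_congr rfl fun s _ => congrArg f ?_
      exact D.left_oSR s
  have h₂ : ∑ r : D.reverse.Region, (- f r) = - ∑ r : D.Region, f r := by
    rw [← Finset.sum_neg_distrib]
    rfl
  simp only [rotation, Fintype.sum_sum_type, Finset.sum_neg_distrib] at *
  rw [h₂]
  omega

end Diagram

end MOY

/-! ### The substitution of `t⁻¹`, and the normalized weights -/

namespace MOY

/-- Up to a power of `X`, the value at `X⁻¹` is the reversed polynomial. So no denominator vanishes
under `t ↦ t⁻¹`, and `invT` is a ring homomorphism. -/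
theorem eval₂_inv_ne_zero {K : Type*} [Field K] {p : Polynomial K} (hp : p ≠ 0) :
    p.eval₂ (RatFunc.C : K →+* RatFunc K) RatFunc.X⁻¹ ≠ 0 := by
  intro h
  have hX : (RatFunc.X : RatFunc K) ≠ 0 := RatFunc.X_ne_zero
  let _ : Invertible (RatFunc.X⁻¹ : RatFunc K) :=
    ⟨RatFunc.X, mul_inv_cancel₀ hX, inv_mul_cancel₀ hX⟩
  rw [← Polynomial.eval₂_reverse_eq_zero_iff] at h
  change p.reverse.eval₂ (RatFunc.C : K →+* RatFunc K) RatFunc.X = 0 at h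
  have h' := RatFunc.aeval_X_left_eq_algebraMap p.reverse
  rw [Polynomial.aeval_def, RatFunc.algebraMap_eq_C, h] at h'
  exact hp (Polynomial.reverse_eq_zero.1 (RatFunc.algebraMap_injective K (by rw [← h', map_zero])))

/-- The substitution of `t⁻¹` for `t` as a homomorphism. -/
noncomputable def invTHom : RatFunc ℚ →+* RatFunc ℚ where
  toFun := invT
  map_one' := RatFunc.eval_one _ _
  map_zero' := RatFunc.eval_zero _ _
  map_mul' x y := RatFunc.eval_mul _ _ (eval₂_inv_ne_zero x.denom_ne_zero)
    (eval₂_inv_ne_zero y.denom_ne_zero)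
  map_add' x y := RatFunc.eval_add _ _ (eval₂_inv_ne_zero x.denom_ne_zero)
    (eval₂_inv_ne_zero y.denom_ne_zero)

theorem invT_eq (f : RatFunc ℚ) : invT f = invTHom f := rfl

theorem tq_add (a b : ℤ) : tq (a + b) = tq a * tq b := zpow_add₀ RatFunc.X_ne_zero a b

theorem tq_zero : tq 0 = 1 := zpow_zero _

theorem tq_ne_zero (a : ℤ) : tq a ≠ 0 := zpow_ne_zero a RatFunc.X_ne_zero

theorem tq_neg (a : ℤ) : tq (-a) = (tq a)⁻¹ := zpow_neg _ a

theorem tq_sum {ι : Type*} (s : Finset ι) (f : ι → ℤ) : tq (∑ i ∈ s, f i) = ∏ i ∈ s, tq (f i) := by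
  classical
  induction s using Finset.induction_on with
  | empty => simp [tq_zero]
  | insert i s hi ih => rw [Finset.sum_insert hi, Finset.prod_insert hi, tq_add, ih]

theorem invTHom_tq (a : ℤ) : invTHom (tq a) = tq (-a) := by
  have : invTHom RatFunc.X = RatFunc.X⁻¹ := RatFunc.eval_X _ _
  rw [tq, map_zpow₀, this, tq, inv_zpow, zpow_neg]

theorem tq_injective : Function.Injective tq := by
  have key : ∀ n : ℕ, tq n = 1 → n = 0 := fun n h => by
    have h₁ : (algebraMap (Polynomial ℚ) (RatFunc ℚ)) (Polynomial.X ^ n) = algebraMap _ _ 1 := by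
      rw [map_pow, RatFunc.algebraMap_X, map_one]
      simpa [tq] using h
    have h₂ := congrArg Polynomial.natDegree (RatFunc.algebraMap_injective ℚ h₁)
    simpa using h₂
  have key' : ∀ k : ℤ, tq k = 1 → k = 0 := fun k h => by
    obtain ⟨n, rfl | rfl⟩ := k.eq_nat_or_neg
    · rw [key n h, Nat.cast_zero]
    · rw [tq_neg, inv_eq_one] at h
      rw [key n h, Nat.cast_zero, neg_zero]
  intro a b h
  have : tq (a - b) = 1 := by
    rw [sub_eq_add_neg, tq_add, tq_neg, h, mul_inv_cancel₀ (tq_ne_zero b)]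
  have := key' _ this
  omega

namespace Diagram

theorem tdiff_ne_zero {k : ℤ} (hk : k ≠ 0) : tdiff k ≠ 0 :=
  sub_ne_zero.2 fun h => hk (by have := tq_injective h; omega)

theorem invTHom_tdiff (k : ℤ) : invTHom (tdiff k) = - tdiff k := by
  rw [tdiff, map_sub, invTHom_tq, invTHom_tq, neg_neg, neg_sub]

variable {D : Diagram} (c : D.PosColoring)

/-- The weights of the corners, divided by a factor at each merge. -/
noncomputable def unitWeight : D.Node → Corner → RatFunc ℚ
  | .inl x, k => nodeWeight c (.inl x) k
  | .inr m, k => nodeWeight c (.inr m) k / tdiff (c.color (.inl (D.oM m)))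

theorem color_oM (m : D.M) : c.color (.inl (D.oM m))
    = c.color (.inl (D.iL (.inr m))) + c.color (.inl (D.iR (.inr m))) :=
  (c.merge m).symm

theorem tdiff_color_ne_zero (e : D.Piece) : tdiff (c.color e) ≠ 0 := tdiff_ne_zero (c.pos e).ne'

/-- At a merge this is `[i + j] = t^(i/2) [j] + [i] t^(-j/2)` and its counterpart under `t ↦ t⁻¹`,
where `[k] = t^(k/2) - t^(-k/2)` is `tdiff k`. It explains the divisor `tdiff` of the outgoing
color. -/
theorem isNormalized_unitWeight : IsNormalized (unitWeight c) where
  cross x := by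
    simp only [unitWeight, nodeWeight, signM, weightA]
    split_ifs <;> ring
  crossS x := by simp [unitWeight, nodeWeight, signM, weightA]
  merge m := by
    have h := tdiff_color_ne_zero c (.inl (D.oM m))
    simp only [unitWeight, nodeWeight]
    rw [← add_div, div_eq_one_iff_eq h, color_oM]
    change tq (2 * c.color (.inl (D.iL (.inr m)))) * tdiff (c.color (.inl (D.iR (.inr m))))
      + tdiff (c.color (.inl (D.iL (.inr m)))) * tq (-(2 * c.color (.inl (D.iR (.inr m))))) = _
    simp only [tdiff, mul_add, neg_add, tq_add]
    ring
  mergeS m := by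
    have h := tdiff_color_ne_zero c (.inl (D.oM m))
    simp only [unitWeight, nodeWeight]
    rw [← add_div, div_eq_one_iff_eq h, color_oM]
    change tq (-(2 * c.color (.inl (D.iL (.inr m))))) * tdiff (c.color (.inl (D.iR (.inr m))))
      + tdiff (c.color (.inl (D.iL (.inr m)))) * tq (2 * c.color (.inl (D.iR (.inr m)))) = _
    simp only [tdiff, mul_add, neg_add, tq_add]
    ring

/-- The product of the factors of the vertices. -/
noncomputable def vertexFactor : RatFunc ℚ :=
  (∏ s, tdiff (c.color (.inl (D.iS s)))) * ∏ m, tdiff (c.color (.inl (D.oM m)))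

theorem stateSum_eq_unit (δ : D.Piece) :
    stateSum c δ = vertexFactor c * reducedSum δ (unitWeight c) := by
  rw [stateSum_eq, vertexFactor, mul_assoc]
  congr 1
  simp only [reducedSum, Finset.mul_sum]
  refine Finset.sum_congr rfl fun s _ => ?_
  rw [Fintype.prod_sum_type, Fintype.prod_sum_type]
  simp only [unitWeight]
  rw [mul_left_comm, ← Finset.prod_mul_distrib]
  congr 1
  exact Finset.prod_congr rfl fun m _ =>
    (mul_div_cancel₀ _ (tdiff_color_ne_zero c (.inl (D.oM m)))).symm

/-- Every factor changes its sign, and there are as many splits as merges. -/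
theorem invTHom_vertexFactor : invTHom (vertexFactor c) = vertexFactor c := by
  simp only [vertexFactor, map_mul, map_prod, invTHom_tdiff, Finset.prod_neg, Finset.card_univ,
    D.card_merge_eq_card_split]
  rw [mul_mul_mul_comm, ← pow_add, ← two_mul, pow_mul, neg_one_sq, one_pow, one_mul]

theorem invTHom_reducedSum (δ : D.Piece) (w : D.Node → Corner → RatFunc ℚ) :
    invTHom (reducedSum δ w) = reducedSum δ fun x k => invTHom (w x k) := by
  simp only [reducedSum, map_sum, map_prod]

/-- The factors of the Alexander polynomial that do not depend on the planar embedding. -/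
noncomputable def commonFactor : RatFunc ℚ :=
  framing c * vertexFactor c / (tq 2 - tq (-2)) ^ ((Fintype.card D.Vertex : ℤ) - 1)

theorem Good.alexander_eq (hD : D.Good) (δ : D.Piece) :
    alexander c δ = commonFactor c * tq (2 * rotation (index c)) * reducedSum δ (unitWeight c)
      / initialFactor c δ := by
  rw [alexander, hD.curliness_eq, stateSum_eq_unit, commonFactor]
  field_simp

theorem alexander_eq_zero (hD : ¬ D.Good) (δ : D.Piece) : alexander c δ = 0 := by
  rw [alexander, stateSum_eq, reducedSum_eq_zero hD, mul_zero, mul_zero]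

/-- The sign comes from the exponent `#Vertex - 1`, which is odd since `#Vertex = 2 * #M`. It will
cancel against the sign of the initial factor. -/
theorem invTHom_commonFactor_mirror : invTHom (commonFactor c.mirror) = - commonFactor c := by
  have h₁ : invTHom (framing c.mirror) = framing c := by
    simp only [framing, map_prod, invTHom_tq]
    refine Finset.prod_congr rfl fun e _ => congrArg tq ?_
    change -(c.color e * ((D.negTwist e : ℤ) - (D.posTwist e : ℤ))) = _
    ring
  have h₂ : invTHom (vertexFactor c.mirror) = vertexFactor c := invTHom_vertexFactor c.mirror
  have h₃ : invTHom (tq 2 - tq (-2)) = - (tq 2 - tq (-2)) := by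
    rw [map_sub, invTHom_tq, invTHom_tq, neg_neg, neg_sub]
  have h₄ : (Fintype.card D.mirror.Vertex : ℤ) = 2 * Fintype.card D.M := by
    change (Fintype.card D.Vertex : ℤ) = _
    rw [Fintype.card_sum, ← D.card_merge_eq_card_split]
    push_cast
    ring
  have h₅ : (Fintype.card D.Vertex : ℤ) = 2 * Fintype.card D.M := h₄
  rw [commonFactor, commonFactor, map_div₀, map_mul, h₁, h₂, map_zpow₀, h₃, h₄, h₅,
    Odd.neg_zpow ⟨(Fintype.card D.M : ℤ) - 1, by ring⟩, div_neg]

theorem commonFactor_reverse : commonFactor c.reverse = commonFactor c := by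
  have h₁ : framing c.reverse = framing c := rfl
  have h₂ : vertexFactor c.reverse = vertexFactor c := mul_comm _ _
  have h₃ : Fintype.card D.reverse.Vertex = Fintype.card D.Vertex :=
    Fintype.card_congr (Equiv.sumComm D.S D.M)
  rw [commonFactor, commonFactor, h₁, h₂, h₃]

theorem good_reverse (hD : D.Good) : D.reverse.Good := by
  unfold Good at *
  have h : Fintype.card D.reverse.Node = Fintype.card D.Node := by
    have h₁ : Fintype.card D.reverse.Node = Fintype.card D.X + Fintype.card D.S :=
      Fintype.card_sum
    rw [h₁, Fintype.card_sum, D.card_merge_eq_card_split]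
  rw [h]
  exact hD

theorem Good.index_reverse (hD : D.Good) : index c.reverse = fun r => - index c r := by
  refine winding_unique ((good_reverse hD).isIndex c.reverse).1 ?_
    ((good_reverse hD).isIndex c.reverse).2 fun e => ?_
  · change - index c D.outer = 0
    rw [(hD.isIndex c).1, neg_zero]
  · change - index c (D.leftR e) = - index c (D.rightR e) + c.color e
    have := hD.index_right c e
    omega

end Diagram

end MOY

/-! ### Index and initial factors at crossings and merges -/

namespace MOY

namespace Diagram

variable {D : Diagram}

section

variable (hD : D.Good) (c : D.PosColoring)

include hD

/-- The index in the corners of a crossing. -/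
theorem Good.index_cross (x : D.X) :
    index c (D.corner (.inl x) .S) = index c (D.corner (.inl x) .W)
      + c.color (D.into (.crossL x)) ∧
    index c (D.corner (.inl x) .N) = index c (D.corner (.inl x) .W)
      + c.color (D.into (.crossR x)) ∧
    index c (D.corner (.inl x) .E) = index c (D.corner (.inl x) .W)
      + c.color (D.into (.crossL x)) + c.color (D.into (.crossR x)) := by
  have h₁ := hD.index_right c (.inl (D.iL (.inl x)))
  have h₂ := hD.index_right c (.inl (D.iR (.inl x)))
  have h₃ := hD.index_right c (.inl (D.oL x))
  rw [left_iL, right_iL] at h₁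
  rw [left_iR, right_iR, h₁] at h₂
  rw [left_oL, right_oL] at h₃
  refine ⟨h₁, ?_, h₂⟩
  rw [h₃, c.cross₂]
  rfl

/-- The index in the corners of a merge. -/
theorem Good.index_merge (m : D.M) :
    index c (D.corner (.inr m) .S) = index c (D.corner (.inr m) .W)
      + c.color (D.into (.mergeL m)) ∧
    index c (D.corner (.inr m) .E) = index c (D.corner (.inr m) .W)
      + c.color (D.into (.mergeL m)) + c.color (D.into (.mergeR m)) := by
  have h₁ := hD.index_right c (.inl (D.iL (.inr m)))
  have h₂ := hD.index_right c (.inl (D.iR (.inr m)))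
  rw [left_iL, right_iL] at h₁
  rw [left_iR, right_iR, h₁] at h₂
  exact ⟨h₁, h₂⟩

end

theorem tq_four (k : ℤ) : tq (4 * k) = tq (2 * k) ^ 2 := by
  rw [show 4 * k = 2 * k + 2 * k by ring, tq_add, sq]

theorem initialFactor_ne_zero (hD : D.Good) (c : D.PosColoring) (e : D.Piece) :
    initialFactor c e ≠ 0 :=
  sub_ne_zero.2 fun h => by
    have := tq_injective h
    have := hD.index_lt c e
    omega

/-! ### Independence of the initial point -/

theorem unitWeight_merge_W (c : D.PosColoring) (m : D.M) : unitWeight c (.inr m) .W =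
    tq (2 * c.color (D.into (.mergeL m))) * tdiff (c.color (D.into (.mergeR m)))
      / tdiff (c.color (D.into (.mergeL m)) + c.color (D.into (.mergeR m))) := by
  simp only [unitWeight, nodeWeight, color_oM]
  rfl

theorem unitWeight_merge_E (c : D.PosColoring) (m : D.M) : unitWeight c (.inr m) .E =
    tdiff (c.color (D.into (.mergeL m))) * tq (-(2 * c.color (D.into (.mergeR m))))
      / tdiff (c.color (D.into (.mergeL m)) + c.color (D.into (.mergeR m))) := by
  simp only [unitWeight, nodeWeight, color_oM]
  rfl

theorem tdiff_merge_ne_zero (c : D.PosColoring) (m : D.M) :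
    tdiff (c.color (D.into (.mergeL m)) + c.color (D.into (.mergeR m))) ≠ 0 := by
  have h₁ := c.pos (D.into (.mergeL m))
  have h₂ := c.pos (D.into (.mergeR m))
  exact tdiff_ne_zero (by omega)

/-- The initial factors of the arcs at a crossing and at a merge. -/
theorem Good.initialFactor_cross (hD : D.Good) (c : D.PosColoring) (x : D.X) :
    ∃ T A B : RatFunc ℚ, T ≠ 0 ∧ A ≠ 0 ∧ B ≠ 0 ∧
      A = tq (4 * c.color (D.into (.crossL x))) ∧ B = tq (4 * c.color (D.into (.crossR x))) ∧
      initialFactor c (.inl (D.iL (.inl x))) = T * (A - 1) ∧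
      initialFactor c (.inl (D.iR (.inl x))) = T * A * (B - 1) ∧
      initialFactor c (.inl (D.oL x)) = T * (B - 1) ∧
      initialFactor c (.inl (D.oR x)) = T * B * (A - 1) := by
  obtain ⟨h₁, h₂, h₃⟩ := hD.index_cross c x
  refine ⟨tq (4 * index c (D.corner (.inl x) .W)), _, _, tq_ne_zero _, tq_ne_zero _, tq_ne_zero _,
    rfl, rfl, ?_⟩
  simp only [initialFactor, left_iL, right_iL, left_iR, right_iR, left_oL, right_oL, left_oR,
    right_oR, h₁, h₂, h₃, mul_add, tq_add]
  refine ⟨?_, ?_, ?_, ?_⟩ <;> ring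

theorem Good.initialFactor_merge (hD : D.Good) (c : D.PosColoring) (m : D.M) :
    ∃ T A B : RatFunc ℚ,
      A = tq (2 * c.color (D.into (.mergeL m))) ∧ B = tq (2 * c.color (D.into (.mergeR m))) ∧
      initialFactor c (.inl (D.iL (.inr m))) = T * (A ^ 2 - 1) ∧
      initialFactor c (.inl (D.iR (.inr m))) = T * A ^ 2 * (B ^ 2 - 1) ∧
      initialFactor c (.inl (D.oM m)) = T * (A ^ 2 * B ^ 2 - 1) := by
  obtain ⟨h₁, h₂⟩ := hD.index_merge c m
  refine ⟨tq (4 * index c (D.corner (.inr m) .W)), _, _, rfl, rfl, ?_⟩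
  simp only [initialFactor, left_iL, right_iL, left_iR, right_iR, left_oM, right_oM,
    h₁, h₂, mul_add, tq_add]
  rw [tq_four, tq_four (c.color (D.into (.mergeL m))), tq_four (c.color (D.into (.mergeR m)))]
  refine ⟨by ring, by ring, by ring⟩

/-- The weights at a merge, and their values at `t⁻¹`. -/
theorem exists_unitWeight_merge (c : D.PosColoring) (m : D.M) :
    ∃ A B : RatFunc ℚ, A ≠ 0 ∧ B ≠ 0 ∧
      A = tq (2 * c.color (D.into (.mergeL m))) ∧ B = tq (2 * c.color (D.into (.mergeR m))) ∧
      A ^ 2 * B ^ 2 - 1 ≠ 0 ∧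
      unitWeight c (.inr m) .W = A ^ 2 * (B ^ 2 - 1) / (A ^ 2 * B ^ 2 - 1) ∧
      unitWeight c (.inr m) .E = (A ^ 2 - 1) / (A ^ 2 * B ^ 2 - 1) ∧
      invTHom (unitWeight c (.inr m) .W) = (B ^ 2 - 1) / (A ^ 2 * B ^ 2 - 1) ∧
      invTHom (unitWeight c (.inr m) .E) = B ^ 2 * (A ^ 2 - 1) / (A ^ 2 * B ^ 2 - 1) := by
  have h₀ := tdiff_merge_ne_zero c m
  have hA := tq_ne_zero (2 * c.color (D.into (.mergeL m)))
  have hB := tq_ne_zero (2 * c.color (D.into (.mergeR m)))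
  refine ⟨_, _, hA, hB, rfl, rfl, ?_⟩
  rw [unitWeight_merge_W, unitWeight_merge_E]
  simp only [map_div₀, map_mul, invTHom_tdiff, invTHom_tq]
  simp only [mul_add, tq_add, tdiff, neg_neg, tq_neg, mul_inv] at h₀ ⊢
  generalize tq (2 * c.color (D.into (.mergeL m))) = A at *
  generalize tq (2 * c.color (D.into (.mergeR m))) = B at *
  have h₄ : A ^ 2 * B ^ 2 - 1 ≠ 0 := fun h => h₀ (by
    field_simp
    linear_combination h)
  have h₅ : A * B - A⁻¹ * B⁻¹ = (A ^ 2 * B ^ 2 - 1) / (A * B) := by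
    field_simp
  rw [h₅]
  refine ⟨h₄, ?_, ?_, ?_, ?_⟩ <;> field_simp

theorem initialFactor_split (c : D.PosColoring) (s : D.S) :
    initialFactor c (.inl (D.iS s))
      = initialFactor c (.inl (D.oSL s)) + initialFactor c (.inl (D.oSR s)) := by
  simp only [initialFactor, left_iS, right_iS, left_oSL, right_oSL, left_oSR, right_oSR]
  ring

open Classical in
-- The initial factors are a stationary vector of the walk. In terms of the powers `A`, `B` of `t`
-- given by the two incoming colors, each row at a crossing or merge is an elementary identity.
theorem Good.walk_initialFactor (hD : D.Good) (c : D.PosColoring) :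
    (1 - walkMatrix (unitWeight c)).mulVec (fun a => initialFactor c (.inl a)) = 0 := by
  rw [Matrix.sub_mulVec, Matrix.one_mulVec, sub_eq_zero]
  funext a
  rcases D.arc_head_cases a with ⟨x | m, rfl⟩ | ⟨x | m, rfl⟩ | ⟨s, rfl⟩
  · rw [walk_iL_cross]
    obtain ⟨T, A, B, hT, hA, hB, eA, eB, h₁, h₂, h₃, h₄⟩ := hD.initialFactor_cross c x
    rw [h₁, h₃, h₄]
    simp only [unitWeight, nodeWeight, signM, weightA, overColor]
    split_ifs
    · rw [← eA]; ring
    · rw [tq_neg, ← eB]; field_simp; ring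
  · rw [walk_iL_merge]
    obtain ⟨T, A, B, eA, eB, h₁, h₂, h₃⟩ := hD.initialFactor_merge c m
    obtain ⟨A', B', hA, hB, eA', eB', h₄, h₅, h₆, -⟩ := exists_unitWeight_merge c m
    rw [h₁, h₃, h₆]
    rw [← eA] at eA'
    rw [← eB] at eB'
    subst eA' eB'
    field_simp
  · rw [walk_iR_cross]
    obtain ⟨T, A, B, hT, hA, hB, eA, eB, h₁, h₂, h₃, h₄⟩ := hD.initialFactor_cross c x
    rw [h₂, h₃, h₄]
    simp only [unitWeight, nodeWeight, signM, weightA, overColor]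
    split_ifs
    · rw [← eA]; ring
    · rw [tq_neg, ← eB]; field_simp; ring
  · rw [walk_iR_merge]
    obtain ⟨T, A, B, eA, eB, h₁, h₂, h₃⟩ := hD.initialFactor_merge c m
    obtain ⟨A', B', hA, hB, eA', eB', h₄, h₅, h₆, -⟩ := exists_unitWeight_merge c m
    rw [h₂, h₃, h₅]
    rw [← eA] at eA'
    rw [← eB] at eB'
    subst eA' eB'
    field_simp
  · rw [walk_iS]
    exact initialFactor_split c s

/-- By `adjugate_diag_mul`, applied to this stationary vector, the reduced sums are proportional to
the initial factors by which they are divided. -/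
theorem Good.alexander_eq_alexander (hD : D.Good) (c : D.PosColoring) (δ δ' : D.Piece) :
    alexander c δ = alexander c δ' := by
  classical
  rcases hD.loop_cases with hL | ⟨-, hP⟩
  · rcases δ with a | l
    · rcases δ' with b | l
      · have hw := isNormalized_unitWeight c
        have h := adjugate_diag_mul (1 - walkMatrix (unitWeight c)) (fun b => by
          convert hw.sub_walk_colSum b) (fun a => initialFactor c (.inl a)) (by
          convert hD.walk_initialFactor c) a b
        have ha := hD.reducedSum_eq_adjugate c a hw
        have hb := hD.reducedSum_eq_adjugate c b hw
        have h' : reducedSum (.inl a) (unitWeight c) * initialFactor c (.inl b)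
            = reducedSum (.inl b) (unitWeight c) * initialFactor c (.inl a) := by
          rw [ha, hb]
          convert h
        rw [hD.alexander_eq, hD.alexander_eq, div_eq_div_iff (initialFactor_ne_zero hD c _)
          (initialFactor_ne_zero hD c _), mul_assoc, h', ← mul_assoc]
      · exact hL.elim l
    · exact hL.elim l
  · rw [Subsingleton.elim δ δ']

/-! ### The mirror image -/

theorem corner_mirror (x : D.Node) (k : Corner) :
    (D.mirror.corner x k : D.Region) = D.corner x k := by
  rcases x with x | m <;> cases k <;> rfl

theorem reducedSum_mirror {K : Type} [CommRing K] (δ : D.Piece) (w : D.Node → Corner → K) :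
    reducedSum (D := D.mirror) δ w = reducedSum δ w := by
  classical
  -- The corners of the mirror image agree with those of `D` only after a case distinction, so the
  -- corner function is generalized and then substituted as a whole.
  have h : ∀ f : D.Node → Corner → D.Region, f = D.corner →
      (∑ s : D.Node → Corner with Set.BijOn (fun x => f x (s x)) Set.univ
        {r | r ≠ D.leftR δ ∧ r ≠ D.rightR δ}, ∏ x, w x (s x)) = reducedSum δ w := by
    rintro _ rfl
    unfold reducedSum IsReducedState
    congr
  refine Eq.trans ?_ (h D.mirror.corner (funext fun x => funext fun k => corner_mirror (D := D) x k))
  unfold reducedSum IsReducedState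
  congr

theorem rotation_mirror (f : D.Region → ℤ) : rotation (D := D.mirror) f = rotation f :=
  congrArg (∑ r, f r - ·) (Finset.sum_congr rfl fun x _ => congrArg f (corner_mirror (D := D) x .S))

/-- The weights of the mirror image. -/
noncomputable def mirrorWeight (c : D.PosColoring) : D.Node → Corner → RatFunc ℚ :=
  unitWeight (D := D.mirror) c.mirror

theorem mirrorWeight_merge (c : D.PosColoring) (m : D.M) (k : Corner) :
    mirrorWeight c (.inr m) k = unitWeight c (.inr m) k := by
  cases k <;> rfl


/-- The gauge factor is a power of `t` with exponent the index at `S` minus the index at `r`: one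
factor for the row and one for the column. At a merge it is false for the corners `S` and `N`
separately and true for their sum, which is `1`; therefore the corners lying in `r` are summed. -/
theorem Good.unitWeight_gauge (hD : D.Good) (c : D.PosColoring) (x : D.Node) (r : D.Region)
    [DecidableEq D.Region] :
    (∑ k, if D.corner x k = r then (kappa x k : RatFunc ℚ) * unitWeight c x k else 0)
      = tq (4 * index c (D.corner x .S)) * (tq (-(4 * index c r)) *
        ∑ k, if D.corner x k = r then (kappa x k : RatFunc ℚ) *
          invTHom (mirrorWeight c x k) else 0) := by
  rcases x with x | m
  · obtain ⟨h₁, h₂, h₃⟩ := hD.index_cross c x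
    simp only [Finset.mul_sum]
    refine Finset.sum_congr rfl fun k _ => ?_
    split_ifs with hr
    · subst hr
      have e₁ : c.mirror.color (D.mirror.into (.crossL x)) = c.color (D.into (.crossL x)) := rfl
      have e₂ : c.mirror.color (D.mirror.into (.crossR x)) = c.color (D.into (.crossR x)) := rfl
      have e₃ : D.mirror.positive x = !D.positive x := rfl
      have hT := tq_ne_zero (4 * index c (D.corner (.inl x) .W))
      have hA := tq_ne_zero (4 * c.color (D.into (.crossL x)))
      have hB := tq_ne_zero (4 * c.color (D.into (.crossR x)))
      cases k <;> cases hp : D.positive x <;>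
        simp only [mirrorWeight, unitWeight, nodeWeight, signM, weightA, overColor, e₁, e₂, e₃, hp, h₁, h₂, h₃,
          kappa, Bool.not_true, Bool.not_false, Bool.false_eq_true, if_true, if_false, map_mul,
          map_one, map_neg, map_inv₀, invTHom_tq, mul_add, tq_add, tq_neg, inv_inv] <;>
        field_simp
    · simp
  · obtain ⟨h₁, h₂⟩ := hD.index_merge c m
    obtain ⟨A, B, hA, hB, eA, eB, h₃, h₄, h₅, h₆, h₇⟩ := exists_unitWeight_merge c m
    have hw := (isNormalized_unitWeight c).mergeS m
    have hW : unitWeight c (.inr m) .W = A ^ 2 * invTHom (unitWeight c (.inr m) .W) := by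
      rw [h₆, h₄, mul_div_assoc]
    have hE : unitWeight c (.inr m) .E = (B ^ 2)⁻¹ * invTHom (unitWeight c (.inr m) .E) := by
      rw [h₇, h₅]
      field_simp
    have hN : unitWeight c (.inr m) .N = 1 - unitWeight c (.inr m) .S := by
      rw [← hw, add_sub_cancel_left]
    have gW : D.corner (.inr m) .W = r → tq (4 * index c (D.corner (.inr m) .S)) *
        tq (-(4 * index c r)) = A ^ 2 := by
      rintro rfl
      rw [h₁, ← tq_add, eA, ← tq_four]
      congr 1
      ring
    have gE : D.corner (.inr m) .E = r → tq (4 * index c (D.corner (.inr m) .S)) *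
        tq (-(4 * index c r)) = (B ^ 2)⁻¹ := by
      rintro rfl
      rw [h₁, h₂, ← tq_add, eB, ← tq_four, ← tq_neg]
      congr 1
      ring
    have gS : D.corner (.inr m) .S = r → tq (4 * index c (D.corner (.inr m) .S)) *
        tq (-(4 * index c r)) = 1 := by
      rintro rfl
      rw [tq_neg, mul_inv_cancel₀ (tq_ne_zero _)]
    rw [← mul_assoc]
    simp only [sum_corner, kappa, mirrorWeight_merge, corner_merge_N, hN, map_sub, map_one, mul_add, mul_ite, mul_zero,
      Int.cast_neg, Int.cast_one]
    congr 1
    · congr 1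
      · rw [← add_zero (_ + _)]
        by_cases hr : D.corner (.inr m) .S = r
        · simp only [if_pos hr, gS hr]
          ring
        · simp only [if_neg hr, add_zero]
      · split_ifs with hr
        · rw [gW hr, one_mul, one_mul, ← hW]
        · rfl
    · split_ifs with hr
      · rw [gE hr, one_mul, one_mul, ← hE]
      · rfl

theorem prod_subtype_mul {ι K : Type*} [Fintype ι] [CommMonoid K] {a b : ι} (hab : a ≠ b)
    [Fintype {i // i ≠ a ∧ i ≠ b}] (F : ι → K) :
    (∏ i : {i // i ≠ a ∧ i ≠ b}, F i) * (F a * F b) = ∏ i, F i := by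
  classical
  have h : ∏ i : {i // i ≠ a ∧ i ≠ b}, F i = ∏ i ∈ (Finset.univ.erase a).erase b, F i := by
    refine (Finset.prod_subtype _ (fun i => ?_) F).symm
    simp [and_comm]
  rw [h, mul_comm (F a), ← mul_assoc, Finset.prod_erase_mul _ _ (by simp [hab.symm]),
    Finset.prod_erase_mul _ _ (Finset.mem_univ a)]

/-- The gauge multiplies the corner matrix by diagonal matrices from both sides. Their determinants
contribute the index at all `S` corners minus the index of all regions except the two at `δ`. The
sign of the states is the same on both sides, as it does not depend on the weights. -/
theorem Good.reducedSum_gauge (hD : D.Good) (c : D.PosColoring) (δ : D.Piece) :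
    reducedSum δ (unitWeight c)
      = tq (4 * (index c (D.leftR δ) + index c (D.rightR δ) - rotation (index c)))
        * invTHom (reducedSum (D := D.mirror) δ (unitWeight c.mirror)) := by
  classical
  obtain ⟨e⟩ := hD.nonempty_equiv c δ
  obtain ⟨ε, hε, h⟩ := hD.exists_sign e c
  have h₁ := h (RatFunc ℚ) (unitWeight c)
  have h₂ := h (RatFunc ℚ) (fun x k => invTHom (mirrorWeight c x k))
  have h₃ : invTHom (reducedSum (D := D.mirror) δ (unitWeight c.mirror))
      = reducedSum (D := D) δ fun x k => invTHom (mirrorWeight c x k) := by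
    rw [← invTHom_reducedSum]
    exact congrArg invTHom (reducedSum_mirror δ (mirrorWeight c))
  rw [h₃]
  have hm : cornerMatrix e (unitWeight c) = Matrix.diagonal (fun x => tq (4 * index c (D.corner x .S)))
      * (cornerMatrix e (fun x k => invTHom (mirrorWeight c x k))
        * Matrix.diagonal fun y => tq (-(4 * index c (e y).1))) := by
    ext x y
    rw [Matrix.diagonal_mul, Matrix.mul_diagonal, mul_comm (cornerMatrix _ _ _ _)]
    have := hD.unitWeight_gauge c x (e y).1
    unfold cornerMatrix
    convert this
  have hne : D.leftR δ ≠ D.rightR δ := fun h => by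
    have := hD.index_lt c δ
    rw [h] at this
    exact lt_irrefl _ this
  have hp : (∏ x, tq (4 * index c (D.corner x .S))) * ∏ y, tq (-(4 * index c (e y).1))
      = tq (4 * (index c (D.leftR δ) + index c (D.rightR δ) - rotation (index c))) := by
    have h₄ := prod_subtype_mul hne (fun r => tq (-(4 * index c r)))
    rw [← Equiv.prod_comp e] at h₄
    have h₅ : tq (4 * (index c (D.leftR δ) + index c (D.rightR δ))) * (tq (-(4 * index c (D.leftR δ)))
        * tq (-(4 * index c (D.rightR δ)))) = 1 := by
      rw [← tq_add, ← tq_add, ← tq_zero]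
      congr 1
      ring
    have h₆ : tq (4 * (index c (D.leftR δ) + index c (D.rightR δ) - rotation (index c)))
        = (∏ x, tq (4 * index c (D.corner x .S))) * (∏ r, tq (-(4 * index c r)))
          * tq (4 * (index c (D.leftR δ) + index c (D.rightR δ))) := by
      rw [← tq_sum, ← tq_sum, ← tq_add, ← tq_add, rotation, Finset.sum_neg_distrib,
        ← Finset.mul_sum, ← Finset.mul_sum]
      congr 1
      ring
    rw [h₆, ← h₄]
    linear_combination -(∏ x, tq (4 * index c (D.corner x .S))) *
      (∏ y, tq (-(4 * index c (e y).1))) * h₅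
  have hε' : (ε : RatFunc ℚ) ≠ 0 := by
    rcases hε with rfl | rfl <;> simp
  rw [hm, Matrix.det_mul, Matrix.det_mul, Matrix.det_diagonal, Matrix.det_diagonal] at h₁
  rw [← hp]
  refine mul_left_cancel₀ hε' (h₁.symm.trans ?_)
  have h₂' : (cornerMatrix e fun x k => invTHom (mirrorWeight c x k)).det
      = ε * reducedSum δ fun x k => invTHom (mirrorWeight c x k) := by
    convert h₂
  rw [h₂']
  ring

/-- The substitution inverts the curliness, a discrepancy of `t` to the power `rotation (index c)`,
which cancels the rotation in `Good.reducedSum_gauge`. The rest of that exponent is the one by which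
`t ↦ t⁻¹` shifts the initial factor, and the two minus signs cancel. -/
theorem Good.alexander_mirror (hD : D.Good) (c : D.PosColoring) (δ : D.Piece) :
    alexander c δ = invT (alexander c.mirror δ) := by
  have h₀ := Good.alexander_eq (D := D.mirror) c.mirror hD δ
  rw [hD.alexander_eq]
  refine Eq.trans ?_ (congrArg invT h₀).symm
  rw [invT_eq, map_div₀, map_mul, map_mul,
    invTHom_commonFactor_mirror, hD.reducedSum_gauge]
  have h₁ : invTHom (initialFactor c.mirror δ) = - initialFactor c δ
      * tq (-(4 * (index c (D.leftR δ) + index c (D.rightR δ)))) := by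
    change invTHom (tq (4 * index c (D.rightR δ)) - tq (4 * index c (D.leftR δ))) =
      - (tq (4 * index c (D.rightR δ)) - tq (4 * index c (D.leftR δ))) * _
    rw [map_sub, invTHom_tq, invTHom_tq]
    simp only [mul_add, neg_add, tq_add, tq_neg]
    have hL := tq_ne_zero (4 * index c (D.leftR δ))
    have hR := tq_ne_zero (4 * index c (D.rightR δ))
    field_simp
    ring
  have h₂ : rotation (D := D.mirror) (index c.mirror) = rotation (index c) :=
    rotation_mirror _
  have h₃ : tq (4 * (index c (D.leftR δ) + index c (D.rightR δ) - rotation (index c)))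
      = tq (4 * (index c (D.leftR δ) + index c (D.rightR δ))) * (tq (2 * rotation (index c)))⁻¹ ^ 2 := by
    rw [← tq_neg, sq, ← tq_add, ← tq_add]
    congr 1
    ring
  have hi := initialFactor_ne_zero hD c δ
  have hT := tq_ne_zero (4 * (index c (D.leftR δ) + index c (D.rightR δ)))
  have hr := tq_ne_zero (2 * rotation (index c))
  rw [h₁, h₂, h₃, invTHom_tq, tq_neg, tq_neg]
  field_simp

end Diagram

end MOY

namespace MOY

namespace Diagram

variable {D : Diagram}

/-! ### Reversal -/

/-- Weights on a diagram and on the reversed diagram for which the walks are transposed to each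
other up to the scaling by `v`. -/
structure IsTransposed {K : Type} [CommRing K] (v : D.Arc → K) (w : D.Node → Corner → K)
    (w' : D.reverse.Node → Corner → K) : Prop where
  cross₁ : ∀ x : D.X, v (D.iR (.inl x)) * (1 - w' (.inl x) .W)
    = v (D.oR x) * (1 - w (.inl x) .E)
  cross₂ : ∀ x : D.X, v (D.iL (.inl x)) * w' (.inl x) .E = v (D.oR x) * w (.inl x) .E
  cross₃ : ∀ x : D.X, v (D.iR (.inl x)) * w' (.inl x) .W = v (D.oL x) * w (.inl x) .W
  cross₄ : ∀ x : D.X, v (D.iL (.inl x)) * (1 - w' (.inl x) .E)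
    = v (D.oL x) * (1 - w (.inl x) .W)
  mergeL : ∀ m : D.M, v (D.iL (.inr m)) = v (D.oM m) * w (.inr m) .E
  mergeR : ∀ m : D.M, v (D.iR (.inr m)) = v (D.oM m) * w (.inr m) .W
  splitL : ∀ s : D.S, v (D.iS s) * w' (.inr s) .W = v (D.oSL s)
  splitR : ∀ s : D.S, v (D.iS s) * w' (.inr s) .E = v (D.oSR s)

section

variable {K : Type} [CommRing K] {v : D.Arc → K} {w : D.Node → Corner → K}
  {w' : D.reverse.Node → Corner → K}

theorem sum_mul_walk (w : D.Node → Corner → K) (z y : D.Arc → K) :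
    ∑ a, z a * (walkMatrix w).mulVec y a
      = ∑ x, (z (D.iL (.inl x)) * ((1 - w (.inl x) .W) * y (D.oL x) + w (.inl x) .E * y (D.oR x))
        + z (D.iR (.inl x)) * (w (.inl x) .W * y (D.oL x) + (1 - w (.inl x) .E) * y (D.oR x)))
      + (∑ m, (z (D.iL (.inr m)) * (w (.inr m) .E * y (D.oM m))
        + z (D.iR (.inr m)) * (w (.inr m) .W * y (D.oM m)))
      + ∑ s, z (D.iS s) * (y (D.oSL s) + y (D.oSR s))) := by
  rw [D.sum_head, Fintype.sum_sum_type, add_assoc]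
  simp only [walk_iL_cross, walk_iR_cross, walk_iL_merge, walk_iR_merge, walk_iS]

/-- The transposition in the form of an adjointness relation, which can be checked at one crossing
or vertex at a time. -/
theorem IsTransposed.sum_eq (h : IsTransposed v w w') (z z' : D.Arc → K) :
    ∑ a, z' a * (walkMatrix (D := D.reverse) w').mulVec (fun b : D.Arc => v b * z b) a
      = ∑ b, z b * (walkMatrix w).mulVec (fun a => v a * z' a) b := by
  -- Reversal exchanges merges with splits, so their two sums appear in the opposite order on the
  -- reversed diagram.
  rw [sum_mul_walk w]
  refine (sum_mul_walk (D := D.reverse) w' z' _).trans (congrArg₂ _ ?_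
    (Eq.trans (add_comm _ _) (congrArg₂ _ ?_ ?_)))
  · refine Finset.sum_congr rfl fun (x : D.X) _ => ?_
    change z' (D.oR x) * ((1 - w' (.inl x) .W) * (v (D.iR (.inl x)) * z (D.iR (.inl x)))
        + w' (.inl x) .E * (v (D.iL (.inl x)) * z (D.iL (.inl x))))
      + z' (D.oL x) * (w' (.inl x) .W * (v (D.iR (.inl x)) * z (D.iR (.inl x)))
        + (1 - w' (.inl x) .E) * (v (D.iL (.inl x)) * z (D.iL (.inl x)))) = _
    linear_combination z' (D.oR x) * z (D.iR (.inl x)) * h.cross₁ x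
      + z' (D.oR x) * z (D.iL (.inl x)) * h.cross₂ x
      + z' (D.oL x) * z (D.iR (.inl x)) * h.cross₃ x
      + z' (D.oL x) * z (D.iL (.inl x)) * h.cross₄ x
  · refine Finset.sum_congr rfl fun (m : D.M) _ => ?_
    change z' (D.oM m) * (v (D.iR (.inr m)) * z (D.iR (.inr m))
      + v (D.iL (.inr m)) * z (D.iL (.inr m))) = _
    linear_combination z' (D.oM m) * z (D.iR (.inr m)) * h.mergeR m
      + z' (D.oM m) * z (D.iL (.inr m)) * h.mergeL m
  · refine Finset.sum_congr rfl fun (s : D.S) _ => ?_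
    change z' (D.oSR s) * (w' (.inr s) .E * (v (D.iS s) * z (D.iS s)))
      + z' (D.oSL s) * (w' (.inr s) .W * (v (D.iS s) * z (D.iS s))) = _
    linear_combination z' (D.oSR s) * z (D.iS s) * h.splitR s
      + z' (D.oSL s) * z (D.iS s) * h.splitL s

theorem IsTransposed.walk_eq (h : IsTransposed v w w') (a b : D.Arc) :
    walkMatrix (D := D.reverse) w' a b * v b = v a * walkMatrix w b a := by
  classical
  have := h.sum_eq (Pi.single b 1) (Pi.single a 1)
  have e : ∀ (u : D.Arc → K) (i : D.Arc), (fun j => u j * Pi.single (M := fun _ => K) i 1 j)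
      = Pi.single i (u i) := fun u i => by
    funext j
    by_cases hj : j = i
    · subst hj; simp
    · simp [hj]
  rw [e v a] at this
  have h₂ : (walkMatrix (D := D.reverse) w').mulVec (fun j : D.Arc => v j * (Pi.single b 1 : D.Arc → K) j) a
      = walkMatrix (D := D.reverse) w' a b * v b := by
    change ∑ j : D.Arc, walkMatrix (D := D.reverse) w' a j * (v j * (Pi.single b 1 : D.Arc → K) j) = _
    rw [Finset.sum_eq_single b (fun j _ hj => by rw [Pi.single_eq_of_ne hj, mul_zero, mul_zero])
      (fun h => (h (Finset.mem_univ b)).elim), Pi.single_eq_same, mul_one]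
  rw [Finset.sum_eq_single a (fun j _ hj => by rw [Pi.single_eq_of_ne hj, zero_mul])
    (fun h => (h (Finset.mem_univ a)).elim), Finset.sum_eq_single b (fun j _ hj => by
      rw [Pi.single_eq_of_ne hj, zero_mul]) (fun h => (h (Finset.mem_univ b)).elim), h₂,
    Pi.single_eq_same, Pi.single_eq_same, one_mul, one_mul, Matrix.mulVec_single] at this
  rw [this]
  simp [mul_comm]

end

theorem IsNormalized.map {K L : Type} [CommRing K] [CommRing L] (f : K →+* L)
    {w : D.Node → Corner → K} (hw : IsNormalized w) : IsNormalized fun x k => f (w x k) where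
  cross x := by rw [← map_add, ← map_add, hw.cross, map_one]
  crossS x := by rw [hw.crossS, map_one]
  merge m := by rw [← map_add, hw.merge, map_one]
  mergeS m := by rw [← map_add, hw.mergeS, map_one]

theorem isNormalized_mirrorWeight (c : D.PosColoring) : IsNormalized (mirrorWeight c) where
  cross := (isNormalized_unitWeight (D := D.mirror) c.mirror).cross
  crossS := (isNormalized_unitWeight (D := D.mirror) c.mirror).crossS
  merge := (isNormalized_unitWeight (D := D.mirror) c.mirror).merge
  mergeS := (isNormalized_unitWeight (D := D.mirror) c.mirror).mergeS

/-- Time reversal of the walk with respect to its stationary vector: the reversed walk belongs to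
the mirror image with reversed orientations, at `t⁻¹`. At a split, the ratios of the initial factors
are the weights of the reversed merge. -/
theorem Good.isTransposed (hD : D.Good) (c : D.PosColoring) :
    IsTransposed (fun a => initialFactor c (.inl a)) (unitWeight c)
      (fun x k => invTHom (mirrorWeight c.reverse x k)) := by
  have hcross : ∀ x : D.X, ∃ T A B : RatFunc ℚ, A ≠ 0 ∧ B ≠ 0 ∧
      initialFactor c (.inl (D.iL (.inl x))) = T * (A - 1) ∧
      initialFactor c (.inl (D.iR (.inl x))) = T * A * (B - 1) ∧
      initialFactor c (.inl (D.oL x)) = T * (B - 1) ∧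
      initialFactor c (.inl (D.oR x)) = T * B * (A - 1) ∧
      unitWeight c (.inl x) .W = (if D.positive x then A else 1) ∧
      unitWeight c (.inl x) .E = (if D.positive x then 1 else B⁻¹) ∧
      invTHom (mirrorWeight c.reverse (.inl x) .W) = (if D.positive x then 1 else A⁻¹) ∧
      invTHom (mirrorWeight c.reverse (.inl x) .E) = (if D.positive x then B else 1) := by
    intro x
    obtain ⟨T, A, B, -, hA, hB, eA, eB, h₁, h₂, h₃, h₄⟩ := hD.initialFactor_cross c x
    refine ⟨T, A, B, hA, hB, h₁, h₂, h₃, h₄, ?_⟩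
    have e₁ : c.reverse.mirror.color (D.reverse.mirror.into (.crossL x))
      = c.color (D.into (.crossL x)) := (c.cross₁ x).symm
    have e₂ : c.reverse.mirror.color (D.reverse.mirror.into (.crossR x))
      = c.color (D.into (.crossR x)) := (c.cross₂ x).symm
    have e₃ : D.reverse.mirror.positive x = !D.positive x := rfl
    cases hp : D.positive x <;>
      simp [mirrorWeight, unitWeight, nodeWeight, signM, weightA, overColor, e₁, e₂, e₃, hp,
        invTHom_tq, tq_neg, eA, eB]
  have hsplit : ∀ s : D.S, ∃ T A B : RatFunc ℚ, A ^ 2 * B ^ 2 - 1 ≠ 0 ∧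
      initialFactor c (.inl (D.iS s)) = T * (A ^ 2 * B ^ 2 - 1) ∧
      initialFactor c (.inl (D.oSL s)) = T * (B ^ 2 - 1) ∧
      initialFactor c (.inl (D.oSR s)) = T * B ^ 2 * (A ^ 2 - 1) ∧
      invTHom (mirrorWeight c.reverse (.inr s) .W) = (B ^ 2 - 1) / (A ^ 2 * B ^ 2 - 1) ∧
      invTHom (mirrorWeight c.reverse (.inr s) .E)
        = B ^ 2 * (A ^ 2 - 1) / (A ^ 2 * B ^ 2 - 1) := by
    intro s
    obtain ⟨A, B, hA, hB, eA, eB, h₁, -, -, h₂, h₃⟩ :=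
      exists_unitWeight_merge (D := D.reverse) c.reverse s
    -- The half turn makes the right outgoing edge of the split the left incoming edge of the
    -- reversed merge.
    have eA' : A ^ 2 = tq (4 * c.color (.inl (D.oSR s))) := by rw [eA, tq_four]; rfl
    have eB' : B ^ 2 = tq (4 * c.color (.inl (D.oSL s))) := by rw [eB, tq_four]; rfl
    have h₄ := hD.index_right c (.inl (D.oSL s))
    have h₅ := hD.index_right c (.inl (D.oSR s))
    rw [left_oSL, right_oSL] at h₄
    rw [left_oSR, right_oSR, h₄] at h₅
    refine ⟨tq (4 * index c (D.splitW s)), A, B, h₁, ?_, ?_, ?_,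
      (congrArg invTHom (mirrorWeight_merge (D := D.reverse) c.reverse s .W)).trans h₂,
      (congrArg invTHom (mirrorWeight_merge (D := D.reverse) c.reverse s .E)).trans h₃⟩ <;>
    · simp only [eA', eB', initialFactor, left_iS, right_iS, left_oSL, right_oSL, left_oSR, right_oSR, h₄, h₅,
        mul_add, tq_add]
      ring
  constructor
  · intro x
    obtain ⟨T, A, B, hA, hB, h₁, h₂, h₃, h₄, g₁, g₂, g₃, g₄⟩ := hcross x
    rw [h₂, h₄, g₂, g₃]
    split_ifs
    · ring
    · field_simp
  · intro x
    obtain ⟨T, A, B, hA, hB, h₁, h₂, h₃, h₄, g₁, g₂, g₃, g₄⟩ := hcross x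
    rw [h₁, h₄, g₂, g₄]
    split_ifs
    · ring
    · field_simp
  · intro x
    obtain ⟨T, A, B, hA, hB, h₁, h₂, h₃, h₄, g₁, g₂, g₃, g₄⟩ := hcross x
    rw [h₂, h₃, g₁, g₃]
    split_ifs
    · ring
    · field_simp
  · intro x
    obtain ⟨T, A, B, hA, hB, h₁, h₂, h₃, h₄, g₁, g₂, g₃, g₄⟩ := hcross x
    rw [h₁, h₃, g₁, g₄]
    split_ifs
    · ring
    · field_simp
      ring
  · intro m
    obtain ⟨T, A, B, eA, eB, h₁, h₂, h₃⟩ := hD.initialFactor_merge c m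
    obtain ⟨A', B', hA, hB, eA', eB', h₄, h₅, h₆, -⟩ := exists_unitWeight_merge c m
    rw [← eA] at eA'
    rw [← eB] at eB'
    subst eA' eB'
    rw [h₁, h₃, h₆]
    field_simp
  · intro m
    obtain ⟨T, A, B, eA, eB, h₁, h₂, h₃⟩ := hD.initialFactor_merge c m
    obtain ⟨A', B', hA, hB, eA', eB', h₄, h₅, h₆, -⟩ := exists_unitWeight_merge c m
    rw [← eA] at eA'
    rw [← eB] at eB'
    subst eA' eB'
    rw [h₂, h₃, h₅]
    field_simp
  · intro s
    obtain ⟨T, A, B, h₁, h₂, h₃, h₄, h₅, h₆⟩ := hsplit s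
    rw [h₂, h₃, h₅]
    field_simp
  · intro s
    obtain ⟨T, A, B, h₁, h₂, h₃, h₄, h₅, h₆⟩ := hsplit s
    rw [h₂, h₄, h₆]
    field_simp

theorem Good.reducedSum_of_isEmpty (hD : D.Good) (c : D.PosColoring) {K : Type} [CommRing K]
    [IsEmpty D.Node] (δ : D.Piece) (w : D.Node → Corner → K) : reducedSum δ w = 1 := by
  classical
  obtain ⟨e⟩ := hD.nonempty_equiv c δ
  have h : ∀ s : D.Node → Corner, IsReducedState δ s := fun s =>
    ⟨fun x => isEmptyElim x, fun x => isEmptyElim x, fun r hr => isEmptyElim (e.symm ⟨r, hr⟩)⟩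
  simp [reducedSum, h]

/-- Transposition and conjugation by the initial factors preserve the principal minor at `d`. For a
free circle both sums consist of one empty product. -/
theorem Good.reducedSum_reverse (hD : D.Good) (c : D.PosColoring) (δ : D.Piece) :
    reducedSum (D := D.reverse) δ (fun x k => invTHom (mirrorWeight c.reverse x k))
      = reducedSum δ (unitWeight c) := by
  classical
  rcases δ with d | l
  · rw [hD.reducedSum_eq_adjugate c d (isNormalized_unitWeight c)]
    refine ((good_reverse hD).reducedSum_eq_adjugate c.reverse d
      ((isNormalized_mirrorWeight c.reverse).map invTHom)).trans ?_
    have ht := hD.isTransposed c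
    let N : Matrix D.Arc D.Arc (RatFunc ℚ) :=
      walkMatrix (D := D.reverse) fun x k => invTHom (mirrorWeight c.reverse x k)
    have := adjugate_diag_conj_transpose (1 - walkMatrix (unitWeight c))
      (fun a => initialFactor c (.inl a)) (fun a => initialFactor_ne_zero hD c _)
      (1 - N) (fun a b => by
          rw [Matrix.sub_apply, Matrix.sub_apply, sub_mul, mul_sub, ← ht.walk_eq a b]
          congr 1
          by_cases hab : a = b
          · subst hab
            rw [Matrix.one_apply_eq, mul_comm]
          · rw [Matrix.one_apply_ne hab, Matrix.one_apply_ne (Ne.symm hab), zero_mul, mul_zero]) d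
    exact this
  · have hA : IsEmpty D.Arc := (hD.loop_cases.resolve_left fun h => h.elim l).1
    have := isEmpty_node_of_arc hA
    have := isEmpty_node_of_arc (D := D.reverse) hA
    rw [hD.reducedSum_of_isEmpty c]
    exact (good_reverse hD).reducedSum_of_isEmpty c.reverse _ _

/-- Reversal negates the index and the rotation, and `t ↦ t⁻¹` undoes this. So, unlike for the
mirror image alone, no power of `t` has to be compensated, only two signs. -/
theorem Good.alexander_reverse_mirror (hD : D.Good) (c : D.PosColoring) (δ : D.Piece) :
    alexander c δ = invT (alexander (D := D.reverse.mirror) c.reverse.mirror δ) := by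
  have hR := good_reverse hD
  have h₀ := Good.alexander_eq (D := D.reverse.mirror) c.reverse.mirror hR δ
  rw [hD.alexander_eq]
  refine Eq.trans ?_ (congrArg invT h₀).symm
  have hZ : invTHom (reducedSum (D := D.reverse.mirror) δ (unitWeight c.reverse.mirror))
      = reducedSum δ (unitWeight c) := by
    rw [← hD.reducedSum_reverse]
    exact (congrArg invTHom (reducedSum_mirror (D := D.reverse) δ (mirrorWeight c.reverse))).trans
      (invTHom_reducedSum (D := D.reverse) δ (mirrorWeight c.reverse))
  have h₁ : invTHom (initialFactor c.reverse.mirror δ) = - initialFactor c δ := by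
    have h₂ : initialFactor c.reverse.mirror δ
        = tq (4 * index c.reverse (D.leftR δ)) - tq (4 * index c.reverse (D.rightR δ)) := rfl
    rw [h₂, hD.index_reverse, map_sub, invTHom_tq, invTHom_tq, initialFactor]
    simp only [mul_neg, neg_neg, neg_sub]
  have h₃ : rotation (D := D.reverse.mirror) (index c.reverse.mirror) = - rotation (index c) := by
    refine (rotation_mirror (D := D.reverse) (index c.reverse)).trans ?_
    rw [hD.index_reverse]
    exact rotation_reverse _
  rw [invT_eq, map_div₀, map_mul, map_mul, invTHom_commonFactor_mirror, commonFactor_reverse, hZ,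
    h₁, h₃, invTHom_tq, mul_neg, neg_neg, neg_mul, neg_mul, neg_div_neg_eq]

/-! ### The theorem -/

theorem alexander_eq_invT_mirror (c : D.PosColoring) (δ δ' : D.Piece) :
    alexander c δ = invT (alexander (D := D.mirror) c.mirror δ') := by
  by_cases hD : D.Good
  · rw [hD.alexander_eq_alexander c δ δ']
    exact hD.alexander_mirror c δ'
  · have h : alexander (D := D.mirror) c.mirror δ' = 0 := alexander_eq_zero (D := D.mirror) _ hD _
    rw [alexander_eq_zero c hD, h, invT_eq, map_zero]

theorem good_reverse_iff : D.reverse.Good ↔ D.Good := by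
  refine ⟨fun h => ?_, good_reverse⟩
  have := good_reverse h
  unfold Good at *
  exact this

/-- Both diagrams are compared with the reversed mirror image at `t⁻¹`: `D` by transposition, the
reversed diagram by the mirror formula. -/
theorem alexander_eq_reverse (c : D.PosColoring) (δ δ' : D.Piece) :
    alexander c δ = alexander (D := D.reverse) c.reverse δ' := by
  by_cases hD : D.Good
  · rw [hD.alexander_eq_alexander c δ δ', hD.alexander_reverse_mirror]
    exact (alexander_eq_invT_mirror (D := D.reverse) c.reverse δ' δ').symm
  · rw [alexander_eq_zero c hD]
    exact (alexander_eq_zero (D := D.reverse) c.reverse (fun h => hD (good_reverse_iff.1 h)) δ').symm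

/-- Without crossings only the weights at merges occur, which the mirror image does not change, and
the framing factors are trivial. -/
theorem alexander_mirror_of_isPlanar (hp : D.IsPlanar) (c : D.PosColoring) (δ : D.Piece) :
    alexander (D := D.mirror) c.mirror δ = alexander c δ := by
  by_cases hD : D.Good
  · have h := Good.alexander_eq (D := D.mirror) c.mirror hD δ
    have hw : mirrorWeight c = unitWeight c := by
      funext x k
      rcases x with x | m
      · exact hp.1.elim x
      · exact mirrorWeight_merge c m k
    have h₁ : reducedSum (D := D.mirror) δ (unitWeight c.mirror) = reducedSum δ (unitWeight c) :=
      (reducedSum_mirror δ (mirrorWeight c)).trans (by rw [hw])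
    have h₂ : rotation (D := D.mirror) (index c.mirror) = rotation (index c) := rotation_mirror _
    have h₃ : framing c.mirror = framing c := by
      refine Finset.prod_congr rfl fun e _ => congrArg tq ?_
      change c.color e * ((D.negTwist e : ℤ) - (D.posTwist e : ℤ)) = _
      rw [hp.2 e]
    have h₄ : commonFactor c.mirror = commonFactor c := by
      rw [commonFactor, h₃]
      rfl
    have h₅ : initialFactor c.mirror δ = initialFactor c δ := rfl
    rw [hD.alexander_eq, h, h₁, h₂, h₄, h₅]
  · rw [alexander_eq_zero c hD]
    exact alexander_eq_zero (D := D.mirror) c.mirror hD δ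

end Diagram

end MOY

theorem proposition5p1 (D : MOY.Diagram) (c : D.PosColoring) :
    (∀ δ δ' : D.Piece,
      MOY.Diagram.alexander c δ = MOY.invT (MOY.Diagram.alexander (D := D.mirror) c.mirror δ')) ∧
    (∀ δ δ' : D.Piece,
      MOY.Diagram.alexander c δ = MOY.Diagram.alexander (D := D.reverse) c.reverse δ') ∧
    (D.IsPlanar → ∀ δ δ' : D.Piece,
      MOY.Diagram.alexander c δ = MOY.invT (MOY.Diagram.alexander c δ')) := by
  refine ⟨MOY.Diagram.alexander_eq_invT_mirror c, MOY.Diagram.alexander_eq_reverse c,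
    fun hp δ δ' => ?_⟩
  rw [← MOY.Diagram.alexander_mirror_of_isPlanar hp c δ']
  exact MOY.Diagram.alexander_eq_invT_mirror c δ δ'
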